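/- Let $M$ be a smooth paracompact $n$-manifold and $(x^\mu,y^a)$ the induced charts of $TM$. Let $N^a_\mu(x,y)$ be a nonlinear connection, $\delta_\mu=\partial_\mu-N^a_\mu\dot\partial_a$ with $\dot\partial_a=\partial/\partial y^a$, and let $R^a_{\mu\nu}=\delta_\nu N^a_\mu-\delta_\mu N^a_\nu$ be its curvature. Let $\lambda_i=\lambda_i^\alpha\delta_\alpha+\lambda_i^a\dot\partial_a$ $(i=1,\dots,n)$ be vector fields on $TM$ with $(\lambda_i^\alpha)$, $(\lambda_i^a)$ invertible and inverse matrices $(\lambda_{i\alpha})$, $(\lambda_{ia})$ (an EAP-space; the splitting may be defined on $TM$ or only off the null section; repeated indices, including $i,j$, are summed). Put $g_{\mu\nu}=\lambda_{i\mu}\lambda_{i\nu}$, $g^{\mu\nu}=\lambda_i^\mu\lambda_i^\nu$, and raise and lower horizontal indices with these. The canonical $d$-connection has coefficients $\Gamma^\alpha_{\mu\nu}=\lambda_i^\alpha\delta_\nu\lambda_{i\mu}$, $\Gamma^a_{b\nu}=\lambda_i^a\delta_\nu\lambda_{ib}$, $C^\alpha_{\mu c}=\lambda_i^\alpha\dot\partial_c\lambda_{i\mu}$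 (and $C^a_{bc}=\lambda_i^a\dot\partial_c\lambda_{ib}$); a bar $|$ denotes its horizontal covariant derivative. The natural metric connection has $\mathring\Gamma^\alpha_{\mu\nu}=\frac12g^{\alpha\epsilon}(\delta_\mu g_{\epsilon\nu}+\delta_\nu g_{\epsilon\mu}-\delta_\epsilon g_{\mu\nu})$, $\mathring C^\alpha_{\mu c}=\frac12g^{\alpha\epsilon}\dot\partial_cg_{\mu\epsilon}$; $\mathring|$ denotes its horizontal covariant derivative. Its curvatures are given by $\mathring R(\delta_\mu,\delta_\nu)\delta_\beta=\mathring R^\alpha_{\beta\mu\nu}\delta_\alpha$ and $\mathring R(\dot\partial_c,\delta_\nu)\delta_\beta=\mathring P^\alpha_{\beta\nu c}\delta_\alpha$; $\mathring R_{\beta\nu}=\mathring R^\alpha_{\beta\nu\alpha}$, $\mathring{\mathcal R}=g^{\mu\nu}\mathring R_{\mu\nu}$, $\mathring G_{\mu\nu}=\mathring R_{\mu\nu}-\frac12g_{\mu\nu}\mathring{\mathcal R}$. Further let $$\Lambda^\alpha_{\mu\nu}=\Gamma^\alpha_{\mu\nu}-\Gamma^\alpha_{\nu\mu},\quad \gamma^\alpha_{\mu\nu}=\Gamma^\alpha_{\mu\nu}-\mathring\Gamma^\alpha_{\mu\nu},\quad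 \Omega^\alpha_{\mu\nu}=\gamma^\alpha_{\mu\nu}+\gamma^\alpha_{\nu\mu},\quad C_\mu=\Lambda^\alpha_{\mu\alpha},$$ $$\xi_{\mu\nu}=\gamma_{\mu\nu}{}^{\alpha}{}_{|\alpha},\quad \gamma_{\mu\nu}=C_\alpha\gamma_{\mu\nu}{}^{\alpha},\quad \eta_{\mu\nu}=C_\beta\Lambda^\beta_{\mu\nu},\quad \phi_{\mu\nu}=C_\beta\Omega^\beta_{\mu\nu},\quad \chi_{\mu\nu}=\Lambda^\alpha_{\mu\nu|\alpha},\quad \psi_{\mu\nu}=\Omega^\alpha_{\mu\nu|\alpha},$$ $$\epsilon_{\mu\nu}=C_{\mu|\nu}-C_{\nu|\mu},\quad \theta_{\mu\nu}=C_{\mu|\nu}+C_{\nu|\mu},\quad \alpha_{\mu\nu}=C_\mu C_\nu,$$ $$\kappa_{\mu\nu},\varpi_{\mu\nu}=\gamma^\beta_{\alpha\mu}\gamma^\alpha_{\nu\beta}\mp\gamma^\beta_{\mu\alpha}\gamma^\alpha_{\beta\nu},\quad \sigma_{\mu\nu}=\gamma^\beta_{\alpha\mu}\gamma^\alpha_{\beta\nu},\quad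 \omega_{\mu\nu}=\gamma^\beta_{\mu\alpha}\gamma^\alpha_{\nu\beta},$$ $\sigma=g^{\mu\nu}\sigma_{\mu\nu}$, $\varpi=g^{\mu\nu}\varpi_{\mu\nu}$, $H_{\mu\nu}=\Lambda^\alpha_{\epsilon\mu}\Lambda^\epsilon_{\alpha\nu}-C_\mu C_\nu$, $H=g^{\mu\nu}H_{\mu\nu}$, $|\lambda|=\det(\lambda_{i\beta})$, $\mathcal H=|\lambda|H$. Assume that the canonical $d$-connection is of Berwald type: $\dot\partial_bN^a_\mu=\Gamma^a_{b\mu}$ and $C^\alpha_{\mu c}=0$. Then, in every chart: 1. $\lambda_i^\alpha$, $\lambda_{i\alpha}$ and all the horizontal objects $g_{\mu\nu},g^{\mu\nu},\Gamma^\alpha_{\mu\nu},\mathring\Gamma^\alpha_{\mu\nu},\Lambda^\alpha_{\mu\nu},\gamma^\alpha_{\mu\nu},\Omega^\alpha_{\mu\nu},C_\mu$, the second rank tensors above, $\mathring R^\alpha_{\beta\mu\nu}$, $H_{\mu\nu}$, $\mathcal H$ and $E_{\mu\nu},T_{\mu\nu},F_{\mu\nu},J^\mu$ below depend on $x$ only,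 and equal the objects given by the same formulas, with $\partial_\mu$ in place of $\delta_\mu$, for the tetrad $\lambda_i^\alpha(x)$ on the base. Moreover $\mathring C^\alpha_{\mu c}=0$, $C^\alpha_{\mu c}-\mathring C^\alpha_{\mu c}=0$, $\mathring P^\alpha_{\beta\nu c}=0$, $\mathring R_{\beta\mu}=\mathring R_{\mu\beta}=-\frac12(\theta_{\beta\mu}-\psi_{\beta\mu}+\phi_{\beta\mu})+\omega_{\beta\mu}$ and $\mathring G^\mu{}_{\sigma\mathring|\mu}=0$. 2. $\mathcal H$ is a function of $\lambda_{j\beta}(x)$ and $\lambda_{j\beta,\gamma}=\partial_\gamma\lambda_{j\beta}$. With $\frac{\delta\mathcal H}{\delta\lambda_{j\beta}}=\frac{\partial\mathcal H}{\partial\lambda_{j\beta}}-\frac{\partial}{\partial x^\gamma}\frac{\partial\mathcal H}{\partial\lambda_{j\beta,\gamma}}$ one has $g_{\mu\beta}\frac1{|\lambda|}\frac{\delta\mathcal H}{\delta\lambda_{j\beta}}\lambda_{j\nu}=E_{\mu\nu}$, where $$E_{\mu\nu}=g_{\mu\nu}H-2H_{\mu\nu}-2(C_\mu C_\nu-C_{\nu|\mu})+2g_{\mu\nu}(C^\epsilon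 C_\epsilon-C^\epsilon{}_{|\epsilon})-2(C^\epsilon\Lambda_{\mu\epsilon\nu}+g^{\epsilon\alpha}\Lambda_{\mu\nu\alpha|\epsilon}).$$ So the horizontal Euler–Lagrange equations are $E_{\mu\nu}=0$; by 1 these are identical to the equations of the generalized field theory (GFT), given by the same formula for the tetrad $\lambda_i^\alpha(x)$. 3. At each point, $E_{\mu\nu}=0$ (for all $\mu,\nu$) is equivalent to the two systems $$\mathring R_{\mu\nu}-\tfrac12g_{\mu\nu}\mathring{\mathcal R}=T_{\mu\nu}:=\tfrac12g_{\mu\nu}(\sigma-\varpi)-(\sigma_{\mu\nu}-\varpi_{\mu\nu}),\qquad F_{\mu\nu}:=\gamma_{\mu\nu}-\xi_{\mu\nu}+\eta_{\mu\nu}=\partial_\nu C_\mu-\partial_\mu C_\nu.$$ 4. If $E_{\mu\nu}=0$ throughout the chart, then $T^\mu{}_{\nu\mathring|\mu}=0$ and $\mathfrak S_{\mu,\nu,\sigma}F_{\mu\nu\mathring|\sigma}=-\mathfrak S_{\mu,\nu,\sigma}R^a_{\mu\nu}\dot\partial_aC_\sigma=0$ (cyclic sums). 5. The current $J^\mu:=F^{\mu\nu}{}_{\mathring|\nu}$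 is conserved: $J^\mu{}_{\mathring|\mu}=0$. -/

import Mathlib

open scoped Manifold ContDiff

noncomputable section

namespace EAP

/-- Coordinate space `ℝⁿ`. -/
abbrev Coord (n : ℕ) : Type := Fin n → ℝ

/-- Coordinates `(x, y)` of the tangent bundle over a chart domain. -/
abbrev TCoord (n : ℕ) : Type := Coord n × Coord n

/-! ### Tensor calculus of a frame

A frame `λ_i` with contravariant components `λ_i^α`, together with the operators that play the role
of the partial derivatives. With `D μ = δ_μ` on the tangent bundle this is the horizontal
calculus of an EAP-space; with `D μ = ∂_μ` on the base it is the calculus of a conventional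
absolute parallelism (AP-) space. -/

/-- `up z i α = λ_i^α(z)`, and `D μ` is the `μ`-th derivation. -/
structure HFrame (X : Type*) (n : ℕ) where
  up : X → Fin n → Fin n → ℝ
  D : Fin n → (X → ℝ) → X → ℝ

namespace HFrame

variable {X : Type*} {n : ℕ} (S : HFrame X n)

/-- Covariant components `λ_{i β}`: the inverse matrix, `∑_i λ_i^α λ_{iβ} = δ^α_β`. -/
def down (z : X) (i β : Fin n) : ℝ := (Matrix.of (S.up z))⁻¹ β i

/-- `|λ| = det (λ_{iβ})`. -/
def detDown (z : X) : ℝ := (Matrix.of (S.down z)).det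

/-- `g_{μν} = ∑_i λ_{iμ} λ_{iν}`. -/
def g (z : X) (μ ν : Fin n) : ℝ := ∑ i, S.down z i μ * S.down z i ν

/-- `g^{μν} = ∑_i λ_i^μ λ_i^ν`. -/
def gInv (z : X) (μ ν : Fin n) : ℝ := ∑ i, S.up z i μ * S.up z i ν

/-- Trace `g^{μν} A_{μν}`. -/
def tr (A : X → Fin n → Fin n → ℝ) (z : X) : ℝ := ∑ μ, ∑ ν, S.gInv z μ ν * A z μ ν

/-- Canonical connection `Γ^α_{μν} = λ_i^α (D_ν λ_{iμ})`. -/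
def Gam (z : X) (α μ ν : Fin n) : ℝ :=
  ∑ i, S.up z i α * S.D ν (fun w => S.down w i μ) z

/-- `hh`-coefficients of the natural metric connection. -/
def Gam0 (z : X) (α μ ν : Fin n) : ℝ :=
  (1 / 2) * ∑ ε, S.gInv z α ε *
    (S.D μ (fun w => S.g w ε ν) z + S.D ν (fun w => S.g w ε μ) z - S.D ε (fun w => S.g w μ ν) z)

/-- Torsion `Λ^α_{μν} = Γ^α_{μν} - Γ^α_{νμ}`. -/
def Tor (z : X) (α μ ν : Fin n) : ℝ := S.Gam z α μ ν - S.Gam z α ν μ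

/-- Contortion `γ^α_{μν}`. -/
def gam (z : X) (α μ ν : Fin n) : ℝ := S.Gam z α μ ν - S.Gam0 z α μ ν

/-- `Ω^α_{μν} = γ^α_{μν} + γ^α_{νμ}`. -/
def Om (z : X) (α μ ν : Fin n) : ℝ := S.gam z α μ ν + S.gam z α ν μ

/-- Basic vector `C_μ = Λ^α_{μα}`. -/
def C (z : X) (μ : Fin n) : ℝ := ∑ α, S.Tor z α μ α

/-- `C^μ`. -/
def CUp (z : X) (μ : Fin n) : ℝ := ∑ ε, S.gInv z μ ε * S.C z ε

/-- `Λ_{βμν} = g_{βε} Λ^ε_{μν}`. -/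
def TorLow (z : X) (β μ ν : Fin n) : ℝ := ∑ ε, S.g z β ε * S.Tor z ε μ ν

/-- `γ_{αμν} = g_{αε} γ^ε_{μν}`. -/
def gamLow (z : X) (α μ ν : Fin n) : ℝ := ∑ ε, S.g z α ε * S.gam z ε μ ν

/-- `γ_{μν}{}^α = g^{αε} γ_{μνε}`. -/
def gamMix (z : X) (μ ν α : Fin n) : ℝ := ∑ ε, S.gInv z α ε * S.gamLow z μ ν ε

/-! Covariant derivatives for connection coefficients `K^α_{μν}` (`D_ν e_μ = K^α_{μν} e_α`);
the last index of the result is the index of differentiation. -/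

/-- Covariant derivative of `V^α`. -/
def cdU (K : X → Fin n → Fin n → Fin n → ℝ) (V : X → Fin n → ℝ) (z : X) (α μ : Fin n) : ℝ :=
  S.D μ (fun w => V w α) z + ∑ ε, V z ε * K z α ε μ

/-- Covariant derivative of `W_α`. -/
def cdD (K : X → Fin n → Fin n → Fin n → ℝ) (W : X → Fin n → ℝ) (z : X) (α μ : Fin n) : ℝ :=
  S.D μ (fun w => W w α) z - ∑ ε, W z ε * K z ε α μ

/-- Covariant derivative of `A^{αβ}`. -/
def cdUU (K : X → Fin n → Fin n → Fin n → ℝ) (A : X → Fin n → Fin n → ℝ) (z : X)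
    (α β μ : Fin n) : ℝ :=
  S.D μ (fun w => A w α β) z + ∑ ε, A z ε β * K z α ε μ + ∑ ε, A z α ε * K z β ε μ

/-- Covariant derivative of `A^α_β`. -/
def cdUD (K : X → Fin n → Fin n → Fin n → ℝ) (A : X → Fin n → Fin n → ℝ) (z : X)
    (α β μ : Fin n) : ℝ :=
  S.D μ (fun w => A w α β) z + ∑ ε, A z ε β * K z α ε μ - ∑ ε, A z α ε * K z ε β μ

/-- Covariant derivative of `A_{αβ}`. -/
def cdDD (K : X → Fin n → Fin n → Fin n → ℝ) (A : X → Fin n → Fin n → ℝ) (z : X)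
    (α β μ : Fin n) : ℝ :=
  S.D μ (fun w => A w α β) z - ∑ ε, A z ε β * K z ε α μ - ∑ ε, A z α ε * K z ε β μ

/-- Covariant derivative of `A^α_{βσ}`. -/
def cdUDD (K : X → Fin n → Fin n → Fin n → ℝ) (A : X → Fin n → Fin n → Fin n → ℝ) (z : X)
    (α β σ μ : Fin n) : ℝ :=
  S.D μ (fun w => A w α β σ) z + ∑ ε, A z ε β σ * K z α ε μ
    - ∑ ε, A z α ε σ * K z ε β μ - ∑ ε, A z α β ε * K z ε σ μ

/-- Covariant derivative of `A_{αβσ}`. -/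
def cdDDD (K : X → Fin n → Fin n → Fin n → ℝ) (A : X → Fin n → Fin n → Fin n → ℝ) (z : X)
    (α β σ μ : Fin n) : ℝ :=
  S.D μ (fun w => A w α β σ) z - ∑ ε, A z ε β σ * K z ε α μ
    - ∑ ε, A z α ε σ * K z ε β μ - ∑ ε, A z α β ε * K z ε σ μ

/-- Covariant derivative of `A_{αβ}{}^σ`. -/
def cdDDU (K : X → Fin n → Fin n → Fin n → ℝ) (A : X → Fin n → Fin n → Fin n → ℝ) (z : X)
    (α β σ μ : Fin n) : ℝ :=
  S.D μ (fun w => A w α β σ) z - ∑ ε, A z ε β σ * K z ε α μ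
    - ∑ ε, A z α ε σ * K z ε β μ + ∑ ε, A z α β ε * K z σ ε μ

/-! Fundamental second rank tensors. A bar `|` is the canonical connection `Γ`. -/

/-- `ξ_{μν} = γ_{μν}{}^α{}_{|α}`. -/
def xi (z : X) (μ ν : Fin n) : ℝ := ∑ α, S.cdDDU S.Gam S.gamMix z μ ν α α

/-- `γ_{μν} = C_α γ_{μν}{}^α`. -/
def gam2 (z : X) (μ ν : Fin n) : ℝ := ∑ α, S.C z α * S.gamMix z μ ν α

/-- `η_{μν} = C_β Λ^β_{μν}`. -/
def eta (z : X) (μ ν : Fin n) : ℝ := ∑ β, S.C z β * S.Tor z β μ ν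

/-- `φ_{μν} = C_β Ω^β_{μν}`. -/
def phi (z : X) (μ ν : Fin n) : ℝ := ∑ β, S.C z β * S.Om z β μ ν

/-- `χ_{μν} = Λ^α_{μν|α}`. -/
def chi (z : X) (μ ν : Fin n) : ℝ := ∑ α, S.cdUDD S.Gam S.Tor z α μ ν α

/-- `ψ_{μν} = Ω^α_{μν|α}`. -/
def psi (z : X) (μ ν : Fin n) : ℝ := ∑ α, S.cdUDD S.Gam S.Om z α μ ν α

/-- `ε_{μν} = C_{μ|ν} - C_{ν|μ}`. -/
def eps (z : X) (μ ν : Fin n) : ℝ := S.cdD S.Gam S.C z μ ν - S.cdD S.Gam S.C z ν μ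

/-- `θ_{μν} = C_{μ|ν} + C_{ν|μ}`. -/
def theta (z : X) (μ ν : Fin n) : ℝ := S.cdD S.Gam S.C z μ ν + S.cdD S.Gam S.C z ν μ

/-- `κ_{μν} = γ^β_{αμ} γ^α_{νβ} - γ^β_{μα} γ^α_{βν}`. -/
def kappa (z : X) (μ ν : Fin n) : ℝ :=
  ∑ α, ∑ β, (S.gam z β α μ * S.gam z α ν β - S.gam z β μ α * S.gam z α β ν)

/-- `ϖ_{μν} = γ^β_{αμ} γ^α_{νβ} + γ^β_{μα} γ^α_{βν}`. -/
def varpi (z : X) (μ ν : Fin n) : ℝ :=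
  ∑ α, ∑ β, (S.gam z β α μ * S.gam z α ν β + S.gam z β μ α * S.gam z α β ν)

/-- `σ_{μν} = γ^β_{αμ} γ^α_{βν}`. -/
def sigma (z : X) (μ ν : Fin n) : ℝ := ∑ α, ∑ β, S.gam z β α μ * S.gam z α β ν

/-- `ω_{μν} = γ^β_{μα} γ^α_{νβ}`. -/
def omega (z : X) (μ ν : Fin n) : ℝ := ∑ α, ∑ β, S.gam z β μ α * S.gam z α ν β

/-- `α_{μν} = C_μ C_ν`. -/
def alpha (z : X) (μ ν : Fin n) : ℝ := S.C z μ * S.C z ν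

/-! Lagrangian, field equations and physical tensors. -/

/-- `H_{μν} = Λ^α_{εμ} Λ^ε_{αν} - C_μ C_ν`. -/
def H (z : X) (μ ν : Fin n) : ℝ :=
  (∑ α, ∑ ε, S.Tor z α ε μ * S.Tor z ε α ν) - S.C z μ * S.C z ν

/-- Scalar Lagrangian `|λ| g^{μν} H_{μν}`. -/
def Lag (z : X) : ℝ := S.detDown z * S.tr S.H z

/-- The tensor
`E_{μν} = g_{μν} H - 2 H_{μν} - 2 (C_μ C_ν - C_{ν|μ}) + 2 g_{μν} (C^ε C_ε - C^ε{}_{|ε})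
  - 2 (C^ε Λ_{μεν} + g^{εα} Λ_{μνα|ε})`. -/
def E (z : X) (μ ν : Fin n) : ℝ :=
  S.g z μ ν * S.tr S.H z - 2 * S.H z μ ν
    - 2 * (S.C z μ * S.C z ν - S.cdD S.Gam S.C z ν μ)
    + 2 * S.g z μ ν * ((∑ ε, S.CUp z ε * S.C z ε) - ∑ ε, S.cdU S.Gam S.CUp z ε ε)
    - 2 * ((∑ ε, S.CUp z ε * S.TorLow z μ ε ν)
        + ∑ ε, ∑ α, S.gInv z ε α * S.cdDDD S.Gam S.TorLow z μ ν α ε)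

/-- `T_{μν} = ½ g_{μν} (σ - ϖ) - (σ_{μν} - ϖ_{μν})`. -/
def T (z : X) (μ ν : Fin n) : ℝ :=
  (1 / 2) * S.g z μ ν * (S.tr S.sigma z - S.tr S.varpi z) - (S.sigma z μ ν - S.varpi z μ ν)

/-- `F_{μν} = γ_{μν} - ξ_{μν} + η_{μν}`. -/
def F (z : X) (μ ν : Fin n) : ℝ := S.gam2 z μ ν - S.xi z μ ν + S.eta z μ ν

/-- `F^{μν}`. -/
def FUp (z : X) (μ ν : Fin n) : ℝ :=
  ∑ α, ∑ β, S.gInv z μ α * S.gInv z ν β * S.F z α β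

/-- Raise the first index of `A_{μν}`. -/
def raise (A : X → Fin n → Fin n → ℝ) (z : X) (μ ν : Fin n) : ℝ :=
  ∑ ε, S.gInv z μ ε * A z ε ν

/-- Divergence `A^μ{}_ν` with respect to `μ`, for the natural metric connection, where
`A^μ{}_ν = g^{με} A_{εν}`. -/
def div0 (A : X → Fin n → Fin n → ℝ) (z : X) (ν : Fin n) : ℝ :=
  ∑ μ, S.cdUD S.Gam0 (S.raise A) z μ ν μ

/-- Current `J^μ`: divergence of `F^{μν}` in `ν` for the natural metric connection. -/
def J (z : X) (μ : Fin n) : ℝ := ∑ ν, S.cdUU S.Gam0 S.FUp z μ ν ν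

/-- Divergence of the current for the natural metric connection. -/
def divJ (z : X) : ℝ := ∑ μ, S.cdU S.Gam0 S.J z μ μ

/-- Cyclic sum of the natural covariant derivatives of `F`. -/
def cycF (z : X) (μ ν σ : Fin n) : ℝ :=
  S.cdDD S.Gam0 S.F z μ ν σ + S.cdDD S.Gam0 S.F z ν σ μ + S.cdDD S.Gam0 S.F z σ μ ν

/-- `D_μ Γ°^α_{βν} - D_ν Γ°^α_{βμ} + Γ°^ε_{βν} Γ°^α_{εμ} - Γ°^ε_{βμ} Γ°^α_{εν}`: the components
`R^α_{βμν}` of `R(D_μ, D_ν) e_β` when the derivations commute. -/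
def curv0 (z : X) (α β μ ν : Fin n) : ℝ :=
  S.D μ (fun w => S.Gam0 w α β ν) z - S.D ν (fun w => S.Gam0 w α β μ) z
    + ∑ ε, (S.Gam0 z ε β ν * S.Gam0 z α ε μ - S.Gam0 z ε β μ * S.Gam0 z α ε ν)

/-- Ricci contraction `R_{βν} = R^α_{βνα}`. -/
def ricci (K : X → Fin n → Fin n → Fin n → Fin n → ℝ) (z : X) (β ν : Fin n) : ℝ :=
  ∑ α, K z α β ν α

/-- Einstein tensor `R_{μν} - ½ g_{μν} R` of a curvature `K`. -/
def einstein (K : X → Fin n → Fin n → Fin n → Fin n → ℝ) (z : X) (μ ν : Fin n) : ℝ :=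
  ricci K z μ ν - (1 / 2) * S.g z μ ν * S.tr (ricci K) z

end HFrame

/-- The conventional AP-calculus of a tetrad `ℓ x i α = λ_i^α(x)` on an open set of `ℝⁿ`;
`(apFrame ℓ).E` is the left-hand side of the field equations of the GFT. -/
def apFrame {n : ℕ} (ℓ : Coord n → Fin n → Fin n → ℝ) : HFrame (Coord n) n where
  up := ℓ
  D := fun μ f x => fderiv ℝ f x (Pi.single μ 1)

/-! ### The Lagrangian on first jets and its Euler–Lagrange expression

For fields `λ_{jβ}(x)`, the variables are `U j β = λ_{jβ}` and `P j β γ = λ_{jβ,γ}`. -/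

/-- `|λ| g^{μν} (Λ^α_{εμ} Λ^ε_{αν} - C_μ C_ν)` with `Λ^α_{μν} = λ_j^α (λ_{jμ,ν} - λ_{jν,μ})`. -/
def jetLagrangian {n : ℕ} (U : Fin n → Fin n → ℝ) (P : Fin n → Fin n → Fin n → ℝ) : ℝ :=
  let up : Fin n → Fin n → ℝ := fun j α => (Matrix.of U)⁻¹ α j
  let gInv : Fin n → Fin n → ℝ := fun μ ν => ∑ j, up j μ * up j ν
  let Tor : Fin n → Fin n → Fin n → ℝ := fun α μ ν => ∑ j, up j α * (P j μ ν - P j ν μ)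
  let C : Fin n → ℝ := fun μ => ∑ α, Tor α μ α
  (Matrix.of U).det *
    ∑ μ, ∑ ν, gInv μ ν * ((∑ α, ∑ ε, Tor α ε μ * Tor ε α ν) - C μ * C ν)

/-- `jet B x j β γ = ∂_γ B_{jβ}(x)`. -/
def jet {n : ℕ} (B : Coord n → Fin n → Fin n → ℝ) (x : Coord n) (j β γ : Fin n) : ℝ :=
  fderiv ℝ (fun w => B w j β) x (Pi.single γ 1)

/-- `δ𝓗/δλ_{jβ} = ∂𝓗/∂λ_{jβ} - ∂_γ (∂𝓗/∂λ_{jβ,γ})` along the field `B = (λ_{jβ}(x))`. -/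
def eulerLagrange {n : ℕ} (B : Coord n → Fin n → Fin n → ℝ) (x : Coord n) (j β : Fin n) : ℝ :=
  fderiv ℝ (fun U : Fin n → Fin n → ℝ => jetLagrangian U (jet B x)) (B x)
      (Pi.single j (Pi.single β 1))
    - ∑ γ, fderiv ℝ (fun w : Coord n =>
        fderiv ℝ (fun P : Fin n → Fin n → Fin n → ℝ => jetLagrangian (B w) P) (jet B w)
          (Pi.single j (Pi.single β (Pi.single γ 1)))) x (Pi.single γ 1)

/-! ### EAP-spaces in a chart -/

/-- `∂_μ = ∂/∂x^μ`. -/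
def pdx {n : ℕ} (μ : Fin n) (f : TCoord n → ℝ) (z : TCoord n) : ℝ :=
  fderiv ℝ f z (Pi.single μ 1, 0)

/-- `∂̇_a = ∂/∂y^a`. -/
def pdy {n : ℕ} (a : Fin n) (f : TCoord n → ℝ) (z : TCoord n) : ℝ :=
  fderiv ℝ f z (0, Pi.single a 1)

/-- Components in one chart: `N z a μ = N^a_μ`, `hUp z i α = λ_i^α`, `vUp z i a = λ_i^a`. -/
structure LocalEAP (n : ℕ) where
  N : TCoord n → Fin n → Fin n → ℝ
  hUp : TCoord n → Fin n → Fin n → ℝ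
  vUp : TCoord n → Fin n → Fin n → ℝ

namespace LocalEAP

variable {n : ℕ} (S : LocalEAP n)

/-- `δ_μ = ∂_μ - N^a_μ ∂̇_a`. -/
def delta (μ : Fin n) (f : TCoord n → ℝ) (z : TCoord n) : ℝ :=
  pdx μ f z - ∑ a, S.N z a μ * pdy a f z

/-- The horizontal calculus of the EAP-space. -/
def hor : HFrame (TCoord n) n where
  up := S.hUp
  D := S.delta

/-- `λ_{ib}`. -/
def vDown (z : TCoord n) (i b : Fin n) : ℝ := (Matrix.of (S.vUp z))⁻¹ b i

/-- `Γ^a_{bν} = λ_i^a (δ_ν λ_{ib})`. -/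
def GamV (z : TCoord n) (a b ν : Fin n) : ℝ :=
  ∑ i, S.vUp z i a * S.delta ν (fun w => S.vDown w i b) z

/-- `C^α_{μc} = λ_i^α (∂̇_c λ_{iμ})`. -/
def CH (z : TCoord n) (α μ c : Fin n) : ℝ :=
  ∑ i, S.hUp z i α * pdy c (fun w => S.hor.down w i μ) z

/-- `C°^α_{μc} = ½ g^{αε} ∂̇_c g_{με}`. -/
def CH0 (z : TCoord n) (α μ c : Fin n) : ℝ :=
  (1 / 2) * ∑ ε, S.hor.gInv z α ε * pdy c (fun w => S.hor.g w μ ε) z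

/-- Curvature of the nonlinear connection, `R^a_{μν} = δ_ν N^a_μ - δ_μ N^a_ν`. -/
def RN (z : TCoord n) (a μ ν : Fin n) : ℝ :=
  S.delta ν (fun w => S.N w a μ) z - S.delta μ (fun w => S.N w a ν) z

/-- `R°^α_{βμν}`, the horizontal curvature `R°(δ_μ, δ_ν) δ_β = R°^α_{βμν} δ_α` of the natural
metric connection, using `[δ_μ, δ_ν] = R^a_{μν} ∂̇_a`. -/
def curvH (z : TCoord n) (α β μ ν : Fin n) : ℝ :=
  S.hor.curv0 z α β μ ν - ∑ a, S.RN z a μ ν * S.CH0 z α β a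

/-- `P°^α_{βνc}`, the mixed curvature `R°(∂̇_c, δ_ν) δ_β = P°^α_{βνc} δ_α` of the natural metric
connection, using `[∂̇_c, δ_ν] = - (∂̇_c N^a_ν) ∂̇_a`. -/
def curvP (z : TCoord n) (α β ν c : Fin n) : ℝ :=
  pdy c (fun w => S.hor.Gam0 w α β ν) z - S.delta ν (fun w => S.CH0 w α β c) z
    + ∑ ε, (S.hor.Gam0 z ε β ν * S.CH0 z α ε c - S.CH0 z ε β c * S.hor.Gam0 z α ε ν)
    + ∑ a, pdy c (fun w => S.N w a ν) z * S.CH0 z α β a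

end LocalEAP

/-! ### EAP-spaces on a manifold -/

/-- `∂f^a/∂x^b`. -/
def jac {n : ℕ} (f : Coord n → Coord n) (x : Coord n) (a b : Fin n) : ℝ :=
  fderiv ℝ f x (Pi.single b 1) a

/-- An EAP-space `(TM, λ)` with nonlinear connection `N`, given by components in all charts of `M`.

The `fibre` of admissible directions `y` contains all `y ≠ 0`: it is either all of `ℝⁿ` (everything
lives on `TM`) or `ℝⁿ ∖ {0}` (the horizontal-vertical splitting lives off the null section). The
components `λ_i^α = dx^α(λ_i)` do not involve `N` and are smooth on the whole of `TM`. -/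
structure EAPSpace (n : ℕ) (M : Type*) [TopologicalSpace M] [ChartedSpace (Coord n) M] where
  fibre : Set (Coord n)
  mem_fibre_of_ne_zero : ∀ y : Coord n, y ≠ 0 → y ∈ fibre
  /-- components in the chart `e` -/
  loc : OpenPartialHomeomorph M (Coord n) → LocalEAP n
  smooth_hUp : ∀ e ∈ IsManifold.maximalAtlas 𝓘(ℝ, Coord n) ∞ M, ∀ i α,
    ContDiffOn ℝ ∞ (fun z => (loc e).hUp z i α) (e.target ×ˢ Set.univ)
  smooth_vUp : ∀ e ∈ IsManifold.maximalAtlas 𝓘(ℝ, Coord n) ∞ M, ∀ i a,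
    ContDiffOn ℝ ∞ (fun z => (loc e).vUp z i a) (e.target ×ˢ fibre)
  smooth_N : ∀ e ∈ IsManifold.maximalAtlas 𝓘(ℝ, Coord n) ∞ M, ∀ a μ,
    ContDiffOn ℝ ∞ (fun z => (loc e).N z a μ) (e.target ×ˢ fibre)
  indep_h : ∀ e ∈ IsManifold.maximalAtlas 𝓘(ℝ, Coord n) ∞ M, ∀ z ∈ e.target ×ˢ fibre,
    (Matrix.of ((loc e).hUp z)).det ≠ 0
  indep_v : ∀ e ∈ IsManifold.maximalAtlas 𝓘(ℝ, Coord n) ∞ M, ∀ z ∈ e.target ×ˢ fibre,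
    (Matrix.of ((loc e).vUp z)).det ≠ 0
  /-- `λ_i^{α'} = p^{α'}_α λ_i^α` -/
  trans_h : ∀ e ∈ IsManifold.maximalAtlas 𝓘(ℝ, Coord n) ∞ M,
    ∀ e' ∈ IsManifold.maximalAtlas 𝓘(ℝ, Coord n) ∞ M,
    ∀ x ∈ (e.symm.trans e').source, ∀ (y : Coord n) (i α' : Fin n),
      (loc e').hUp (e' (e.symm x), fderiv ℝ (e.symm.trans e') x y) i α'
        = ∑ α, jac (e.symm.trans e') x α' α * (loc e).hUp (x, y) i α
  /-- `λ_i^{a'} = p^{a'}_a λ_i^a` -/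
  trans_v : ∀ e ∈ IsManifold.maximalAtlas 𝓘(ℝ, Coord n) ∞ M,
    ∀ e' ∈ IsManifold.maximalAtlas 𝓘(ℝ, Coord n) ∞ M,
    ∀ x ∈ (e.symm.trans e').source, ∀ y ∈ fibre, ∀ i a' : Fin n,
      (loc e').vUp (e' (e.symm x), fderiv ℝ (e.symm.trans e') x y) i a'
        = ∑ a, jac (e.symm.trans e') x a' a * (loc e).vUp (x, y) i a
  /-- `N^{a'}_{α'} = p^{a'}_a p^α_{α'} N^a_α + p^{a'}_a p^a_{c'α'} y^{c'}` -/
  trans_N : ∀ e ∈ IsManifold.maximalAtlas 𝓘(ℝ, Coord n) ∞ M,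
    ∀ e' ∈ IsManifold.maximalAtlas 𝓘(ℝ, Coord n) ∞ M,
    ∀ x ∈ (e.symm.trans e').source, ∀ y ∈ fibre, ∀ a' α' : Fin n,
      (loc e').N (e' (e.symm x), fderiv ℝ (e.symm.trans e') x y) a' α'
        = (∑ a, ∑ α, jac (e.symm.trans e') x a' a
              * jac (e'.symm.trans e) (e' (e.symm x)) α α' * (loc e).N (x, y) a α)
          + ∑ a, ∑ c, jac (e.symm.trans e') x a' a
              * fderiv ℝ (fun w => jac (e'.symm.trans e) w a c) (e' (e.symm x)) (Pi.single α' 1)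
              * fderiv ℝ (e.symm.trans e') x y c

/-- The canonical `d`-connection is of Berwald type:
`∂̇_b N^a_μ = Γ^a_{bμ}` and `C^α_{μc} = 0`. -/
def EAPSpace.IsBerwald {n : ℕ} {M : Type*} [TopologicalSpace M] [ChartedSpace (Coord n) M]
    (S : EAPSpace n M) : Prop :=
  ∀ e ∈ IsManifold.maximalAtlas 𝓘(ℝ, Coord n) ∞ M, ∀ z ∈ e.target ×ˢ S.fibre,
    (∀ a b μ, pdy b (fun w => (S.loc e).N w a μ) z = (S.loc e).GamV z a b μ) ∧
    (∀ α μ c, (S.loc e).CH z α μ c = 0)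

end EAP

end

noncomputable section

namespace EAP

/-! Since `λ_i^α` is invertible, `C^α_{μc} = 0` says that the vertical derivatives of `λ_{iμ}`
vanish. Hence the horizontal frame is constant along every ray `t ↦ (x, t y)`, `t > 0`, and
smoothness across the null section identifies its value on each ray with its value at `y = 0`
(`LocalEAP.hUp_eq_of_CH_eq_zero`). So the frame is a tetrad `ℓ(x)` on the base. On functions of `x`
alone `δ_μ` acts as `∂_μ`, whatever `N` is, so the horizontal calculus is the absolute parallelism
calculus of `ℓ`, and every term with a vertical derivative drops out.

What remains is a set of identities for a tetrad on an open set. They are proved in a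
`DifferentialFrame`, a commutative algebra with commuting derivations, where an identity is an
equality of ring elements and may be differentiated. The algebra used is that of smooth functions on
the chart domain; `HFrame.Realizes` carries the results back to points of the base and of the
tangent bundle.

In the algebra everything is expressed in the frame. There the metric is the identity matrix and the
frame is parallel for `Γ`, so a bar derivative is the ordinary derivative of frame components. All
tensors become polynomials in the frame contortion `ct i j k`, which is skew in `i, j`, and its
frame derivatives. The connection `Γ°` is the gauge transform by the frame of the skew matrix-valued
form `-w`; this yields the curvature, its symmetries, the Ricci formula and the second Bianchi
identity. Symmetry of Ricci, read in frame components, is a relation between the curl of `C` and the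
divergence of the torsion (`e_cc_sub`). With it, `E = -2 (G - T) + 2 (F - curl C)` (`E_split`): the
first bracket is symmetric and the second skew, so `E = 0` separates into the two systems. The
conservation of `T` is then the contracted Bianchi identity, and the cyclic identity is `d² = 0`.
The current is conserved identically, as a double divergence of a skew tensor.

For the variational statement, the Lagrangian is `|λ|` times a quadratic form in the frame torsion.
Its partial derivatives are computed along lines in jet space. The divergence of the momentum is
evaluated from the commutators of the frame fields and from `∂_γ (|λ| λ_b^γ) = -|λ| c_b`, and
`e_cc_sub` again matches the result with `E` (`euler_eq`). -/

/-- An absolute parallelism over an abstract commutative algebra `R` of functions, with commuting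
derivations `d μ` as partial derivatives. -/
structure DifferentialFrame (R : Type*) [CommRing R] [Algebra ℝ R] (n : ℕ) where
  up : Fin n → Fin n → R
  dn : Fin n → Fin n → R
  d : Fin n → Derivation ℝ R R
  d_comm : ∀ μ ν f, d μ (d ν f) = d ν (d μ f)
  sum_up_dn : ∀ α β, ∑ i, up i α * dn i β = if α = β then 1 else 0
  sum_dn_up : ∀ i j, ∑ α, dn i α * up j α = if i = j then 1 else 0

/-! ### Tensors of an absolute parallelism as elements of the function algebra -/

namespace DifferentialFrame

variable {R : Type*} [CommRing R] [Algebra ℝ R] {n : ℕ} (A : DifferentialFrame R n)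

variable (R) in
/-- The scalar `1 / 2` of an `ℝ`-algebra. -/
def half : R := algebraMap ℝ R (1 / 2)

/-- `half R` is opaque to `ring`, so this relation is what cancels factors of one half inside
`linear_combination`. -/
theorem two_mul_half : 2 * half R = 1 := by
  have : (2 : R) = algebraMap ℝ R 2 := (map_ofNat (algebraMap ℝ R) 2).symm
  rw [half, this, ← map_mul]; norm_num

def detDown : R := (Matrix.of A.dn).det

def g (μ ν : Fin n) : R := ∑ i, A.dn i μ * A.dn i ν

def gInv (μ ν : Fin n) : R := ∑ i, A.up i μ * A.up i ν

def tr (a : Fin n → Fin n → R) : R := ∑ μ, ∑ ν, A.gInv μ ν * a μ ν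

def Gam (α μ ν : Fin n) : R := ∑ i, A.up i α * A.d ν (A.dn i μ)

def Gam0 (α μ ν : Fin n) : R :=
  half R * ∑ ε, A.gInv α ε * (A.d μ (A.g ε ν) + A.d ν (A.g ε μ) - A.d ε (A.g μ ν))

def Tor (α μ ν : Fin n) : R := A.Gam α μ ν - A.Gam α ν μ

def gam (α μ ν : Fin n) : R := A.Gam α μ ν - A.Gam0 α μ ν

def Om (α μ ν : Fin n) : R := A.gam α μ ν + A.gam α ν μ

def C (μ : Fin n) : R := ∑ α, A.Tor α μ α

def CUp (μ : Fin n) : R := ∑ ε, A.gInv μ ε * A.C ε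

def TorLow (β μ ν : Fin n) : R := ∑ ε, A.g β ε * A.Tor ε μ ν

def gamLow (α μ ν : Fin n) : R := ∑ ε, A.g α ε * A.gam ε μ ν

def gamMix (μ ν α : Fin n) : R := ∑ ε, A.gInv α ε * A.gamLow μ ν ε

def cdU (K : Fin n → Fin n → Fin n → R) (V : Fin n → R) (α μ : Fin n) : R :=
  A.d μ (V α) + ∑ ε, V ε * K α ε μ

def cdD (K : Fin n → Fin n → Fin n → R) (W : Fin n → R) (α μ : Fin n) : R :=
  A.d μ (W α) - ∑ ε, W ε * K ε α μ

def cdUU (K : Fin n → Fin n → Fin n → R) (a : Fin n → Fin n → R) (α β μ : Fin n) : R :=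
  A.d μ (a α β) + ∑ ε, a ε β * K α ε μ + ∑ ε, a α ε * K β ε μ

def cdUD (K : Fin n → Fin n → Fin n → R) (a : Fin n → Fin n → R) (α β μ : Fin n) : R :=
  A.d μ (a α β) + ∑ ε, a ε β * K α ε μ - ∑ ε, a α ε * K ε β μ

def cdDD (K : Fin n → Fin n → Fin n → R) (a : Fin n → Fin n → R) (α β μ : Fin n) : R :=
  A.d μ (a α β) - ∑ ε, a ε β * K ε α μ - ∑ ε, a α ε * K ε β μ

def cdUDD (K : Fin n → Fin n → Fin n → R) (a : Fin n → Fin n → Fin n → R)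
    (α β σ μ : Fin n) : R :=
  A.d μ (a α β σ) + ∑ ε, a ε β σ * K α ε μ - ∑ ε, a α ε σ * K ε β μ - ∑ ε, a α β ε * K ε σ μ

def cdDDD (K : Fin n → Fin n → Fin n → R) (a : Fin n → Fin n → Fin n → R)
    (α β σ μ : Fin n) : R :=
  A.d μ (a α β σ) - ∑ ε, a ε β σ * K ε α μ - ∑ ε, a α ε σ * K ε β μ - ∑ ε, a α β ε * K ε σ μ

def cdDDU (K : Fin n → Fin n → Fin n → R) (a : Fin n → Fin n → Fin n → R)
    (α β σ μ : Fin n) : R :=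
  A.d μ (a α β σ) - ∑ ε, a ε β σ * K ε α μ - ∑ ε, a α ε σ * K ε β μ + ∑ ε, a α β ε * K σ ε μ

def xi (μ ν : Fin n) : R := ∑ α, A.cdDDU A.Gam A.gamMix μ ν α α

def gam2 (μ ν : Fin n) : R := ∑ α, A.C α * A.gamMix μ ν α

def eta (μ ν : Fin n) : R := ∑ β, A.C β * A.Tor β μ ν

def phi (μ ν : Fin n) : R := ∑ β, A.C β * A.Om β μ ν

def chi (μ ν : Fin n) : R := ∑ α, A.cdUDD A.Gam A.Tor α μ ν α

def psi (μ ν : Fin n) : R := ∑ α, A.cdUDD A.Gam A.Om α μ ν α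

def eps (μ ν : Fin n) : R := A.cdD A.Gam A.C μ ν - A.cdD A.Gam A.C ν μ

def theta (μ ν : Fin n) : R := A.cdD A.Gam A.C μ ν + A.cdD A.Gam A.C ν μ

def kappa (μ ν : Fin n) : R :=
  ∑ α, ∑ β, (A.gam β α μ * A.gam α ν β - A.gam β μ α * A.gam α β ν)

def varpi (μ ν : Fin n) : R :=
  ∑ α, ∑ β, (A.gam β α μ * A.gam α ν β + A.gam β μ α * A.gam α β ν)

def sigma (μ ν : Fin n) : R := ∑ α, ∑ β, A.gam β α μ * A.gam α β ν

def omega (μ ν : Fin n) : R := ∑ α, ∑ β, A.gam β μ α * A.gam α ν β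

def alpha (μ ν : Fin n) : R := A.C μ * A.C ν

def H (μ ν : Fin n) : R := (∑ α, ∑ ε, A.Tor α ε μ * A.Tor ε α ν) - A.C μ * A.C ν

def Lag : R := A.detDown * A.tr A.H

def E (μ ν : Fin n) : R :=
  A.g μ ν * A.tr A.H - 2 * A.H μ ν
    - 2 * (A.C μ * A.C ν - A.cdD A.Gam A.C ν μ)
    + 2 * A.g μ ν * ((∑ ε, A.CUp ε * A.C ε) - ∑ ε, A.cdU A.Gam A.CUp ε ε)
    - 2 * ((∑ ε, A.CUp ε * A.TorLow μ ε ν)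
        + ∑ ε, ∑ α, A.gInv ε α * A.cdDDD A.Gam A.TorLow μ ν α ε)

def T (μ ν : Fin n) : R :=
  half R * A.g μ ν * (A.tr A.sigma - A.tr A.varpi) - (A.sigma μ ν - A.varpi μ ν)

def F (μ ν : Fin n) : R := A.gam2 μ ν - A.xi μ ν + A.eta μ ν

def FUp (μ ν : Fin n) : R := ∑ α, ∑ β, A.gInv μ α * A.gInv ν β * A.F α β

def raise (a : Fin n → Fin n → R) (μ ν : Fin n) : R := ∑ ε, A.gInv μ ε * a ε ν

def div0 (a : Fin n → Fin n → R) (ν : Fin n) : R := ∑ μ, A.cdUD A.Gam0 (A.raise a) μ ν μ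

def J (μ : Fin n) : R := ∑ ν, A.cdUU A.Gam0 A.FUp μ ν ν

def divJ : R := ∑ μ, A.cdU A.Gam0 A.J μ μ

def cycF (μ ν σ : Fin n) : R :=
  A.cdDD A.Gam0 A.F μ ν σ + A.cdDD A.Gam0 A.F ν σ μ + A.cdDD A.Gam0 A.F σ μ ν

def curv0 (α β μ ν : Fin n) : R :=
  A.d μ (A.Gam0 α β ν) - A.d ν (A.Gam0 α β μ)
    + ∑ ε, (A.Gam0 ε β ν * A.Gam0 α ε μ - A.Gam0 ε β μ * A.Gam0 α ε ν)

def ricci (K : Fin n → Fin n → Fin n → Fin n → R) (β ν : Fin n) : R := ∑ α, K α β ν α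

def einstein (K : Fin n → Fin n → Fin n → Fin n → R) (μ ν : Fin n) : R :=
  ricci K μ ν - half R * A.g μ ν * A.tr (ricci K)

end DifferentialFrame

/-! ### Evaluation: each tensor is built from the frame by ring operations and derivations, so it
commutes with `ev` -/

namespace HFrame

variable {X : Type*} {n : ℕ} {S : HFrame X n}
variable {R : Type*} [CommRing R] [Algebra ℝ R] {A : DifferentialFrame R n}
variable {Z : Set X} {ev : Z → R →ₐ[ℝ] ℝ}

/-- On `Z`, the calculus of `S` is the calculus of `A`, elements of `R` being evaluated by `ev`. -/
structure Realizes (S : HFrame X n) (A : DifferentialFrame R n) (ev : Z → R →ₐ[ℝ] ℝ) :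
    Prop where
  up : ∀ (z : Z) i α, S.up z i α = ev z (A.up i α)
  -- The agreement of `f` with `r` is asked on `Z` only: in the applications `Z` is open, so values
  -- off `Z` do not affect derivatives on it.
  D : ∀ μ (f : X → ℝ) r, (∀ w : Z, f w = ev w r) → ∀ z : Z, S.D μ f z = ev z (A.d μ r)

namespace Realizes

theorem half_eq (z : Z) : ev z (DifferentialFrame.half R) = 1 / 2 := (ev z).commutes _

/-- Inverse matrices are unique, and evaluating `sum_dn_up` exhibits the evaluated dual frame as an
inverse of `S.up z`. -/
theorem down (h : S.Realizes A ev) (z : Z) (i β) : S.down z i β = ev z (A.dn i β) := by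
  have key : (Matrix.of fun β i => ev z (A.dn i β)) * Matrix.of (S.up z) = 1 := by
    rw [mul_eq_one_comm]
    ext i j
    simp only [Matrix.mul_apply, Matrix.of_apply, h.up, Matrix.one_apply]
    have := congrArg (ev z) (A.sum_dn_up j i)
    simp only [map_sum, map_mul] at this
    simp_rw [mul_comm (ev z (A.up _ _))]
    rw [this, apply_ite (ev z), map_one, map_zero]
    simp only [eq_comm]
  rw [HFrame.down, Matrix.inv_eq_left_inv key, Matrix.of_apply]

theorem D_down (h : S.Realizes A ev) (z : Z) (ν i μ) :
    S.D ν (fun w => S.down w i μ) z = ev z (A.d ν (A.dn i μ)) :=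
  h.D _ _ _ (fun w => h.down w i μ) z

theorem detDown (h : S.Realizes A ev) (z : Z) : S.detDown z = ev z A.detDown := by
  rw [HFrame.detDown, DifferentialFrame.detDown, AlgHom.map_det]
  congr 1; ext i j; simp [h.down]

theorem g (h : S.Realizes A ev) (z : Z) (μ ν) : S.g z μ ν = ev z (A.g μ ν) := by
  simp only [HFrame.g, DifferentialFrame.g, h.down, map_sum, map_mul]

theorem gInv (h : S.Realizes A ev) (z : Z) (μ ν) : S.gInv z μ ν = ev z (A.gInv μ ν) := by
  simp only [HFrame.gInv, DifferentialFrame.gInv, h.up, map_sum, map_mul]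

theorem tr (h : S.Realizes A ev) {a : X → Fin n → Fin n → ℝ} {b : Fin n → Fin n → R}
    (hab : ∀ (w : Z) μ ν, a w μ ν = ev w (b μ ν)) (z : Z) : S.tr a z = ev z (A.tr b) := by
  simp only [HFrame.tr, DifferentialFrame.tr, h.gInv, hab, map_sum, map_mul]

theorem Gam (h : S.Realizes A ev) (z : Z) (α μ ν) : S.Gam z α μ ν = ev z (A.Gam α μ ν) := by
  simp only [HFrame.Gam, DifferentialFrame.Gam, h.up, h.D_down, map_sum, map_mul]

theorem D_g (h : S.Realizes A ev) (z : Z) (ν i μ) :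
    S.D ν (fun w => S.g w i μ) z = ev z (A.d ν (A.g i μ)) :=
  h.D _ _ _ (fun w => h.g w i μ) z

theorem Gam0 (h : S.Realizes A ev) (z : Z) (α μ ν) : S.Gam0 z α μ ν = ev z (A.Gam0 α μ ν) := by
  simp only [HFrame.Gam0, DifferentialFrame.Gam0, h.gInv, h.D_g, map_sum, map_mul, map_add,
    map_sub, half_eq]

theorem Tor (h : S.Realizes A ev) (z : Z) (α μ ν) : S.Tor z α μ ν = ev z (A.Tor α μ ν) := by
  simp only [HFrame.Tor, DifferentialFrame.Tor, h.Gam, map_sub]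

theorem gam (h : S.Realizes A ev) (z : Z) (α μ ν) : S.gam z α μ ν = ev z (A.gam α μ ν) := by
  simp only [HFrame.gam, DifferentialFrame.gam, h.Gam, h.Gam0, map_sub]

theorem Om (h : S.Realizes A ev) (z : Z) (α μ ν) : S.Om z α μ ν = ev z (A.Om α μ ν) := by
  simp only [HFrame.Om, DifferentialFrame.Om, h.gam, map_add]

theorem C (h : S.Realizes A ev) (z : Z) (μ) : S.C z μ = ev z (A.C μ) := by
  simp only [HFrame.C, DifferentialFrame.C, h.Tor, map_sum]

theorem CUp (h : S.Realizes A ev) (z : Z) (μ) : S.CUp z μ = ev z (A.CUp μ) := by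
  simp only [HFrame.CUp, DifferentialFrame.CUp, h.gInv, h.C, map_sum, map_mul]

theorem TorLow (h : S.Realizes A ev) (z : Z) (α μ ν) :
    S.TorLow z α μ ν = ev z (A.TorLow α μ ν) := by
  simp only [HFrame.TorLow, DifferentialFrame.TorLow, h.g, h.Tor, map_sum, map_mul]

theorem gamLow (h : S.Realizes A ev) (z : Z) (α μ ν) :
    S.gamLow z α μ ν = ev z (A.gamLow α μ ν) := by
  simp only [HFrame.gamLow, DifferentialFrame.gamLow, h.g, h.gam, map_sum, map_mul]

theorem gamMix (h : S.Realizes A ev) (z : Z) (α μ ν) :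
    S.gamMix z α μ ν = ev z (A.gamMix α μ ν) := by
  simp only [HFrame.gamMix, DifferentialFrame.gamMix, h.gInv, h.gamLow, map_sum, map_mul]

section covariant

variable {K : X → Fin n → Fin n → Fin n → ℝ} {L : Fin n → Fin n → Fin n → R}

theorem cdU (h : S.Realizes A ev) (hK : ∀ (w : Z) α μ ν, K w α μ ν = ev w (L α μ ν))
    {a : X → Fin n → ℝ} {b : Fin n → R} (hab : ∀ (w : Z) μ, a w μ = ev w (b μ)) (z : Z) (α μ) :
    S.cdU K a z α μ = ev z (A.cdU L b α μ) := by
  simp only [HFrame.cdU, DifferentialFrame.cdU,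
    h.D μ (fun w => a w α) _ (fun w => hab w α) z, hK, hab, map_sum,
    map_mul, map_add]

theorem cdD (h : S.Realizes A ev) (hK : ∀ (w : Z) α μ ν, K w α μ ν = ev w (L α μ ν))
    {a : X → Fin n → ℝ} {b : Fin n → R} (hab : ∀ (w : Z) μ, a w μ = ev w (b μ)) (z : Z) (α μ) :
    S.cdD K a z α μ = ev z (A.cdD L b α μ) := by
  simp only [HFrame.cdD, DifferentialFrame.cdD,
    h.D μ (fun w => a w α) _ (fun w => hab w α) z, hK, hab, map_sum,
    map_mul, map_sub]

theorem cdUU (h : S.Realizes A ev) (hK : ∀ (w : Z) α μ ν, K w α μ ν = ev w (L α μ ν))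
    {a : X → Fin n → Fin n → ℝ} {b : Fin n → Fin n → R}
    (hab : ∀ (w : Z) μ ν, a w μ ν = ev w (b μ ν)) (z : Z) (α β μ) :
    S.cdUU K a z α β μ = ev z (A.cdUU L b α β μ) := by
  simp only [HFrame.cdUU, DifferentialFrame.cdUU,
    h.D μ (fun w => a w α β) _ (fun w => hab w α β) z, hK, hab,
    map_sum, map_mul, map_add]

theorem cdUD (h : S.Realizes A ev) (hK : ∀ (w : Z) α μ ν, K w α μ ν = ev w (L α μ ν))
    {a : X → Fin n → Fin n → ℝ} {b : Fin n → Fin n → R}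
    (hab : ∀ (w : Z) μ ν, a w μ ν = ev w (b μ ν)) (z : Z) (α β μ) :
    S.cdUD K a z α β μ = ev z (A.cdUD L b α β μ) := by
  simp only [HFrame.cdUD, DifferentialFrame.cdUD,
    h.D μ (fun w => a w α β) _ (fun w => hab w α β) z, hK, hab,
    map_sum, map_mul, map_add, map_sub]

theorem cdDD (h : S.Realizes A ev) (hK : ∀ (w : Z) α μ ν, K w α μ ν = ev w (L α μ ν))
    {a : X → Fin n → Fin n → ℝ} {b : Fin n → Fin n → R}
    (hab : ∀ (w : Z) μ ν, a w μ ν = ev w (b μ ν)) (z : Z) (α β μ) :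
    S.cdDD K a z α β μ = ev z (A.cdDD L b α β μ) := by
  simp only [HFrame.cdDD, DifferentialFrame.cdDD,
    h.D μ (fun w => a w α β) _ (fun w => hab w α β) z, hK, hab,
    map_sum, map_mul, map_sub]

theorem cdUDD (h : S.Realizes A ev) (hK : ∀ (w : Z) α μ ν, K w α μ ν = ev w (L α μ ν))
    {a : X → Fin n → Fin n → Fin n → ℝ} {b : Fin n → Fin n → Fin n → R}
    (hab : ∀ (w : Z) α μ ν, a w α μ ν = ev w (b α μ ν)) (z : Z) (α β σ μ) :
    S.cdUDD K a z α β σ μ = ev z (A.cdUDD L b α β σ μ) := by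
  simp only [HFrame.cdUDD, DifferentialFrame.cdUDD,
    h.D μ (fun w => a w α β σ) _ (fun w => hab w α β σ) z, hK, hab,
    map_sum, map_mul, map_add, map_sub]

theorem cdDDD (h : S.Realizes A ev) (hK : ∀ (w : Z) α μ ν, K w α μ ν = ev w (L α μ ν))
    {a : X → Fin n → Fin n → Fin n → ℝ} {b : Fin n → Fin n → Fin n → R}
    (hab : ∀ (w : Z) α μ ν, a w α μ ν = ev w (b α μ ν)) (z : Z) (α β σ μ) :
    S.cdDDD K a z α β σ μ = ev z (A.cdDDD L b α β σ μ) := by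
  simp only [HFrame.cdDDD, DifferentialFrame.cdDDD,
    h.D μ (fun w => a w α β σ) _ (fun w => hab w α β σ) z, hK, hab,
    map_sum, map_mul, map_sub]

theorem cdDDU (h : S.Realizes A ev) (hK : ∀ (w : Z) α μ ν, K w α μ ν = ev w (L α μ ν))
    {a : X → Fin n → Fin n → Fin n → ℝ} {b : Fin n → Fin n → Fin n → R}
    (hab : ∀ (w : Z) α μ ν, a w α μ ν = ev w (b α μ ν)) (z : Z) (α β σ μ) :
    S.cdDDU K a z α β σ μ = ev z (A.cdDDU L b α β σ μ) := by
  simp only [HFrame.cdDDU, DifferentialFrame.cdDDU,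
    h.D μ (fun w => a w α β σ) _ (fun w => hab w α β σ) z, hK, hab,
    map_sum, map_mul, map_add, map_sub]

end covariant

theorem xi (h : S.Realizes A ev) (z : Z) (μ ν) : S.xi z μ ν = ev z (A.xi μ ν) := by
  simp only [HFrame.xi, DifferentialFrame.xi, h.cdDDU h.Gam h.gamMix, map_sum]

theorem gam2 (h : S.Realizes A ev) (z : Z) (μ ν) : S.gam2 z μ ν = ev z (A.gam2 μ ν) := by
  simp only [HFrame.gam2, DifferentialFrame.gam2, h.C, h.gamMix, map_sum, map_mul]

theorem eta (h : S.Realizes A ev) (z : Z) (μ ν) : S.eta z μ ν = ev z (A.eta μ ν) := by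
  simp only [HFrame.eta, DifferentialFrame.eta, h.C, h.Tor, map_sum, map_mul]

theorem phi (h : S.Realizes A ev) (z : Z) (μ ν) : S.phi z μ ν = ev z (A.phi μ ν) := by
  simp only [HFrame.phi, DifferentialFrame.phi, h.C, h.Om, map_sum, map_mul]

theorem chi (h : S.Realizes A ev) (z : Z) (μ ν) : S.chi z μ ν = ev z (A.chi μ ν) := by
  simp only [HFrame.chi, DifferentialFrame.chi, h.cdUDD h.Gam h.Tor, map_sum]

theorem psi (h : S.Realizes A ev) (z : Z) (μ ν) : S.psi z μ ν = ev z (A.psi μ ν) := by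
  simp only [HFrame.psi, DifferentialFrame.psi, h.cdUDD h.Gam h.Om, map_sum]

theorem eps (h : S.Realizes A ev) (z : Z) (μ ν) : S.eps z μ ν = ev z (A.eps μ ν) := by
  simp only [HFrame.eps, DifferentialFrame.eps, h.cdD h.Gam h.C, map_sub]

theorem theta (h : S.Realizes A ev) (z : Z) (μ ν) : S.theta z μ ν = ev z (A.theta μ ν) := by
  simp only [HFrame.theta, DifferentialFrame.theta, h.cdD h.Gam h.C, map_add]

theorem kappa (h : S.Realizes A ev) (z : Z) (μ ν) : S.kappa z μ ν = ev z (A.kappa μ ν) := by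
  simp only [HFrame.kappa, DifferentialFrame.kappa, h.gam, map_sum, map_mul, map_sub]

theorem varpi (h : S.Realizes A ev) (z : Z) (μ ν) : S.varpi z μ ν = ev z (A.varpi μ ν) := by
  simp only [HFrame.varpi, DifferentialFrame.varpi, h.gam, map_sum, map_mul, map_add]

theorem sigma (h : S.Realizes A ev) (z : Z) (μ ν) : S.sigma z μ ν = ev z (A.sigma μ ν) := by
  simp only [HFrame.sigma, DifferentialFrame.sigma, h.gam, map_sum, map_mul]

theorem omega (h : S.Realizes A ev) (z : Z) (μ ν) : S.omega z μ ν = ev z (A.omega μ ν) := by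
  simp only [HFrame.omega, DifferentialFrame.omega, h.gam, map_sum, map_mul]

theorem alpha (h : S.Realizes A ev) (z : Z) (μ ν) : S.alpha z μ ν = ev z (A.alpha μ ν) := by
  simp only [HFrame.alpha, DifferentialFrame.alpha, h.C, map_mul]

theorem H (h : S.Realizes A ev) (z : Z) (μ ν) : S.H z μ ν = ev z (A.H μ ν) := by
  simp only [HFrame.H, DifferentialFrame.H, h.Tor, h.C, map_sum, map_mul, map_sub]

theorem Lag (h : S.Realizes A ev) (z : Z) : S.Lag z = ev z A.Lag := by
  simp only [HFrame.Lag, DifferentialFrame.Lag, h.detDown, h.tr h.H, map_mul]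

theorem E (h : S.Realizes A ev) (z : Z) (μ ν) : S.E z μ ν = ev z (A.E μ ν) := by
  simp only [HFrame.E, DifferentialFrame.E, h.g, h.gInv, h.tr h.H, h.H, h.C, h.CUp, h.TorLow,
    h.cdD h.Gam h.C, h.cdU h.Gam h.CUp, h.cdDDD h.Gam h.TorLow, map_sum, map_mul, map_sub,
    map_add, map_ofNat]

theorem T (h : S.Realizes A ev) (z : Z) (μ ν) : S.T z μ ν = ev z (A.T μ ν) := by
  simp only [HFrame.T, DifferentialFrame.T, h.g, h.tr h.sigma, h.tr h.varpi, h.sigma, h.varpi,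
    half_eq, map_mul, map_sub]

theorem F (h : S.Realizes A ev) (z : Z) (μ ν) : S.F z μ ν = ev z (A.F μ ν) := by
  simp only [HFrame.F, DifferentialFrame.F, h.gam2, h.xi, h.eta, map_sub, map_add]

theorem FUp (h : S.Realizes A ev) (z : Z) (μ ν) : S.FUp z μ ν = ev z (A.FUp μ ν) := by
  simp only [HFrame.FUp, DifferentialFrame.FUp, h.gInv, h.F, map_sum, map_mul]

theorem raise (h : S.Realizes A ev) {a : X → Fin n → Fin n → ℝ} {b : Fin n → Fin n → R}
    (hab : ∀ (w : Z) μ ν, a w μ ν = ev w (b μ ν)) (z : Z) (μ ν) :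
    S.raise a z μ ν = ev z (A.raise b μ ν) := by
  simp only [HFrame.raise, DifferentialFrame.raise, h.gInv, hab, map_sum, map_mul]

theorem div0 (h : S.Realizes A ev) {a : X → Fin n → Fin n → ℝ} {b : Fin n → Fin n → R}
    (hab : ∀ (w : Z) μ ν, a w μ ν = ev w (b μ ν)) (z : Z) (ν) :
    S.div0 a z ν = ev z (A.div0 b ν) := by
  simp only [HFrame.div0, DifferentialFrame.div0, h.cdUD h.Gam0 (h.raise hab), map_sum]

theorem J (h : S.Realizes A ev) (z : Z) (μ) : S.J z μ = ev z (A.J μ) := by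
  simp only [HFrame.J, DifferentialFrame.J, h.cdUU h.Gam0 h.FUp, map_sum]

theorem divJ (h : S.Realizes A ev) (z : Z) : S.divJ z = ev z A.divJ := by
  simp only [HFrame.divJ, DifferentialFrame.divJ, h.cdU h.Gam0 h.J, map_sum]

theorem cycF (h : S.Realizes A ev) (z : Z) (μ ν σ) : S.cycF z μ ν σ = ev z (A.cycF μ ν σ) := by
  simp only [HFrame.cycF, DifferentialFrame.cycF, h.cdDD h.Gam0 h.F, map_add]

theorem curv0 (h : S.Realizes A ev) (z : Z) (α β μ ν) :
    S.curv0 z α β μ ν = ev z (A.curv0 α β μ ν) := by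
  simp only [HFrame.curv0, DifferentialFrame.curv0,
    h.D μ (fun w => S.Gam0 w α β ν) _ (fun w => h.Gam0 w α β ν) z,
    h.D ν (fun w => S.Gam0 w α β μ) _ (fun w => h.Gam0 w α β μ) z, h.Gam0,
    map_sum, map_mul, map_add, map_sub]

theorem ricci {K : X → Fin n → Fin n → Fin n → Fin n → ℝ} {L : Fin n → Fin n → Fin n → Fin n → R}
    (hK : ∀ (w : Z) α β μ ν, K w α β μ ν = ev w (L α β μ ν)) (z : Z) (μ ν) :
    HFrame.ricci K z μ ν = ev z (DifferentialFrame.ricci L μ ν) := by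
  simp only [HFrame.ricci, DifferentialFrame.ricci, hK, map_sum]

theorem einstein (h : S.Realizes A ev) {K : X → Fin n → Fin n → Fin n → Fin n → ℝ}
    {L : Fin n → Fin n → Fin n → Fin n → R}
    (hK : ∀ (w : Z) α β μ ν, K w α β μ ν = ev w (L α β μ ν)) (z : Z) (μ ν) :
    S.einstein K z μ ν = ev z (A.einstein L μ ν) := by
  simp only [HFrame.einstein, DifferentialFrame.einstein, h.g, ricci hK, h.tr (ricci hK), half_eq,
    map_mul, map_sub]

end Realizes

end HFrame

namespace DifferentialFrame

/-- Contraction with a matrix and then with its inverse. This serves both for passing between frame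
and coordinate components and for lowering and raising by the metric. -/
theorem sum_mul_sum_eq {R : Type*} [CommRing R] {n : ℕ} {a b : Fin n → Fin n → R}
    (h : ∀ i j, ∑ k, a i k * b k j = if i = j then 1 else 0) (f : Fin n → R) (i : Fin n) :
    ∑ k, a i k * ∑ j, b k j * f j = f i := by
  simp_rw [Finset.mul_sum, ← mul_assoc]
  rw [Finset.sum_comm]
  simp_rw [← Finset.sum_mul, h]
  simp

variable {R : Type*} [CommRing R] [Algebra ℝ R] {n : ℕ} (A : DifferentialFrame R n)

/-! ### Passage between coordinate and frame components -/

/-- Coordinate components `w_μ = λ_{iμ} f_i`. -/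
def lo (f : Fin n → R) (μ : Fin n) : R := ∑ i, A.dn i μ * f i

/-- Coordinate components `v^α = λ_i^α f_i`. -/
def hi (f : Fin n → R) (α : Fin n) : R := ∑ i, A.up i α * f i

/-- Frame components `λ_i^μ w_μ`. -/
def frLo (w : Fin n → R) (i : Fin n) : R := ∑ μ, A.up i μ * w μ

/-- Frame components `λ_{iα} v^α`. -/
def frHi (v : Fin n → R) (i : Fin n) : R := ∑ α, A.dn i α * v α

/-- The frame derivative `λ_i^μ ∂_μ`. -/
def e (i : Fin n) (f : R) : R := ∑ μ, A.up i μ * A.d μ f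

theorem sum_up_dn' (α β) : ∑ i, A.dn i α * A.up i β = if α = β then 1 else 0 := by
  simp_rw [mul_comm (A.dn _ _), A.sum_up_dn, eq_comm]

theorem sum_dn_up' (i j) : ∑ α, A.up i α * A.dn j α = if i = j then 1 else 0 := by
  simp_rw [mul_comm (A.up _ _), A.sum_dn_up, eq_comm]

theorem lo_frLo (w : Fin n → R) (μ) : A.lo (A.frLo w) μ = w μ :=
  sum_mul_sum_eq (a := fun μ i => A.dn i μ) (b := fun i ν => A.up i ν) A.sum_up_dn' w μ

theorem hi_frHi (v : Fin n → R) (α) : A.hi (A.frHi v) α = v α :=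
  sum_mul_sum_eq (a := fun μ i => A.up i μ) (b := fun i ν => A.dn i ν) A.sum_up_dn v α

theorem frLo_lo (f : Fin n → R) (i) : A.frLo (A.lo f) i = f i :=
  sum_mul_sum_eq (a := fun i μ => A.up i μ) (b := fun μ j => A.dn j μ) A.sum_dn_up' f i

theorem frHi_hi (f : Fin n → R) (i) : A.frHi (A.hi f) i = f i :=
  sum_mul_sum_eq (a := fun i μ => A.dn i μ) (b := fun μ j => A.up j μ) A.sum_dn_up f i

theorem mul_lo (r : R) (f μ) : r * A.lo f μ = A.lo (fun i => r * f i) μ := by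
  simp only [lo, Finset.mul_sum]; exact Finset.sum_congr rfl fun _ _ => by ring

theorem mul_hi (r : R) (f μ) : r * A.hi f μ = A.hi (fun i => r * f i) μ := by
  simp only [hi, Finset.mul_sum]; exact Finset.sum_congr rfl fun _ _ => by ring

theorem lo_mul (r : R) (f μ) : A.lo f μ * r = A.lo (fun i => f i * r) μ := by
  simp only [lo, Finset.sum_mul]; exact Finset.sum_congr rfl fun _ _ => by ring

theorem hi_mul (r : R) (f μ) : A.hi f μ * r = A.hi (fun i => f i * r) μ := by
  simp only [hi, Finset.sum_mul]; exact Finset.sum_congr rfl fun _ _ => by ring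

theorem lo_add (f h : Fin n → R) (μ) : A.lo f μ + A.lo h μ = A.lo (fun i => f i + h i) μ := by
  simp only [lo, ← Finset.sum_add_distrib, mul_add]

theorem lo_sub (f h : Fin n → R) (μ) : A.lo f μ - A.lo h μ = A.lo (fun i => f i - h i) μ := by
  simp only [lo, ← Finset.sum_sub_distrib, mul_sub]

theorem hi_add (f h : Fin n → R) (μ) : A.hi f μ + A.hi h μ = A.hi (fun i => f i + h i) μ := by
  simp only [hi, ← Finset.sum_add_distrib, mul_add]

theorem hi_sub (f h : Fin n → R) (μ) : A.hi f μ - A.hi h μ = A.hi (fun i => f i - h i) μ := by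
  simp only [hi, ← Finset.sum_sub_distrib, mul_sub]

theorem sum_lo {ι : Type*} (s : Finset ι) (f : ι → Fin n → R) (μ) :
    ∑ k ∈ s, A.lo (f k) μ = A.lo (fun i => ∑ k ∈ s, f k i) μ := by
  simp only [lo, Finset.mul_sum]; exact Finset.sum_comm

theorem sum_hi {ι : Type*} (s : Finset ι) (f : ι → Fin n → R) (μ) :
    ∑ k ∈ s, A.hi (f k) μ = A.hi (fun i => ∑ k ∈ s, f k i) μ := by
  simp only [hi, Finset.mul_sum]; exact Finset.sum_comm

theorem lo_lo_comm (x : Fin n → Fin n → R) (μ ν) :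
    A.lo (fun i => A.lo (fun j => x i j) ν) μ = A.lo (fun j => A.lo (fun i => x i j) μ) ν := by
  simp only [lo, Finset.mul_sum]; rw [Finset.sum_comm]
  exact Finset.sum_congr rfl fun _ _ => Finset.sum_congr rfl fun _ _ => by ring

theorem hi_lo_comm (x : Fin n → Fin n → R) (μ ν) :
    A.hi (fun i => A.lo (fun j => x i j) ν) μ = A.lo (fun j => A.hi (fun i => x i j) μ) ν := by
  simp only [lo, hi, Finset.mul_sum]; rw [Finset.sum_comm]
  exact Finset.sum_congr rfl fun _ _ => Finset.sum_congr rfl fun _ _ => by ring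

theorem sum_hi_mul_lo (f h : Fin n → R) : ∑ α, A.hi f α * A.lo h α = ∑ i, f i * h i := by
  simp_rw [A.hi_mul]
  simp only [hi]
  rw [Finset.sum_comm]
  refine Finset.sum_congr rfl fun i _ => ?_
  have := A.frLo_lo h i
  rw [← this, frLo, Finset.mul_sum]
  exact Finset.sum_congr rfl fun _ _ => by ring

theorem sum_lo_mul_hi (f h : Fin n → R) : ∑ α, A.lo f α * A.hi h α = ∑ i, f i * h i := by
  simp_rw [mul_comm (A.lo _ _), sum_hi_mul_lo, mul_comm]

/-- Components `λ_{iμ} λ_{jν} x_{ij}`. -/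
def lo2 (x : Fin n → Fin n → R) (μ ν : Fin n) : R := A.lo (fun i => A.lo (fun j => x i j) ν) μ

/-- Components `λ_{iμ} λ_{jν} λ_{kα} x_{ijk}`. -/
def lo3 (x : Fin n → Fin n → Fin n → R) (μ ν α : Fin n) : R :=
  A.lo (fun i => A.lo2 (x i) ν α) μ

/-- Components `λ_i^α λ_{jμ} λ_{kν} x_{ijk}`. -/
def mix3 (x : Fin n → Fin n → Fin n → R) (α μ ν : Fin n) : R :=
  A.hi (fun i => A.lo2 (x i) μ ν) α

theorem lo2_add (x y : Fin n → Fin n → R) (μ ν) :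
    A.lo2 x μ ν + A.lo2 y μ ν = A.lo2 (fun i j => x i j + y i j) μ ν := by
  simp only [lo2, lo_add]

theorem lo2_sub (x y : Fin n → Fin n → R) (μ ν) :
    A.lo2 x μ ν - A.lo2 y μ ν = A.lo2 (fun i j => x i j - y i j) μ ν := by
  simp only [lo2, lo_sub]

theorem mul_lo2 (r : R) (x μ ν) : r * A.lo2 x μ ν = A.lo2 (fun i j => r * x i j) μ ν := by
  simp only [lo2, mul_lo]

theorem lo2_mul (r : R) (x μ ν) : A.lo2 x μ ν * r = A.lo2 (fun i j => x i j * r) μ ν := by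
  simp only [lo2, lo_mul]

theorem sum_lo2 {ι : Type*} (s : Finset ι) (x : ι → Fin n → Fin n → R) (μ ν) :
    ∑ k ∈ s, A.lo2 (x k) μ ν = A.lo2 (fun i j => ∑ k ∈ s, x k i j) μ ν := by
  simp only [lo2, sum_lo]

theorem lo2_swap (x : Fin n → Fin n → R) (μ ν) :
    A.lo2 x ν μ = A.lo2 (fun i j => x j i) μ ν := A.lo_lo_comm _ _ _

theorem lo_mul_lo (f h : Fin n → R) (μ ν) :
    A.lo f μ * A.lo h ν = A.lo2 (fun i j => f i * h j) μ ν := by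
  rw [lo_mul]; simp only [lo2, mul_lo]

/-- Lets a symmetry known for coordinate tensors be read off in frame components, where it may be
far from visible. -/
theorem lo2_inj {x y : Fin n → Fin n → R} (h : ∀ μ ν, A.lo2 x μ ν = A.lo2 y μ ν) (i j) :
    x i j = y i j := by
  have h1 : ∀ ν, A.lo (x i) ν = A.lo (y i) ν := fun ν => by
    rw [← A.frLo_lo (fun i => A.lo (x i) ν) i, ← A.frLo_lo (fun i => A.lo (y i) ν) i]
    exact congrArg (fun w => A.frLo w i) (funext fun μ => h μ ν)
  rw [← A.frLo_lo (x i) j, ← A.frLo_lo (y i) j]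
  exact congrArg (fun w => A.frLo w j) (funext h1)

/-- Frame components of a covariant tensor. -/
def fr2 (a : Fin n → Fin n → R) (i j : Fin n) : R := A.frLo (fun μ => A.frLo (a μ) j) i

theorem lo2_fr2 (a : Fin n → Fin n → R) (μ ν) : A.lo2 (A.fr2 a) μ ν = a μ ν := by
  simp only [lo2, fr2]
  have key (i) : A.lo (fun j => A.frLo (fun μ => A.frLo (a μ) j) i) ν
      = A.frLo (fun μ => a μ ν) i := by
    simp only [frLo, ← sum_lo, ← A.mul_lo]
    exact Finset.sum_congr rfl fun μ _ => by
      rw [A.sum_lo, show A.lo (fun j => ∑ ρ, A.up j ρ * a μ ρ) ν = a μ ν from A.lo_frLo (a μ) ν]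
  simp only [key, lo_frLo]

theorem g_eq (μ ν) : A.g μ ν = A.lo2 (fun i j => if i = j then 1 else 0) μ ν := by
  simp [g, lo2, lo]

/-- The frame is orthonormal, so raising an index only exchanges `λ_{iβ}` for `λ_i^α` and leaves the
frame components alone. -/
theorem sum_gInv_mul_lo (f : Fin n → R) (α) : ∑ β, A.gInv α β * A.lo f β = A.hi f α := by
  have key (β) : A.gInv α β = A.hi (fun i => A.up i α) β := by simp [gInv, hi, mul_comm]
  simp_rw [key, sum_hi_mul_lo]; rfl

theorem sum_g_mul_hi (f : Fin n → R) (α) : ∑ β, A.g α β * A.hi f β = A.lo f α := by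
  have key (β) : A.g α β = A.lo (fun i => A.dn i α) β := by simp [g, lo, mul_comm]
  simp_rw [key, sum_lo_mul_hi]; rfl

theorem tr_lo2 (x : Fin n → Fin n → R) : A.tr (A.lo2 x) = ∑ i, x i i := by
  have key (μ) : ∑ ν, A.gInv μ ν * A.lo2 x μ ν = A.lo (fun i => A.hi (x i) μ) μ := by
    simp only [lo2, mul_lo, sum_lo]
    simp only [← sum_gInv_mul_lo, mul_lo]
  simp only [tr, key, lo]
  simp only [hi, Finset.mul_sum]
  rw [Finset.sum_comm]
  refine Finset.sum_congr rfl fun i _ => ?_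
  have := A.frHi_hi (x i) i
  simp only [frHi, hi, Finset.mul_sum] at this
  exact this

/-- Full contraction of two mixed tensors. -/
theorem sum_hi_lo_mul_hi_lo (x y : Fin n → Fin n → R) :
    ∑ α, ∑ β, A.hi (fun k => A.lo (x k) α) β * A.hi (fun l => A.lo (y l) β) α
      = ∑ k, ∑ l, x k l * y l k := by
  have key (α) : ∑ β, A.hi (fun k => A.lo (x k) α) β * A.hi (fun l => A.lo (y l) β) α
      = ∑ k, A.lo (x k) α * A.hi (fun l => y l k) α := by
    simp_rw [hi_lo_comm A y]
    exact A.sum_hi_mul_lo _ _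
  simp_rw [key]
  rw [Finset.sum_comm]
  simp_rw [sum_lo_mul_hi]

/-! ### Derivatives -/

theorem e_sum {ι : Type*} (i) (s : Finset ι) (f : ι → R) :
    A.e i (∑ k ∈ s, f k) = ∑ k ∈ s, A.e i (f k) := by
  simp only [e, map_sum, Finset.mul_sum]; exact Finset.sum_comm

theorem e_add (i) (f h : R) : A.e i (f + h) = A.e i f + A.e i h := by
  simp [e, mul_add, Finset.sum_add_distrib]

theorem e_sub (i) (f h : R) : A.e i (f - h) = A.e i f - A.e i h := by
  simp [e, mul_sub, Finset.sum_sub_distrib]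

theorem e_neg (i) (f : R) : A.e i (-f) = -A.e i f := by
  simp [e]

theorem e_mul (i) (f h : R) : A.e i (f * h) = f * A.e i h + h * A.e i f := by
  simp only [e, Finset.mul_sum, ← Finset.sum_add_distrib, Derivation.leibniz, smul_eq_mul]
  exact Finset.sum_congr rfl fun _ _ => by ring

theorem lo_e (f : R) (μ) : A.lo (fun i => A.e i f) μ = A.d μ f := A.lo_frLo (fun μ => A.d μ f) μ

theorem d_lo (ρ f μ) :
    A.d ρ (A.lo f μ) = A.lo (fun i => A.d ρ (f i)) μ + ∑ i, f i * A.d ρ (A.dn i μ) := by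
  simp only [lo, map_sum, Derivation.leibniz, smul_eq_mul, Finset.sum_add_distrib]

theorem d_hi (ρ f μ) :
    A.d ρ (A.hi f μ) = A.hi (fun i => A.d ρ (f i)) μ + ∑ i, f i * A.d ρ (A.up i μ) := by
  simp only [hi, map_sum, Derivation.leibniz, smul_eq_mul, Finset.sum_add_distrib]

/-- The coframe is parallel for `Γ`: this relation is the defining property of the canonical
connection. -/
theorem sum_dn_mul_Gam (i μ ρ) : ∑ ε, A.dn i ε * A.Gam ε μ ρ = A.d ρ (A.dn i μ) :=
  A.frHi_hi (fun i => A.d ρ (A.dn i μ)) i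

/-- The dual form of parallelism, obtained by differentiating `λ_{jε} λ_i^ε = δ_{ij}`. -/
theorem sum_up_mul_Gam (i α ρ) : ∑ ε, A.up i ε * A.Gam α ε ρ = - A.d ρ (A.up i α) := by
  have h (j) : ∑ ε, A.up i ε * A.d ρ (A.dn j ε) = - ∑ ε, A.dn j ε * A.d ρ (A.up i ε) := by
    have h0 := congrArg (A.d ρ) (A.sum_dn_up j i)
    rw [apply_ite (A.d ρ)] at h0
    simp only [map_sum, Derivation.leibniz, smul_eq_mul, Finset.sum_add_distrib, map_zero,
      Derivation.map_one_eq_zero, ite_self] at h0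
    linear_combination h0
  have h1 : ∑ ε, A.up i ε * A.Gam α ε ρ = ∑ j, A.up j α * ∑ ε, A.up i ε * A.d ρ (A.dn j ε) := by
    simp only [Gam, Finset.mul_sum]
    rw [Finset.sum_comm]
    exact Finset.sum_congr rfl fun _ _ => Finset.sum_congr rfl fun _ _ => by ring
  rw [h1]
  simp only [h, mul_neg, Finset.sum_neg_distrib]
  exact congrArg Neg.neg (A.hi_frHi (fun ε => A.d ρ (A.up i ε)) α)

theorem sum_lo_mul_Gam (f : Fin n → R) (μ ρ) :
    ∑ ε, A.lo f ε * A.Gam ε μ ρ = ∑ i, f i * A.d ρ (A.dn i μ) := by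
  simp only [lo, Finset.sum_mul, ← sum_dn_mul_Gam, Finset.mul_sum]
  rw [Finset.sum_comm]
  exact Finset.sum_congr rfl fun _ _ => Finset.sum_congr rfl fun _ _ => by ring

theorem sum_hi_mul_Gam (f : Fin n → R) (α ρ) :
    ∑ ε, A.hi f ε * A.Gam α ε ρ = - ∑ i, f i * A.d ρ (A.up i α) := by
  rw [← Finset.sum_neg_distrib]
  simp only [hi, Finset.sum_mul, ← mul_neg, ← sum_up_mul_Gam, Finset.mul_sum]
  rw [Finset.sum_comm]
  exact Finset.sum_congr rfl fun _ _ => Finset.sum_congr rfl fun _ _ => by ring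

/-- Because the frame is parallel, the canonical covariant derivative acts on the frame components
alone, as a plain derivative. The versions for higher rank apply this index by index. -/
theorem d_lo_sub_Gam (ρ f μ) :
    A.d ρ (A.lo f μ) - ∑ ε, A.lo f ε * A.Gam ε μ ρ = A.lo (fun i => A.d ρ (f i)) μ := by
  rw [d_lo, sum_lo_mul_Gam]; ring

theorem d_hi_add_Gam (ρ f α) :
    A.d ρ (A.hi f α) + ∑ ε, A.hi f ε * A.Gam α ε ρ = A.hi (fun i => A.d ρ (f i)) α := by
  rw [d_hi, sum_hi_mul_Gam]; ring

theorem cdD_Gam (f : Fin n → R) (α μ) :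
    A.cdD A.Gam (A.lo f) α μ = A.lo (fun i => A.d μ (f i)) α := A.d_lo_sub_Gam _ _ _

theorem cdU_Gam (f : Fin n → R) (α μ) :
    A.cdU A.Gam (A.hi f) α μ = A.hi (fun i => A.d μ (f i)) α := A.d_hi_add_Gam _ _ _

theorem sum_hi_d (f : Fin n → R) : ∑ α, A.hi (fun i => A.d α (f i)) α = ∑ i, A.e i (f i) := by
  simp only [hi, e]; exact Finset.sum_comm

/-- `x_{ij|ρ}` in the frame, for the canonical connection. -/
theorem d_lo2_sub_Gam (x : Fin n → Fin n → R) (α β μ) :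
    A.d μ (A.lo2 x α β) - ∑ ε, A.lo2 x ε β * A.Gam ε α μ - ∑ ε, A.lo2 x α ε * A.Gam ε β μ
      = A.lo2 (fun i j => A.d μ (x i j)) α β := by
  have h : ∑ ε, A.lo2 x α ε * A.Gam ε β μ
      = A.lo (fun i => ∑ ε, A.lo (x i) ε * A.Gam ε β μ) α := by
    simp only [lo2, lo_mul, sum_lo]
  rw [h]
  simp only [lo2]
  rw [d_lo_sub_Gam, lo_sub]
  simp only [d_lo_sub_Gam]

theorem cdDDD_Gam (x : Fin n → Fin n → Fin n → R) (α β σ μ) :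
    A.cdDDD A.Gam (A.lo3 x) α β σ μ = A.lo3 (fun i j k => A.d μ (x i j k)) α β σ := by
  have h1 : ∑ ε, A.lo3 x α ε σ * A.Gam ε β μ
      = A.lo (fun i => ∑ ε, A.lo2 (x i) ε σ * A.Gam ε β μ) α := by
    simp only [lo3, lo_mul, sum_lo]
  have h2 : ∑ ε, A.lo3 x α β ε * A.Gam ε σ μ
      = A.lo (fun i => ∑ ε, A.lo2 (x i) β ε * A.Gam ε σ μ) α := by
    simp only [lo3, lo_mul, sum_lo]
  rw [cdDDD, h1, h2]
  simp only [lo3]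
  rw [d_lo_sub_Gam, lo_sub, lo_sub]
  simp only [d_lo2_sub_Gam]

theorem cdUDD_Gam (x : Fin n → Fin n → Fin n → R) (α β σ μ) :
    A.cdUDD A.Gam (A.mix3 x) α β σ μ = A.mix3 (fun i j k => A.d μ (x i j k)) α β σ := by
  have h1 : ∑ ε, A.mix3 x α ε σ * A.Gam ε β μ
      = A.hi (fun i => ∑ ε, A.lo2 (x i) ε σ * A.Gam ε β μ) α := by
    simp only [mix3, hi_mul, sum_hi]
  have h2 : ∑ ε, A.mix3 x α β ε * A.Gam ε σ μ
      = A.hi (fun i => ∑ ε, A.lo2 (x i) β ε * A.Gam ε σ μ) α := by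
    simp only [mix3, hi_mul, sum_hi]
  rw [cdUDD, h1, h2]
  simp only [mix3]
  rw [d_hi_add_Gam, hi_sub, hi_sub]
  simp only [d_lo2_sub_Gam]

theorem cdDDU_Gam (x : Fin n → Fin n → Fin n → R) (α β σ μ) :
    A.cdDDU A.Gam (fun μ ν α => A.mix3 x α μ ν) α β σ μ
      = A.mix3 (fun i j k => A.d μ (x i j k)) σ α β := by
  rw [← cdUDD_Gam, cdUDD, cdDDU]; ring

end DifferentialFrame

namespace DifferentialFrame

variable {R : Type*} [CommRing R] [Algebra ℝ R] {n : ℕ} (A : DifferentialFrame R n)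

/-! ### Contortion and torsion in the frame -/

theorem g_symm (μ ν) : A.g μ ν = A.g ν μ := by simp only [g, mul_comm]

theorem gInv_symm (μ ν) : A.gInv μ ν = A.gInv ν μ := by simp only [gInv, mul_comm]

theorem sum_g_gInv (α β) : ∑ ε, A.g α ε * A.gInv ε β = if α = β then 1 else 0 := by
  have key (ε) : A.gInv ε β = A.hi (fun i => A.up i β) ε := by simp [gInv, hi]
  simp_rw [key, sum_g_mul_hi]
  exact A.sum_up_dn' α β

theorem sum_gInv_g (α β) : ∑ ε, A.gInv α ε * A.g ε β = if α = β then 1 else 0 := by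
  simp_rw [A.gInv_symm α, A.g_symm _ β, mul_comm (A.gInv _ _), sum_g_gInv, eq_comm]

theorem Gam0_symm (α μ ν) : A.Gam0 α μ ν = A.Gam0 α ν μ := by
  simp only [Gam0]
  congr 1
  refine Finset.sum_congr rfl fun ε _ => ?_
  rw [A.g_symm μ ν]; ring

theorem sum_g_mul_Gam0 (α μ ν) : ∑ ε, A.g α ε * A.Gam0 ε μ ν
    = half R * (A.d μ (A.g α ν) + A.d ν (A.g α μ) - A.d α (A.g μ ν)) := by
  rw [← sum_mul_sum_eq A.sum_g_gInv
    (fun α => A.d μ (A.g α ν) + A.d ν (A.g α μ) - A.d α (A.g μ ν)) α, Finset.mul_sum]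
  exact Finset.sum_congr rfl fun _ _ => by rw [Gam0]; ring

theorem sum_g_mul_Gam (α μ ν) :
    ∑ ε, A.g α ε * A.Gam ε μ ν = ∑ i, A.dn i α * A.d ν (A.dn i μ) :=
  A.sum_g_mul_hi (fun i => A.d ν (A.dn i μ)) α

theorem d_g (α μ ν) : A.d ν (A.g α μ)
    = ∑ i, A.dn i α * A.d ν (A.dn i μ) + ∑ i, A.dn i μ * A.d ν (A.dn i α) := by
  simp only [g, map_sum, Derivation.leibniz, smul_eq_mul, Finset.sum_add_distrib]

theorem gamLow_eq (α μ ν) : A.gamLow α μ ν = ∑ i, A.dn i α * A.d ν (A.dn i μ)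
    - half R * (A.d μ (A.g α ν) + A.d ν (A.g α μ) - A.d α (A.g μ ν)) := by
  simp only [gamLow, gam, mul_sub, Finset.sum_sub_distrib, sum_g_mul_Gam, sum_g_mul_Gam0]

/-- Both connections preserve `g`, so their difference is skew in the pair of indices on which it
acts as an endomorphism. -/
theorem gamLow_antisymm (α μ ν) : A.gamLow α μ ν = -A.gamLow μ α ν := by
  have h := A.d_g α μ ν
  rw [gamLow_eq, gamLow_eq, A.g_symm μ α]
  linear_combination -h - A.d ν (A.g α μ) * two_mul_half (R := R)

/-- Frame components of the contortion. -/
def ct (i j k : Fin n) : R :=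
  A.frLo (fun α => A.frLo (fun μ => A.frLo (A.gamLow α μ) k) j) i

/-- Frame components of the torsion. -/
def tt (i j k : Fin n) : R := A.ct i j k - A.ct i k j

/-- Frame components of the basic vector. -/
def cc (i : Fin n) : R := ∑ k, A.ct k i k

theorem ct_antisymm (i j k) : A.ct i j k = -A.ct j i k := by
  have h (a b) : A.frLo (A.gamLow a b) k = -A.frLo (A.gamLow b a) k := by
    simp only [frLo, A.gamLow_antisymm a b, mul_neg, Finset.sum_neg_distrib]
  simp only [ct, frLo, Finset.mul_sum] at h ⊢
  rw [Finset.sum_comm, ← Finset.sum_neg_distrib]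
  refine Finset.sum_congr rfl fun α _ => ?_
  rw [← Finset.sum_neg_distrib]
  refine Finset.sum_congr rfl fun μ _ => ?_
  have := h μ α
  simp only [← Finset.mul_sum, this]
  ring

theorem eq_zero_of_eq_neg {a : R} (h : a = -a) : a = 0 := by
  linear_combination half R * h - a * two_mul_half (R := R)

theorem ct_self (i k) : A.ct i i k = 0 := eq_zero_of_eq_neg (A.ct_antisymm i i k)

theorem tt_antisymm (i j k) : A.tt i j k = -A.tt i k j := by simp [tt]

/-- The second half of `tt k i k` is `ct k k i`, which is zero by skewness; so the basic vector is
the trace of the contortion. -/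
theorem sum_tt (i) : ∑ k, A.tt k i k = A.cc i := by simp [tt, cc, ct_self]

theorem gamLow_eq_lo3 (α μ ν) : A.gamLow α μ ν = A.lo3 A.ct α μ ν := by
  have h1 (w : Fin n → Fin n → R) (k ν) :
      A.lo (fun i => A.frLo (fun α => w α i) k) ν = A.frLo (fun α => A.lo (w α) ν) k := by
    simp only [frLo, ← sum_lo, ← mul_lo]
  simp only [lo3, lo2, ct, h1, lo_frLo]

theorem gam_eq (α μ ν) : A.gam α μ ν = A.mix3 A.ct α μ ν := by
  have h := sum_mul_sum_eq A.sum_gInv_g (fun ε => A.gam ε μ ν) α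
  rw [← h]
  change ∑ k, A.gInv α k * A.gamLow k μ ν = _
  simp only [gamLow_eq_lo3, lo3, sum_gInv_mul_lo]
  rfl

theorem mix3_swap (x : Fin n → Fin n → Fin n → R) (α μ ν) :
    A.mix3 x α ν μ = A.mix3 (fun i j k => x i k j) α μ ν := by
  simp only [mix3, A.lo2_swap _ μ ν]

theorem mix3_add (x y : Fin n → Fin n → Fin n → R) (α μ ν) :
    A.mix3 x α μ ν + A.mix3 y α μ ν = A.mix3 (fun i j k => x i j k + y i j k) α μ ν := by
  simp only [mix3, hi_add, lo2_add]

theorem mix3_sub (x y : Fin n → Fin n → Fin n → R) (α μ ν) :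
    A.mix3 x α μ ν - A.mix3 y α μ ν = A.mix3 (fun i j k => x i j k - y i j k) α μ ν := by
  simp only [mix3, hi_sub, lo2_sub]

/-- `Γ°` is symmetric in its lower indices, so the torsion is the skew part of the contortion. From
here on the contortion is the only independent field. -/
theorem Tor_eq (α μ ν) : A.Tor α μ ν = A.mix3 A.tt α μ ν := by
  have h : A.Tor α μ ν = A.gam α μ ν - A.gam α ν μ := by
    simp only [Tor, gam, A.Gam0_symm α μ ν]; ring
  rw [h, gam_eq, gam_eq, A.mix3_swap _ α μ ν, mix3_sub]; rfl

theorem Om_eq (α μ ν) :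
    A.Om α μ ν = A.mix3 (fun i j k => A.ct i j k + A.ct i k j) α μ ν := by
  rw [Om, gam_eq, gam_eq, A.mix3_swap _ α μ ν, mix3_add]

theorem C_eq (μ) : A.C μ = A.lo A.cc μ := by
  have h (α) : A.Tor α μ α = A.lo (fun j => A.hi (fun i => A.lo (A.tt i j) α) α) μ := by
    simp only [Tor_eq, mix3, lo2, hi_lo_comm]
  simp only [C, h, sum_lo]
  congr 1; funext j
  rw [← sum_tt]
  simp only [hi]
  rw [Finset.sum_comm]
  exact Finset.sum_congr rfl fun i _ => A.frLo_lo (A.tt i j) i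

theorem CUp_eq (μ) : A.CUp μ = A.hi A.cc μ := by
  simp only [CUp, C_eq, sum_gInv_mul_lo]

theorem TorLow_eq (α μ ν) : A.TorLow α μ ν = A.lo3 A.tt α μ ν := by
  simp only [TorLow, Tor_eq, mix3, sum_g_mul_hi]; rfl

theorem gamMix_eq (μ ν α) : A.gamMix μ ν α = A.mix3 (fun k i j => A.ct i j k) α μ ν := by
  simp only [gamMix, gamLow_eq_lo3, lo3, lo2, mul_lo, sum_lo]
  simp only [← mul_lo, sum_gInv_mul_lo, mix3, lo2, hi_lo_comm]

/-! ### The fundamental tensors in the frame -/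

/-- Contracting the derivative index with the contravariant one turns `∂_α` into the frame
derivative `e i`. -/
theorem sum_mix3_d (x : Fin n → Fin n → Fin n → R) (μ ν) :
    ∑ α, A.mix3 (fun i j k => A.d α (x i j k)) α μ ν
      = A.lo2 (fun j k => ∑ i, A.e i (x i j k)) μ ν := by
  simp only [mix3, hi, mul_lo2, sum_lo2, e]
  congr 1; funext j k; exact Finset.sum_comm

theorem sum_lo_mul_mix3 (f : Fin n → R) (x : Fin n → Fin n → Fin n → R) (μ ν) :
    ∑ α, A.lo f α * A.mix3 x α μ ν = A.lo2 (fun j k => ∑ i, f i * x i j k) μ ν := by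
  simp only [mix3, sum_lo_mul_hi, mul_lo2, sum_lo2]

theorem sum_mix3_mul_mix3 (x y : Fin n → Fin n → Fin n → R) (μ ν) :
    ∑ α, ∑ β, A.mix3 x β α μ * A.mix3 y α β ν
      = A.lo2 (fun i j => ∑ k, ∑ l, x k l i * y l k j) μ ν := by
  have h := A.sum_hi_lo_mul_hi_lo (fun k l => A.lo (x k l) μ) (fun k l => A.lo (y k l) ν)
  simp only [mix3, lo2] at h ⊢
  rw [h]
  simp only [lo_mul_lo, sum_lo2]
  rfl

theorem eta_eq (μ ν) : A.eta μ ν = A.lo2 (fun i j => ∑ k, A.cc k * A.tt k i j) μ ν := by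
  simp only [eta, C_eq, Tor_eq, sum_lo_mul_mix3]

theorem phi_eq (μ ν) :
    A.phi μ ν = A.lo2 (fun i j => ∑ k, A.cc k * (A.ct k i j + A.ct k j i)) μ ν := by
  simp only [phi, C_eq, Om_eq, sum_lo_mul_mix3]

theorem gam2_eq (μ ν) : A.gam2 μ ν = A.lo2 (fun i j => ∑ k, A.cc k * A.ct i j k) μ ν := by
  simp only [gam2, C_eq, gamMix_eq, sum_lo_mul_mix3]

theorem xi_eq (μ ν) : A.xi μ ν = A.lo2 (fun i j => ∑ k, A.e k (A.ct i j k)) μ ν := by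
  have h : A.gamMix = fun μ ν α => A.mix3 (fun k i j => A.ct i j k) α μ ν := by
    funext μ ν α; exact A.gamMix_eq μ ν α
  simp only [xi, h, cdDDU_Gam, sum_mix3_d]

theorem psi_eq (μ ν) :
    A.psi μ ν = A.lo2 (fun i j => ∑ k, A.e k (A.ct k i j + A.ct k j i)) μ ν := by
  have h : A.Om = A.mix3 (fun i j k => A.ct i j k + A.ct i k j) := by
    funext α μ ν; exact A.Om_eq α μ ν
  simp only [psi, h, cdUDD_Gam, sum_mix3_d]

theorem C_eq_lo : A.C = A.lo A.cc := funext A.C_eq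

theorem CUp_eq_hi : A.CUp = A.hi A.cc := funext A.CUp_eq

theorem cdD_C (μ ν) : A.cdD A.Gam A.C μ ν = A.lo2 (fun i j => A.e j (A.cc i)) μ ν := by
  rw [C_eq_lo, cdD_Gam]
  simp only [lo2, lo_e]

theorem theta_eq (μ ν) :
    A.theta μ ν = A.lo2 (fun i j => A.e j (A.cc i) + A.e i (A.cc j)) μ ν := by
  rw [theta, cdD_C, cdD_C, A.lo2_swap _ μ ν, lo2_add]

theorem sum_cdU_CUp : ∑ ε, A.cdU A.Gam A.CUp ε ε = ∑ i, A.e i (A.cc i) := by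
  simp only [CUp_eq_hi, cdU_Gam, sum_hi_d]

theorem sum_CUp_mul_C : ∑ ε, A.CUp ε * A.C ε = ∑ i, A.cc i * A.cc i := by
  simp only [CUp_eq_hi, C_eq_lo, sum_hi_mul_lo]

theorem sum_CUp_mul_TorLow (μ ν) :
    ∑ ε, A.CUp ε * A.TorLow μ ε ν = A.lo2 (fun i j => ∑ k, A.cc k * A.tt i k j) μ ν := by
  have h (ε) : A.TorLow μ ε ν = A.lo (fun k => A.lo2 (fun i j => A.tt i k j) μ ν) ε := by
    simp only [TorLow_eq, lo3, lo2]
    exact A.lo_lo_comm _ _ _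
  simp only [h, CUp_eq_hi, sum_hi_mul_lo, mul_lo2, sum_lo2]

theorem sum_gInv_mul_cdDDD_TorLow (μ ν) :
    ∑ ε, ∑ α, A.gInv ε α * A.cdDDD A.Gam A.TorLow μ ν α ε
      = A.lo2 (fun i j => ∑ k, A.e k (A.tt i j k)) μ ν := by
  have h : A.TorLow = A.lo3 A.tt := by funext α μ ν; exact A.TorLow_eq α μ ν
  have h1 (ε) : ∑ α, A.gInv ε α * A.cdDDD A.Gam A.TorLow μ ν α ε
      = A.mix3 (fun k i j => A.d ε (A.tt i j k)) ε μ ν := by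
    simp only [h, cdDDD_Gam, lo3, lo2, mul_lo, sum_lo]
    simp only [← mul_lo, sum_gInv_mul_lo, mix3, lo2, hi_lo_comm]
  simp only [h1]
  exact A.sum_mix3_d (fun k i j => A.tt i j k) μ ν

/-- Frame components of `σ_{μν}`. -/
def sigF (i j : Fin n) : R := ∑ k, ∑ l, A.ct k l i * A.ct l k j

/-- Frame components of `ϖ_{μν}`. -/
def varF (i j : Fin n) : R :=
  ∑ k, ∑ l, A.ct k l i * A.ct l j k + ∑ k, ∑ l, A.ct k i l * A.ct l k j

/-- Frame components of `ω_{μν}`. -/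
def omF (i j : Fin n) : R := ∑ k, ∑ l, A.ct k i l * A.ct l j k

theorem sigma_eq (μ ν) : A.sigma μ ν = A.lo2 A.sigF μ ν := by
  simp only [sigma, gam_eq, sum_mix3_mul_mix3]; rfl

theorem omega_eq (μ ν) : A.omega μ ν = A.lo2 A.omF μ ν := by
  have h (α β) : A.gam β μ α = A.mix3 (fun i j k => A.ct i k j) β α μ := by
    rw [gam_eq, mix3_swap]
  have h' (α β) : A.gam α ν β = A.mix3 (fun i j k => A.ct i k j) α β ν := by
    rw [gam_eq, mix3_swap]
  simp only [omega, h, h', sum_mix3_mul_mix3]; rfl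

theorem varpi_eq (μ ν) : A.varpi μ ν = A.lo2 A.varF μ ν := by
  have h (α β μ) : A.gam β μ α = A.mix3 (fun i j k => A.ct i k j) β α μ := by
    rw [gam_eq, mix3_swap]
  have h1 : ∑ α, ∑ β, A.gam β α μ * A.gam α ν β
      = A.lo2 (fun i j => ∑ k, ∑ l, A.ct k l i * A.ct l j k) μ ν := by
    simp only [gam_eq, A.mix3_swap _ _ _ ν, sum_mix3_mul_mix3]
  have h2 : ∑ α, ∑ β, A.gam β μ α * A.gam α β ν
      = A.lo2 (fun i j => ∑ k, ∑ l, A.ct k i l * A.ct l k j) μ ν := by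
    simp only [gam_eq, A.mix3_swap _ _ _ μ, sum_mix3_mul_mix3]
  simp only [varpi, Finset.sum_add_distrib, h1, h2, lo2_add]; rfl

/-- Frame components of `H_{μν}`. -/
def hF (i j : Fin n) : R := ∑ k, ∑ l, A.tt k l i * A.tt l k j - A.cc i * A.cc j

theorem H_eq (μ ν) : A.H μ ν = A.lo2 A.hF μ ν := by
  have h : ∑ α, ∑ ε, A.Tor α ε μ * A.Tor ε α ν = ∑ α, ∑ ε, A.Tor ε α μ * A.Tor α ε ν :=
    Finset.sum_comm
  rw [H, h]
  simp only [Tor_eq, sum_mix3_mul_mix3, C_eq, lo_mul_lo, lo2_sub]; rfl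

/-- The product of two torsions has four contortion terms: one gives `σ`, one gives `ω`, and the two
mixed ones make up `ϖ`. -/
theorem hF_eq (i j) : A.hF i j = A.sigF i j - A.varF i j + A.omF i j - A.cc i * A.cc j := by
  simp only [hF, tt, sigF, varF, omF, ← Finset.sum_add_distrib, ← Finset.sum_sub_distrib]
  congr 1
  exact Finset.sum_congr rfl fun _ _ => Finset.sum_congr rfl fun _ _ => by ring

theorem omF_symm (i j) : A.omF i j = A.omF j i := by
  simp only [omF]; rw [Finset.sum_comm]
  exact Finset.sum_congr rfl fun _ _ => Finset.sum_congr rfl fun _ _ => by ring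

theorem sigF_symm (i j) : A.sigF i j = A.sigF j i := by
  simp only [sigF]; rw [Finset.sum_comm]
  exact Finset.sum_congr rfl fun _ _ => Finset.sum_congr rfl fun _ _ => by ring

theorem varF_symm (i j) : A.varF i j = A.varF j i := by
  simp only [varF]; rw [add_comm]
  congr 1 <;> rw [Finset.sum_comm] <;>
  exact Finset.sum_congr rfl fun _ _ => Finset.sum_congr rfl fun _ _ => by ring

theorem tr_of_eq {a x : Fin n → Fin n → R} (h : ∀ μ ν, a μ ν = A.lo2 x μ ν) :
    A.tr a = ∑ i, x i i := by
  rw [← A.tr_lo2]; simp only [tr, h]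

/-- Frame components of `E_{μν}`. -/
def eF (i j : Fin n) : R :=
  (if i = j then 1 else 0) * (∑ k, A.hF k k + 2 * (∑ k, A.cc k * A.cc k - ∑ k, A.e k (A.cc k)))
    - 2 * A.hF i j - 2 * (A.cc i * A.cc j - A.e i (A.cc j))
    - 2 * (∑ k, A.cc k * A.tt i k j + ∑ k, A.e k (A.tt i j k))

theorem E_eq (μ ν) : A.E μ ν = A.lo2 A.eF μ ν := by
  rw [E, A.tr_of_eq A.H_eq, sum_cdU_CUp, sum_CUp_mul_C, sum_CUp_mul_TorLow,
    sum_gInv_mul_cdDDD_TorLow, cdD_C, H_eq, g_eq, C_eq, C_eq, lo_mul_lo, A.lo2_swap _ μ ν]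
  simp only [mul_lo2, lo2_mul, lo2_add, lo2_sub]
  congr 1; funext i j
  simp only [eF]; ring

end DifferentialFrame

namespace DifferentialFrame

variable {R : Type*} [CommRing R] [Algebra ℝ R] {n : ℕ} (A : DifferentialFrame R n)

/-! ### Curvature of the natural metric connection in the frame -/

/-- Contortion with two frame indices and one coordinate index; its negative is the spin
connection. -/
def w (i j μ : Fin n) : R := A.lo (A.ct i j) μ

theorem w_antisymm (i j μ) : A.w i j μ = -A.w j i μ := by
  simp only [w, lo, A.ct_antisymm i j, mul_neg, Finset.sum_neg_distrib]

theorem Gam0_eq (α μ ν) : A.Gam0 α μ ν = A.Gam α μ ν - A.gam α μ ν := by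
  rw [gam]; ring

theorem gam_eq_w (α μ ν) : A.gam α μ ν = A.hi (fun i => A.lo (fun j => A.w i j ν) μ) α := by
  rw [gam_eq]; rfl

/-- Curvature of the spin connection. -/
def Fc (i j μ ν : Fin n) : R :=
  -A.d μ (A.w i j ν) + A.d ν (A.w i j μ) + ∑ m, (A.w i m μ * A.w m j ν - A.w i m ν * A.w m j μ)

section matrices

def mapd (μ : Fin n) (M : Matrix (Fin n) (Fin n) R) : Matrix (Fin n) (Fin n) R :=
  Matrix.of fun i j => A.d μ (M i j)

theorem mapd_mul (μ) (M N : Matrix (Fin n) (Fin n) R) :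
    A.mapd μ (M * N) = A.mapd μ M * N + M * A.mapd μ N := by
  ext i j
  simp only [mapd, Matrix.of_apply, Matrix.mul_apply, Matrix.add_apply, map_sum,
    Derivation.leibniz, smul_eq_mul, ← Finset.sum_add_distrib]
  exact Finset.sum_congr rfl fun _ _ => by ring

theorem mapd_add (μ) (M N : Matrix (Fin n) (Fin n) R) :
    A.mapd μ (M + N) = A.mapd μ M + A.mapd μ N := by
  ext; simp [mapd]

theorem mapd_sub (μ) (M N : Matrix (Fin n) (Fin n) R) :
    A.mapd μ (M - N) = A.mapd μ M - A.mapd μ N := by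
  ext; simp [mapd]

theorem mapd_neg (μ) (M : Matrix (Fin n) (Fin n) R) : A.mapd μ (-M) = -A.mapd μ M := by
  ext; simp [mapd]

theorem mapd_comm (μ ν) (M : Matrix (Fin n) (Fin n) R) :
    A.mapd μ (A.mapd ν M) = A.mapd ν (A.mapd μ M) := by
  ext; simp [mapd, A.d_comm μ ν]

def matUp : Matrix (Fin n) (Fin n) R := Matrix.of fun α i => A.up i α

def matDn : Matrix (Fin n) (Fin n) R := Matrix.of fun i β => A.dn i β

def matW (μ : Fin n) : Matrix (Fin n) (Fin n) R := Matrix.of fun i j => A.w i j μ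

def matGam0 (μ : Fin n) : Matrix (Fin n) (Fin n) R := Matrix.of fun α β => A.Gam0 α β μ

def matF (μ ν : Fin n) : Matrix (Fin n) (Fin n) R :=
  -A.mapd μ (A.matW ν) + A.mapd ν (A.matW μ) + (A.matW μ * A.matW ν - A.matW ν * A.matW μ)

theorem matF_apply (μ ν i j) : A.matF μ ν i j = A.Fc i j μ ν := by
  simp [matF, Fc, mapd, matW, Matrix.mul_apply, Finset.sum_sub_distrib]

theorem matDn_mul_matUp : A.matDn * A.matUp = 1 := by
  ext i j; simp [matDn, matUp, Matrix.mul_apply, sum_dn_up, Matrix.one_apply]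

theorem matDn_mul_matUp_mul (M : Matrix (Fin n) (Fin n) R) : A.matDn * (A.matUp * M) = M := by
  rw [← mul_assoc, matDn_mul_matUp, one_mul]

theorem mapd_matUp (μ) : A.mapd μ A.matUp = -(A.matUp * (A.mapd μ A.matDn * A.matUp)) := by
  have h : A.mapd μ (A.matDn * A.matUp) = 0 := by
    rw [matDn_mul_matUp]; ext i j; simp only [mapd, Matrix.of_apply, Matrix.one_apply]
    split_ifs <;> simp
  rw [mapd_mul] at h
  have hh : A.matUp * A.matDn = 1 := mul_eq_one_comm.mp A.matDn_mul_matUp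
  calc A.mapd μ A.matUp = A.matUp * A.matDn * A.mapd μ A.matUp := by rw [hh, one_mul]
    _ = A.matUp * (A.matDn * A.mapd μ A.matUp) := mul_assoc _ _ _
    _ = _ := by rw [eq_neg_of_add_eq_zero_right h, mul_neg]

/-- `Γ°` is the gauge transform of `-w` by the frame. The first term is the flat canonical
connection. -/
theorem matGam0_eq (μ) :
    A.matGam0 μ = A.matUp * A.mapd μ A.matDn - A.matUp * (A.matW μ * A.matDn) := by
  ext α β
  simp only [matGam0, Matrix.of_apply, Gam0_eq, gam_eq_w, Matrix.sub_apply, Matrix.mul_apply,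
    matUp, matDn, mapd, matW, hi, lo, Gam]
  simp only [mul_comm]

/-- Curvature is covariant under gauge transformations: second derivatives of the frame cancel by
`mapd_comm`, and what is left is the curvature of `-w` conjugated by the frame. -/
theorem matGam0_curv (μ ν) :
    A.mapd μ (A.matGam0 ν) - A.mapd ν (A.matGam0 μ)
      + (A.matGam0 μ * A.matGam0 ν - A.matGam0 ν * A.matGam0 μ)
      = A.matUp * (A.matF μ ν * A.matDn) := by
  simp only [matGam0_eq, mapd_sub, mapd_mul, mapd_matUp, matF, mul_sub, sub_mul, mul_add, add_mul,
    mul_assoc, neg_mul, mul_neg, matDn_mul_matUp_mul, A.mapd_comm μ ν A.matDn]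
  abel

theorem curv0_eq (α β μ ν) :
    A.curv0 α β μ ν = A.hi (fun i => A.lo (fun j => A.Fc i j μ ν) β) α := by
  have h := congrArg (fun M => M α β) (A.matGam0_curv μ ν)
  simp only [Matrix.add_apply, Matrix.sub_apply, Matrix.mul_apply, matF_apply, mapd, matGam0,
    Matrix.of_apply, matUp, matDn] at h
  simp only [curv0, hi, lo, Finset.sum_sub_distrib]
  simp only [mul_comm (A.dn _ _), ← h]
  simp only [mul_comm]

/-- The form `w` takes values in skew matrices, which are closed under the commutator. -/
theorem Fc_antisymm (i j μ ν) : A.Fc i j μ ν = -A.Fc j i μ ν := by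
  simp only [Fc, A.w_antisymm i j, map_neg, neg_add, ← Finset.sum_neg_distrib]
  congr 1
  refine Finset.sum_congr rfl fun m _ => ?_
  rw [A.w_antisymm i m μ, A.w_antisymm i m ν, A.w_antisymm m j ν, A.w_antisymm m j μ]; ring

theorem Fc_antisymm' (i j μ ν) : A.Fc i j μ ν = -A.Fc i j ν μ := by
  simp only [Fc, neg_add, ← Finset.sum_neg_distrib, neg_sub, neg_neg]
  ring

theorem sum_curv0_self (μ ν) : ∑ α, A.curv0 α α μ ν = 0 := by
  simp only [curv0_eq, hi]
  rw [Finset.sum_comm]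
  have h (i) : ∑ α, A.up i α * A.lo (fun j => A.Fc i j μ ν) α = A.Fc i i μ ν :=
    A.frLo_lo (fun j => A.Fc i j μ ν) i
  simp only [h]
  exact Finset.sum_eq_zero fun i _ => eq_zero_of_eq_neg (A.Fc_antisymm i i μ ν)

theorem curv0_antisymm (α β μ ν) : A.curv0 α β μ ν = -A.curv0 α β ν μ := by
  simp only [curv0, Finset.sum_sub_distrib]; ring

/-- First Bianchi identity; it uses only that `Γ°` is symmetric. -/
theorem curv0_cyclic (α β μ ν) : A.curv0 α β μ ν + A.curv0 α μ ν β + A.curv0 α ν β μ = 0 := by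
  simp only [curv0, A.Gam0_symm _ ν β, A.Gam0_symm _ ν μ, A.Gam0_symm _ μ β,
    Finset.sum_sub_distrib]
  ring

/-- Contraction of the first Bianchi identity. The term that would spoil the symmetry is the trace
`R^α_{αβν}`, which vanishes because the connection is metric. -/
theorem ricci_curv0_symm (β ν) : ricci A.curv0 β ν = ricci A.curv0 ν β := by
  have h : ∑ α, (A.curv0 α β ν α + A.curv0 α ν α β + A.curv0 α α β ν) = 0 :=
    Finset.sum_eq_zero fun α _ => A.curv0_cyclic α β ν α
  simp only [Finset.sum_add_distrib, sum_curv0_self, A.curv0_antisymm _ ν _ β,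
    Finset.sum_neg_distrib] at h
  simp only [ricci]
  linear_combination h

end matrices

/-- Frame components of the curvature. -/
def fF (i j k l : Fin n) : R :=
  -A.e k (A.ct i j l) + A.e l (A.ct i j k) + ∑ p, A.ct i j p * A.tt p k l
    + ∑ m, (A.ct i m k * A.ct m j l - A.ct i m l * A.ct m j k)

/-- Structure equation. -/
theorem d_dn_sub (i μ ν) :
    A.d ν (A.dn i μ) - A.d μ (A.dn i ν) = A.lo2 (A.tt i) μ ν := by
  have h := A.frHi_hi (fun i => A.lo2 (A.tt i) μ ν) i
  rw [← h, show (A.hi fun i => A.lo2 (A.tt i) μ ν) = fun α => A.Tor α μ ν from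
    funext fun α => (A.Tor_eq α μ ν).symm]
  simp only [frHi, Tor, mul_sub, Finset.sum_sub_distrib, sum_dn_mul_Gam]

theorem lo2_e_left (f : Fin n → R) (μ ν) :
    A.lo2 (fun k l => A.e k (f l)) μ ν = A.lo (fun l => A.d μ (f l)) ν := by
  rw [← A.lo2_swap (fun k l => A.e l (f k))]
  simp only [lo2, lo_e]

/-- Differentiating `w = λ_{kμ} ct i j k` also differentiates the coframe; by the structure equation
`d_dn_sub` these extra terms assemble into `ct · tt`. -/
theorem Fc_eq (i j μ ν) : A.Fc i j μ ν = A.lo2 (A.fF i j) μ ν := by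
  have h1 : ∑ p, A.ct i j p * A.d ν (A.dn p μ) - ∑ p, A.ct i j p * A.d μ (A.dn p ν)
      = A.lo2 (fun k l => ∑ p, A.ct i j p * A.tt p k l) μ ν := by
    simp only [← Finset.sum_sub_distrib, ← mul_sub, d_dn_sub, mul_lo2, sum_lo2]
  have h2 : ∑ m, (A.w i m μ * A.w m j ν - A.w i m ν * A.w m j μ)
      = A.lo2 (fun k l => ∑ m, (A.ct i m k * A.ct m j l - A.ct i m l * A.ct m j k)) μ ν := by
    have key (m) : A.w i m ν * A.w m j μ = A.lo2 (fun k l => A.ct i m l * A.ct m j k) μ ν := by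
      simp only [w, lo_mul_lo, A.lo2_swap _ μ ν]
    simp only [key]
    simp only [w, lo_mul_lo, lo2_sub, sum_lo2]
  have h3 : A.lo2 (fun k l => -A.e k (A.ct i j l)) μ ν = -A.lo (fun l => A.d μ (A.ct i j l)) ν := by
    rw [← lo2_e_left]; simp [lo2, lo]
  have h4 : A.lo2 (fun k l => A.e l (A.ct i j k)) μ ν = A.lo (fun k => A.d ν (A.ct i j k)) μ := by
    simp only [lo2, lo_e]
  have h5 : A.lo2 (A.fF i j) μ ν = A.lo2 (fun k l => -A.e k (A.ct i j l)) μ ν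
      + A.lo2 (fun k l => A.e l (A.ct i j k)) μ ν
      + A.lo2 (fun k l => ∑ p, A.ct i j p * A.tt p k l) μ ν
      + A.lo2 (fun k l => ∑ m, (A.ct i m k * A.ct m j l - A.ct i m l * A.ct m j k)) μ ν := by
    simp only [lo2_add]; rfl
  rw [h5, h3, h4, ← h1, ← h2, Fc]
  simp only [w, d_lo]
  ring

/-- Frame components of the Ricci tensor. -/
def ricF (j l : Fin n) : R :=
  -A.e l (A.cc j) + ∑ i, A.e i (A.ct i j l) - ∑ m, A.cc m * A.ct m j l + A.omF j l

theorem sum_fF (j l) : ∑ i, A.fF i j l i = A.ricF j l := by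
  -- One half of the torsion in the first sum cancels the second sum after relabelling; the
  -- surviving half is `ω`.
  have h1 : ∑ i, ∑ p, A.ct i j p * A.tt p l i + ∑ i, ∑ m, A.ct i m l * A.ct m j i
      = A.omF j l := by
    rw [Finset.sum_comm (f := fun i m => A.ct i m l * A.ct m j i)]
    simp only [tt, omF, ← Finset.sum_add_distrib]
    exact Finset.sum_congr rfl fun _ _ => Finset.sum_congr rfl fun _ _ => by ring
  have h2 : ∑ i, ∑ m, A.ct i m i * A.ct m j l = ∑ m, A.cc m * A.ct m j l := by
    rw [Finset.sum_comm]; simp only [cc, Finset.sum_mul]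
  simp only [fF, Finset.sum_add_distrib, Finset.sum_sub_distrib, Finset.sum_neg_distrib, h2,
    ricF, ← h1, cc, e_sum]
  ring

theorem ricci_curv0_eq (β ν) : ricci A.curv0 β ν = A.lo2 A.ricF β ν := by
  have h (α) : A.curv0 α β ν α
      = A.lo2 (fun j l => A.hi (fun i => A.lo (A.fF i j l) α) α) β ν := by
    simp only [curv0_eq, Fc_eq, lo2, hi_lo_comm]
  simp only [ricci, h, sum_lo2]
  congr 1; funext j l
  rw [← sum_fF]
  simp only [hi]
  rw [Finset.sum_comm]
  exact Finset.sum_congr rfl fun i _ => A.frLo_lo (A.fF i j l) i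

/-- The formula for `ricF` is not manifestly symmetric. Its symmetry comes from the first Bianchi
identity and imposes a differential relation on the contortion. -/
theorem ricF_symm (j l) : A.ricF j l = A.ricF l j := by
  refine A.lo2_inj (x := A.ricF) (y := fun j l => A.ricF l j) (fun μ ν => ?_) j l
  rw [← A.lo2_swap A.ricF μ ν, ← ricci_curv0_eq, ← ricci_curv0_eq, ricci_curv0_symm]

/-- A symmetric matrix equals its symmetrisation, and symmetrising `ricF` produces exactly `θ`, `ψ`
and `φ`. -/
theorem ricF_eq (j l) : A.ricF j l = -half R * ((A.e l (A.cc j) + A.e j (A.cc l))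
    - ∑ k, A.e k (A.ct k j l + A.ct k l j) + ∑ k, A.cc k * (A.ct k j l + A.ct k l j))
    + A.omF j l := by
  have h := A.ricF_symm j l
  have h1 : A.ricF j l = half R * (A.ricF j l + A.ricF l j) := by
    linear_combination half R * h - A.ricF j l * two_mul_half (R := R)
  rw [h1]
  simp only [ricF, A.omF_symm l j, mul_add, e_add, Finset.sum_add_distrib]
  linear_combination A.omF j l * two_mul_half (R := R)

theorem neg_lo2 (x : Fin n → Fin n → R) (μ ν) :
    -A.lo2 x μ ν = A.lo2 (fun i j => -x i j) μ ν := by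
  simp [lo2, lo]

theorem ricci_curv0_formula (β μ) : ricci A.curv0 β μ
    = -half R * (A.theta β μ - A.psi β μ + A.phi β μ) + A.omega β μ := by
  rw [ricci_curv0_eq, theta_eq, psi_eq, phi_eq, omega_eq, lo2_sub, lo2_add, mul_lo2, lo2_add]
  congr 1; funext j l; exact A.ricF_eq j l

/-- Contracted first Bianchi identity. -/
theorem e_cc_sub (j l) : A.e l (A.cc j) - A.e j (A.cc l)
    = ∑ i, A.e i (A.tt i j l) - ∑ i, A.cc i * A.tt i j l := by
  have h := A.ricF_symm j l
  simp only [ricF, A.omF_symm l j] at h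
  simp only [tt, e_sub, mul_sub, Finset.sum_sub_distrib]
  linear_combination -h

/-! ### The field equations -/

theorem einstein_curv0_eq (μ ν) : A.einstein A.curv0 μ ν
    = A.lo2 (fun i j => A.ricF i j - half R * (if i = j then 1 else 0) * ∑ k, A.ricF k k) μ ν := by
  rw [einstein, ricci_curv0_eq, A.tr_of_eq A.ricci_curv0_eq, g_eq, mul_lo2, lo2_mul, lo2_sub]

theorem T_eq (μ ν) : A.T μ ν
    = A.lo2 (fun i j => half R * (if i = j then 1 else 0) * (∑ k, A.sigF k k - ∑ k, A.varF k k)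
      - (A.sigF i j - A.varF i j)) μ ν := by
  rw [T, A.tr_of_eq A.sigma_eq, A.tr_of_eq A.varpi_eq, g_eq, sigma_eq, varpi_eq, mul_lo2, lo2_mul,
    lo2_sub, lo2_sub]

/-- Frame components of `F_{μν}`. -/
def fmF (i j : Fin n) : R :=
  ∑ k, A.cc k * A.ct i j k - ∑ k, A.e k (A.ct i j k) + ∑ k, A.cc k * A.tt k i j

theorem F_eq (μ ν) : A.F μ ν = A.lo2 A.fmF μ ν := by
  rw [F, gam2_eq, xi_eq, eta_eq, lo2_sub, lo2_add]; rfl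

theorem curl_C_eq (μ ν) : A.d ν (A.C μ) - A.d μ (A.C ν)
    = A.lo2 (fun i j => A.e j (A.cc i) - A.e i (A.cc j) + ∑ k, A.cc k * A.tt k i j) μ ν := by
  have h : A.d ν (A.C μ) - A.d μ (A.C ν)
      = A.cdD A.Gam A.C μ ν - A.cdD A.Gam A.C ν μ + A.eta μ ν := by
    simp only [cdD, eta, Tor, mul_sub, Finset.sum_sub_distrib]; ring
  rw [h, cdD_C, cdD_C, A.lo2_swap _ μ ν, eta_eq, lo2_sub, lo2_add]

theorem sum_ct_diag (k) : ∑ i, A.ct k i i = -A.cc k := by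
  simp only [cc, ← Finset.sum_neg_distrib]
  exact Finset.sum_congr rfl fun i _ => A.ct_antisymm k i i

theorem sum_ricF_diag : ∑ k, A.ricF k k = -2 * ∑ k, A.e k (A.cc k) + ∑ k, A.cc k * A.cc k
    + ∑ k, A.omF k k := by
  simp only [ricF, Finset.sum_add_distrib, Finset.sum_sub_distrib, Finset.sum_neg_distrib]
  rw [Finset.sum_comm (f := fun k i => A.e i (A.ct i k k)),
    Finset.sum_comm (f := fun k i => A.cc i * A.ct i k k)]
  simp only [← e_sum, ← Finset.mul_sum, sum_ct_diag, e_neg, mul_neg, Finset.sum_neg_distrib]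
  ring

theorem sum_hF_diag : ∑ k, A.hF k k = ∑ k, A.sigF k k - ∑ k, A.varF k k + ∑ k, A.omF k k
    - ∑ k, A.cc k * A.cc k := by
  simp only [hF_eq, Finset.sum_add_distrib, Finset.sum_sub_distrib]

/-- The terms of `E` involving derivatives of the torsion mix the symmetric and skew parts. Skewness
of `ct` rewrites `t_{ijk}` as `ct_{ijk} + ct_{kij}`; the `ct_{ijk}` terms, skew in `i, j`, go to
`F`, and the contracted first Bianchi identity sorts the rest into Ricci and the curl of `C`. The
quadratic terms follow from `hF_eq` and the two traces. -/
theorem eF_eq (i j) : A.eF i j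
    = -2 * ((A.ricF i j - half R * (if i = j then 1 else 0) * ∑ k, A.ricF k k)
        - (half R * (if i = j then 1 else 0) * (∑ k, A.sigF k k - ∑ k, A.varF k k)
          - (A.sigF i j - A.varF i j)))
      + 2 * (A.fmF i j
        - (A.e j (A.cc i) - A.e i (A.cc j) + ∑ k, A.cc k * A.tt k i j)) := by
  have h := A.e_cc_sub i j
  have h1 : ∑ k, A.cc k * A.tt i k j = ∑ k, A.cc k * (-A.ct k i j - A.ct i j k) :=
    Finset.sum_congr rfl fun k _ => by rw [tt, A.ct_antisymm i k j]
  have h2 : ∑ k, A.e k (A.tt i j k) = ∑ k, A.e k (A.ct i j k + A.ct k i j) :=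
    Finset.sum_congr rfl fun k _ => by rw [tt, A.ct_antisymm i k j]; congr 1; ring
  rw [eF, sum_ricF_diag, sum_hF_diag, hF_eq, h1, h2, fmF, ricF_eq]
  simp only [tt, e_add, e_sub, mul_sub, mul_neg, mul_add, Finset.sum_add_distrib,
    Finset.sum_sub_distrib, Finset.sum_neg_distrib] at h ⊢
  generalize (if i = j then (1 : R) else 0) = δ
  -- The multiplier of `two_mul_half` collects everything that occurs with a factor `2 * half R`;
  -- `δ` is the Kronecker symbol.
  linear_combination h - ((A.e j (A.cc i) + A.e i (A.cc j))
    - (∑ k, A.e k (A.ct k i j) + ∑ k, A.e k (A.ct k j i))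
    + (∑ k, A.cc k * A.ct k i j + ∑ k, A.cc k * A.ct k j i)
    + δ * (-2 * ∑ k, A.e k (A.cc k) + ∑ k, A.cc k * A.cc k + ∑ k, A.omF k k
      + (∑ k, A.sigF k k - ∑ k, A.varF k k))) * two_mul_half (R := R)

theorem E_split (μ ν) : A.E μ ν = -2 * (A.einstein A.curv0 μ ν - A.T μ ν)
    + 2 * (A.F μ ν - (A.d ν (A.C μ) - A.d μ (A.C ν))) := by
  rw [E_eq, einstein_curv0_eq, T_eq, F_eq, curl_C_eq, lo2_sub, lo2_sub, mul_lo2, mul_lo2, lo2_add]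
  congr 1; funext i j; exact A.eF_eq i j

theorem einstein_curv0_symm (μ ν) : A.einstein A.curv0 μ ν = A.einstein A.curv0 ν μ := by
  rw [einstein, einstein, ricci_curv0_symm, g_symm]

theorem T_symm (μ ν) : A.T μ ν = A.T ν μ := by
  rw [T_eq, T_eq, A.lo2_swap _ μ ν]
  simp only [A.sigF_symm, A.varF_symm, eq_comm]

theorem fmF_antisymm (i j) : A.fmF i j = -A.fmF j i := by
  simp only [fmF, A.ct_antisymm i j, A.tt_antisymm _ i j, e_neg, mul_neg, Finset.sum_neg_distrib]
  ring

theorem F_antisymm (μ ν) : A.F μ ν = -A.F ν μ := by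
  rw [F_eq, F_eq, A.lo2_swap _ μ ν, neg_lo2]
  congr 1; funext i j; exact A.fmF_antisymm i j

end DifferentialFrame

namespace DifferentialFrame

variable {R : Type*} [CommRing R] [Algebra ℝ R] {n : ℕ} (A : DifferentialFrame R n)

/-! ### Second Bianchi identity -/

/-- The covariant derivative of the curvature, with two frame and two coordinate indices. -/
def nabF (i j τ α σ : Fin n) : R :=
  A.d σ (A.Fc i j τ α) - ∑ k, A.w i k σ * A.Fc k j τ α - ∑ k, A.w j k σ * A.Fc i k τ α
    - ∑ ε, A.Gam0 ε τ σ * A.Fc i j ε α - ∑ ε, A.Gam0 ε α σ * A.Fc i j τ ε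

/-- Second Bianchi identity for the connection `-w`, whose covariant derivative is `∂ - [w, ·]`.
Second derivatives cancel because derivations commute, cubic terms because matrix multiplication is
associative. -/
theorem matF_bianchi (σ μ ν) :
    (A.mapd σ (A.matF μ ν) - (A.matW σ * A.matF μ ν - A.matF μ ν * A.matW σ))
    + (A.mapd μ (A.matF ν σ) - (A.matW μ * A.matF ν σ - A.matF ν σ * A.matW μ))
    + (A.mapd ν (A.matF σ μ) - (A.matW ν * A.matF σ μ - A.matF σ μ * A.matW ν)) = 0 := by
  simp only [matF, mapd_sub, mapd_mul, mapd_add, mapd_neg, mul_sub, sub_mul, mul_add, add_mul,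
    mul_assoc, neg_mul, mul_neg, A.mapd_comm ν μ, A.mapd_comm ν σ, A.mapd_comm μ σ]
  abel

/-- In the cyclic sum the `Γ°` terms cancel, `Γ°` being symmetric and `Fc` skew in the coordinate
indices; skewness of `w` turns the frame terms into the commutator of `matF_bianchi`. -/
theorem nabF_cyclic (i j σ μ ν) :
    A.nabF i j μ ν σ + A.nabF i j ν σ μ + A.nabF i j σ μ ν = 0 := by
  have h := congrArg (fun M => M i j) (A.matF_bianchi σ μ ν)
  simp only [Matrix.add_apply, Matrix.sub_apply, Matrix.mul_apply, matF_apply, mapd, matW,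
    Matrix.of_apply, Matrix.zero_apply] at h
  have h1 (μ ν σ) : ∑ k, A.w j k σ * A.Fc i k μ ν = -∑ k, A.Fc i k μ ν * A.w k j σ := by
    rw [← Finset.sum_neg_distrib]
    exact Finset.sum_congr rfl fun k _ => by rw [A.w_antisymm j k]; ring
  have h2 (a b c) : ∑ ε, A.Gam0 ε a b * A.Fc i j ε c = -∑ ε, A.Gam0 ε b a * A.Fc i j c ε := by
    rw [← Finset.sum_neg_distrib]
    exact Finset.sum_congr rfl fun k _ => by rw [A.Gam0_symm, A.Fc_antisymm' i j k]; ring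
  simp only [nabF, h1, h2]
  linear_combination h

/-- The frame is constant for the total covariant derivative formed from `Γ°` and `-w`. This lets a
natural covariant derivative pass through frame contractions. -/
theorem d_up (σ i α) : A.d σ (A.up i α)
    = -∑ ε, A.up i ε * A.Gam0 α ε σ - ∑ k, A.up k α * A.w k i σ := by
  have h1 : ∑ ε, A.up i ε * A.gam α ε σ = ∑ k, A.up k α * A.w k i σ := by
    simp only [gam_eq_w, hi_lo_comm]
    exact A.frLo_lo (fun j => A.hi (fun k => A.w k j σ) α) i
  have h2 := A.sum_up_mul_Gam i α σ
  simp only [Gam0_eq, mul_sub, Finset.sum_sub_distrib, h1, h2]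
  ring

theorem d_frLo (σ i) (x : Fin n → R) : A.d σ (A.frLo x i)
    = A.frLo (fun α => A.d σ (x α) - ∑ ε, A.Gam0 ε α σ * x ε) i - ∑ k, A.w k i σ * A.frLo x k := by
  have h1 : ∑ α, x α * ∑ ε, A.up i ε * A.Gam0 α ε σ
      = ∑ α, A.up i α * ∑ ε, A.Gam0 ε α σ * x ε := by
    simp only [Finset.mul_sum]; rw [Finset.sum_comm]
    exact Finset.sum_congr rfl fun _ _ => Finset.sum_congr rfl fun _ _ => by ring
  have h2 : ∑ α, x α * ∑ k, A.up k α * A.w k i σ = ∑ k, A.w k i σ * ∑ α, A.up k α * x α := by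
    simp only [Finset.mul_sum]; rw [Finset.sum_comm]
    exact Finset.sum_congr rfl fun _ _ => Finset.sum_congr rfl fun _ _ => by ring
  simp only [frLo, map_sum, Derivation.leibniz, smul_eq_mul, d_up, mul_sub, mul_neg,
    Finset.sum_add_distrib, Finset.sum_sub_distrib, Finset.sum_neg_distrib, h1, h2]
  ring

theorem cdU_Gam0_hi (v : Fin n → R) (ρ σ) :
    A.cdU A.Gam0 (A.hi v) ρ σ = A.hi (fun j => A.d σ (v j) - ∑ k, A.w j k σ * v k) ρ := by
  have h1 : ∑ j, v j * ∑ ε, A.up j ε * A.Gam0 ρ ε σ = ∑ ε, A.hi v ε * A.Gam0 ρ ε σ := by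
    simp only [hi, Finset.mul_sum, Finset.sum_mul]; rw [Finset.sum_comm]
    exact Finset.sum_congr rfl fun _ _ => Finset.sum_congr rfl fun _ _ => by ring
  have h2 : ∑ j, v j * ∑ k, A.up k ρ * A.w k j σ = ∑ j, A.up j ρ * ∑ k, A.w j k σ * v k := by
    simp only [Finset.mul_sum]; rw [Finset.sum_comm]
    exact Finset.sum_congr rfl fun _ _ => Finset.sum_congr rfl fun _ _ => by ring
  rw [cdU, d_hi]
  simp only [d_up, mul_sub, mul_neg, Finset.sum_sub_distrib, Finset.sum_neg_distrib, h1, h2]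
  simp only [hi, mul_sub, Finset.sum_sub_distrib]
  ring

theorem sum_mul_frLo (c : Fin n → R) (x : Fin n → Fin n → R) (i) :
    ∑ k, c k * A.frLo (x k) i = A.frLo (fun α => ∑ k, c k * x k α) i := by
  simp only [frLo, Finset.mul_sum]; rw [Finset.sum_comm]
  exact Finset.sum_congr rfl fun _ _ => Finset.sum_congr rfl fun _ _ => by ring

theorem frLo_sub (x y : Fin n → R) (i) :
    A.frLo (fun α => x α - y α) i = A.frLo x i - A.frLo y i := by
  simp only [frLo, mul_sub, Finset.sum_sub_distrib]

/-- `R_j{}_ν`, the Ricci tensor with one frame index. -/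
def ricM (j ν : Fin n) : R := ∑ i, A.frLo (fun α => A.Fc i j ν α) i

theorem raise_ricci (μ ν) : A.raise (ricci A.curv0) μ ν = A.hi (fun j => A.ricM j ν) μ := by
  have h (β) : ricci A.curv0 β ν = A.lo (fun j => A.ricM j ν) β := by
    have key (α) : A.curv0 α β ν α = A.lo (fun j => A.hi (fun i => A.Fc i j ν α) α) β := by
      rw [curv0_eq, hi_lo_comm]
    simp only [ricci, key, sum_lo, ricM]
    congr 1; funext j
    simp only [hi, frLo]; exact Finset.sum_comm
  simp only [raise, h, sum_gInv_mul_lo]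

theorem cdUD_ricci (ρ τ σ) : A.cdUD A.Gam0 (A.raise (ricci A.curv0)) ρ τ σ
    = A.hi (fun j => ∑ i, A.frLo (fun α => A.nabF i j τ α σ) i) ρ := by
  have h1 : ∑ ε, A.hi (fun j => A.ricM j ε) ρ * A.Gam0 ε τ σ
      = A.hi (fun j => ∑ ε, A.ricM j ε * A.Gam0 ε τ σ) ρ := by
    simp only [hi_mul, sum_hi]
  have h2 : A.cdUD A.Gam0 (A.raise (ricci A.curv0)) ρ τ σ
      = A.cdU A.Gam0 (A.hi fun j => A.ricM j τ) ρ σ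
        - ∑ ε, A.hi (fun j => A.ricM j ε) ρ * A.Gam0 ε τ σ := by
    simp only [cdUD, cdU, raise_ricci]
  rw [h2, h1, cdU_Gam0_hi, hi_sub]
  congr 1; funext j
  have h3 : ∑ i, ∑ k, A.w k i σ * A.frLo (fun α => A.Fc i j τ α) k
      = ∑ i, A.frLo (fun α => ∑ k, A.w i k σ * A.Fc k j τ α) i := by
    rw [Finset.sum_comm]
    exact Finset.sum_congr rfl fun i _ =>
      A.sum_mul_frLo (fun k => A.w i k σ) (fun k α => A.Fc k j τ α) i
  have h4 : ∑ k, A.w j k σ * ∑ i, A.frLo (fun α => A.Fc i k τ α) i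
      = ∑ i, A.frLo (fun α => ∑ k, A.w j k σ * A.Fc i k τ α) i := by
    simp only [Finset.mul_sum]
    rw [Finset.sum_comm]
    exact Finset.sum_congr rfl fun i _ =>
      A.sum_mul_frLo (fun k => A.w j k σ) (fun k α => A.Fc i k τ α) i
  have h5 : ∑ ε, (∑ i, A.frLo (fun α => A.Fc i j ε α) i) * A.Gam0 ε τ σ
      = ∑ i, A.frLo (fun α => ∑ ε, A.Gam0 ε τ σ * A.Fc i j ε α) i := by
    simp only [mul_comm _ (A.Gam0 _ _ _), Finset.mul_sum]
    rw [Finset.sum_comm]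
    exact Finset.sum_congr rfl fun i _ =>
      A.sum_mul_frLo (fun ε => A.Gam0 ε τ σ) (fun ε α => A.Fc i j ε α) i
  simp only [ricM, h4, h5, map_sum, d_frLo, Finset.sum_sub_distrib, h3, nabF, frLo_sub]
  ring

theorem nabF_antisymm (i j τ α σ) : A.nabF i j τ α σ = -A.nabF j i τ α σ := by
  simp only [nabF, A.Fc_antisymm j i, A.Fc_antisymm _ i, A.Fc_antisymm j _, map_neg, mul_neg,
    Finset.sum_neg_distrib]
  ring

theorem nabF_antisymm' (i j τ α σ) : A.nabF i j τ α σ = -A.nabF i j α τ σ := by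
  simp only [nabF, A.Fc_antisymm' _ _ α, A.Fc_antisymm' _ _ _ τ, map_neg, mul_neg,
    Finset.sum_neg_distrib]
  ring

theorem sum_raise (a : Fin n → Fin n → R) : ∑ μ, A.raise a μ μ = A.tr a := by
  simp only [raise, tr]
  rw [Finset.sum_comm]
  simp only [A.gInv_symm]

theorem d_sum_diag (Y : Fin n → Fin n → R) (σ) :
    A.d σ (∑ ρ, Y ρ ρ) = ∑ ρ, A.cdUD A.Gam0 Y ρ ρ σ := by
  simp only [cdUD, Finset.sum_add_distrib, Finset.sum_sub_distrib, map_sum]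
  rw [Finset.sum_comm (f := fun ρ ε => Y ε ρ * A.Gam0 ρ ε σ)]
  ring

/-- Contracted second Bianchi identity. -/
theorem div0_ricci (ν) : 2 * A.div0 (ricci A.curv0) ν = A.d ν (A.tr (ricci A.curv0)) := by
  have key (N : Fin n → Fin n → Fin n → Fin n → R) :
      ∑ μ, A.hi (fun j => ∑ i, A.frLo (fun α => N i j α μ) i) μ
        = ∑ i, ∑ j, ∑ α, ∑ μ, A.up i α * (A.up j μ * N i j α μ) := by
    simp only [hi, frLo, Finset.mul_sum]
    rw [Finset.sum_comm, Finset.sum_comm (s := Finset.univ) (t := Finset.univ)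
      (f := fun i j => ∑ α, ∑ μ, A.up i α * (A.up j μ * N i j α μ))]
    refine Finset.sum_congr rfl fun j _ => ?_
    rw [Finset.sum_comm]
    refine Finset.sum_congr rfl fun i _ => ?_
    rw [Finset.sum_comm]
    exact Finset.sum_congr rfl fun _ _ => Finset.sum_congr rfl fun _ _ => by ring
  have h1 : A.div0 (ricci A.curv0) ν
      = ∑ i, ∑ j, ∑ α, ∑ μ, A.up i α * (A.up j μ * A.nabF i j ν α μ) := by
    rw [← key]; simp only [div0, cdUD_ricci]
  -- The same divergence with the frame pair and the coordinate pair both relabelled: the two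
  -- skewness signs cancel.
  have h1' : A.div0 (ricci A.curv0) ν
      = ∑ i, ∑ j, ∑ α, ∑ μ, A.up i α * (A.up j μ * A.nabF i j μ ν α) := by
    rw [h1, Finset.sum_comm]
    refine Finset.sum_congr rfl fun i _ => Finset.sum_congr rfl fun j _ => ?_
    rw [Finset.sum_comm]
    refine Finset.sum_congr rfl fun α _ => Finset.sum_congr rfl fun μ _ => ?_
    rw [A.nabF_antisymm, A.nabF_antisymm']; ring
  have h2 : A.d ν (A.tr (ricci A.curv0))
      = ∑ i, ∑ j, ∑ α, ∑ μ, A.up i α * (A.up j μ * A.nabF i j μ α ν) := by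
    rw [← sum_raise, d_sum_diag, ← key]; simp only [cdUD_ricci]
  -- One copy of the divergence is written in each form, so that the summands are the three terms of
  -- the cyclic identity.
  rw [two_mul]
  nth_rw 2 [h1']
  rw [h1, h2]
  simp only [← Finset.sum_add_distrib]
  refine Finset.sum_congr rfl fun i _ => Finset.sum_congr rfl fun j _ =>
    Finset.sum_congr rfl fun α _ => Finset.sum_congr rfl fun μ _ => ?_
  have := A.nabF_cyclic i j μ ν α
  rw [A.nabF_antisymm' i j α μ] at this
  linear_combination A.up i α * A.up j μ * this

theorem div0_einstein (ν) : A.div0 (A.einstein A.curv0) ν = 0 := by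
  have h (μ ν) : A.raise (A.einstein A.curv0) μ ν = A.raise (ricci A.curv0) μ ν
      - (if μ = ν then half R * A.tr (ricci A.curv0) else 0) := by
    have h0 := A.sum_gInv_g μ ν
    simp only [raise, einstein, mul_sub, Finset.sum_sub_distrib]
    congr 1
    rw [← mul_one (half R * _), ← mul_zero (half R * A.tr (ricci A.curv0)), ← mul_ite, ← h0,
      Finset.mul_sum]
    exact Finset.sum_congr rfl fun _ _ => by ring
  have hd (μ f) : A.d μ (half R * f) = half R * A.d μ f := by
    simp [half]
  -- The Kronecker symbol is covariantly constant; the visibly zero bracket records its two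
  -- cancelling connection terms.
  have h1 (μ) : A.cdUD A.Gam0 (A.raise (A.einstein A.curv0)) μ ν μ
      = A.cdUD A.Gam0 (A.raise (ricci A.curv0)) μ ν μ
        - (if μ = ν then half R * A.d μ (A.tr (ricci A.curv0)) else 0)
        - half R * A.tr (ricci A.curv0) * (A.Gam0 μ ν μ - A.Gam0 μ ν μ) := by
    simp only [cdUD, h, map_sub, sub_mul, ite_mul, zero_mul, Finset.sum_sub_distrib,
      Finset.sum_ite_eq, Finset.sum_ite_eq', Finset.mem_univ, if_true, apply_ite (A.d μ), hd,
      map_zero]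
    ring
  have h2 : A.div0 (A.einstein A.curv0) ν = A.div0 (ricci A.curv0) ν
      - half R * A.d ν (A.tr (ricci A.curv0)) := by
    simp [div0, h1, Finset.sum_sub_distrib]
  rw [h2, ← div0_ricci]
  linear_combination -A.div0 (ricci A.curv0) ν * two_mul_half (R := R)

/-! ### Conservation of the current and the cyclic identity -/

/-- The form `Γ°^α_{αν}` is closed because its differential is the trace of the curvature, which is
zero. -/
theorem d_Gam0_trace (μ ν) :
    A.d μ (∑ α, A.Gam0 α α ν) = A.d ν (∑ α, A.Gam0 α α μ) := by
  have h := A.sum_curv0_self μ ν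
  simp only [curv0, Finset.sum_add_distrib, Finset.sum_sub_distrib] at h
  rw [Finset.sum_comm (f := fun α ε => A.Gam0 ε α μ * A.Gam0 α ε ν)] at h
  simp only [map_sum]
  simp only [mul_comm] at h
  linear_combination h

theorem FUp_antisymm (μ ν) : A.FUp μ ν = -A.FUp ν μ := by
  simp only [FUp, ← Finset.sum_neg_distrib]
  rw [Finset.sum_comm]
  refine Finset.sum_congr rfl fun β _ => Finset.sum_congr rfl fun α _ => ?_
  rw [A.F_antisymm α β]; ring

theorem sum_sum_antisymm_mul_symm {a s : Fin n → Fin n → R} (ha : ∀ μ ν, a μ ν = -a ν μ)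
    (hs : ∀ μ ν, s μ ν = s ν μ) : ∑ μ, ∑ ν, a μ ν * s μ ν = 0 := by
  refine eq_zero_of_eq_neg ?_
  conv_lhs => rw [Finset.sum_comm]
  simp only [← Finset.sum_neg_distrib]
  refine Finset.sum_congr rfl fun μ _ => Finset.sum_congr rfl fun ν _ => ?_
  rw [ha ν μ, hs ν μ]; ring

/-- In the divergence of a skew tensor, the connection term of the free index pairs a skew with a
symmetric factor and vanishes; only the trace of `Γ°` survives. -/
theorem J_eq (μ) : A.J μ = ∑ ν, A.d ν (A.FUp μ ν) + ∑ ν, A.FUp μ ν * ∑ α, A.Gam0 α α ν := by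
  have h0 : ∑ ν, ∑ ε, A.FUp ε ν * A.Gam0 μ ε ν = 0 := by
    rw [Finset.sum_comm]
    exact sum_sum_antisymm_mul_symm A.FUp_antisymm (A.Gam0_symm μ)
  simp only [J, cdUU, Finset.sum_add_distrib, h0, add_zero]
  congr 1
  rw [Finset.sum_comm]
  refine Finset.sum_congr rfl fun ε _ => ?_
  rw [Finset.mul_sum]
  exact Finset.sum_congr rfl fun ν _ => by rw [A.Gam0_symm]

/-- With `l` the trace of `Γ°`, this is the double divergence `(∂_μ + l_μ)(∂_ν + l_ν) F^{μν}`. The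
operators commute because `l` is closed, and `F` is skew; no field equation is needed. -/
theorem divJ_eq_zero : A.divJ = 0 := by
  set l : Fin n → R := fun ν => ∑ α, A.Gam0 α α ν with hl
  have h1 : A.divJ = ∑ μ, A.d μ (A.J μ) + ∑ μ, A.J μ * l μ := by
    simp only [divJ, cdU, Finset.sum_add_distrib]
    congr 1
    rw [Finset.sum_comm]
    refine Finset.sum_congr rfl fun ε _ => ?_
    rw [hl, Finset.mul_sum]
    exact Finset.sum_congr rfl fun ν _ => by rw [A.Gam0_symm]
  have h2 : ∑ μ, ∑ ν, A.d μ (A.d ν (A.FUp μ ν)) = 0 := by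
    refine eq_zero_of_eq_neg ?_
    conv_lhs => rw [Finset.sum_comm]
    simp only [← Finset.sum_neg_distrib]
    refine Finset.sum_congr rfl fun μ _ => Finset.sum_congr rfl fun ν _ => ?_
    rw [A.d_comm, A.FUp_antisymm, map_neg, map_neg]
  have h3 : ∑ μ, ∑ ν, A.FUp μ ν * A.d μ (l ν) = 0 :=
    sum_sum_antisymm_mul_symm A.FUp_antisymm fun μ ν => A.d_Gam0_trace μ ν
  have h4 : ∑ μ, ∑ ν, A.FUp μ ν * (l ν * l μ) = 0 :=
    sum_sum_antisymm_mul_symm A.FUp_antisymm fun μ ν => mul_comm _ _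
  have h5 : ∑ μ, ∑ ν, l ν * A.d μ (A.FUp μ ν) = -∑ μ, ∑ ν, A.d ν (A.FUp μ ν) * l μ := by
    rw [Finset.sum_comm]
    simp only [← Finset.sum_neg_distrib]
    refine Finset.sum_congr rfl fun μ _ => Finset.sum_congr rfl fun ν _ => ?_
    rw [A.FUp_antisymm, map_neg]; ring
  have hJ (μ) : A.J μ = ∑ ν, A.d ν (A.FUp μ ν) + ∑ ν, A.FUp μ ν * l ν := A.J_eq μ
  rw [h1]
  simp only [hJ, map_add, map_sum, Derivation.leibniz, smul_eq_mul, add_mul,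
    Finset.sum_add_distrib, Finset.sum_mul, h2, mul_assoc, h3, h4, h5]
  ring

/-- Since `Γ°` is symmetric, the cyclic sum for a skew tensor involves only partial derivatives; for
a curl these cancel. -/
theorem cycF_eq_zero (h : ∀ μ ν, A.F μ ν = A.d ν (A.C μ) - A.d μ (A.C ν)) (μ ν σ) :
    A.cycF μ ν σ = 0 := by
  have h1 (a b c) : ∑ ε, A.F a ε * A.Gam0 ε b c = -∑ ε, A.F ε a * A.Gam0 ε c b := by
    rw [← Finset.sum_neg_distrib]
    exact Finset.sum_congr rfl fun ε _ => by rw [A.F_antisymm, A.Gam0_symm]; ring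
  have h2 : A.d σ (A.F μ ν) + A.d μ (A.F ν σ) + A.d ν (A.F σ μ) = 0 := by
    simp only [h, map_sub, A.d_comm ν μ, A.d_comm σ μ, A.d_comm σ ν]
    ring
  simp only [cycF, cdDD, h1]
  linear_combination h2

end DifferentialFrame

/-! ### The Lagrangian as a quadratic form in the frame torsion of a jet -/

section jets

variable {R : Type*} [CommRing R] {n : ℕ}

/-- Frame components of the torsion of a jet `P j β γ = λ_{jβ,γ}`. -/
def jetTorsion (u : Fin n → Fin n → R) (P : Fin n → Fin n → Fin n → R) (i j k : Fin n) : R :=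
  ∑ μ, ∑ ν, u j μ * u k ν * (P i μ ν - P i ν μ)

/-- The trace `t_{iji}`. -/
def torsionTrace (t : Fin n → Fin n → Fin n → R) (j : Fin n) : R := ∑ i, t i j i

/-- `t_{kjp} t_{jkp} - c_p c_p`. -/
def torsionQuad (t : Fin n → Fin n → Fin n → R) : R :=
  ∑ p, (∑ j, ∑ k, t k j p * t j k p - torsionTrace t p * torsionTrace t p)

/-- Gradient of `torsionQuad`. -/
def torsionGrad (t : Fin n → Fin n → Fin n → R) (i j k : Fin n) : R :=
  2 * t j i k - 2 * (if i = k then torsionTrace t j else 0)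

/-- `∂𝓗/∂λ_{jβ}`. -/
def fieldDeriv (δ : R) (u : Fin n → Fin n → R) (t : Fin n → Fin n → Fin n → R)
    (j β : Fin n) : R :=
  δ * (u j β * torsionQuad t
    - ∑ i, ∑ a, ∑ b, torsionGrad t i a b * (u a β * t i j b + u b β * t i a j))

/-- `∂𝓗/∂λ_{jβ,γ}`. -/
def momentum (δ : R) (u : Fin n → Fin n → R) (t : Fin n → Fin n → Fin n → R)
    (j β γ : Fin n) : R :=
  δ * ∑ a, ∑ b, torsionGrad t j a b * (u a β * u b γ - u a γ * u b β)

variable {R' : Type*} [CommRing R'] (f : R →+* R')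

/-- The jet formulas are polynomial, so they commute with ring homomorphisms. This links derivatives
computed over `ℝ` at a point with elements of the function algebra. -/
theorem map_torsionTrace (t : Fin n → Fin n → Fin n → R) (j) :
    f (torsionTrace t j) = torsionTrace (fun i j k => f (t i j k)) j := by
  simp only [torsionTrace, map_sum]

theorem map_torsionQuad (t : Fin n → Fin n → Fin n → R) :
    f (torsionQuad t) = torsionQuad (fun i j k => f (t i j k)) := by
  simp only [torsionQuad, map_sum, map_sub, map_mul, map_torsionTrace]

theorem map_torsionGrad (t : Fin n → Fin n → Fin n → R) (i j k) :
    f (torsionGrad t i j k) = torsionGrad (fun i j k => f (t i j k)) i j k := by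
  simp only [torsionGrad, map_sub, map_mul, map_ofNat, apply_ite f, map_zero, map_torsionTrace]

theorem map_fieldDeriv (δ : R) (u : Fin n → Fin n → R) (t : Fin n → Fin n → Fin n → R) (j β) :
    f (fieldDeriv δ u t j β)
      = fieldDeriv (f δ) (fun i α => f (u i α)) (fun i j k => f (t i j k)) j β := by
  simp only [fieldDeriv, map_sub, map_mul, map_sum, map_add, map_torsionQuad, map_torsionGrad]

theorem map_momentum (δ : R) (u : Fin n → Fin n → R) (t : Fin n → Fin n → Fin n → R) (j β γ) :
    f (momentum δ u t j β γ)
      = momentum (f δ) (fun i α => f (u i α)) (fun i j k => f (t i j k)) j β γ := by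
  simp only [momentum, map_sub, map_mul, map_sum, map_torsionGrad]

theorem map_jetTorsion (u : Fin n → Fin n → R) (P : Fin n → Fin n → Fin n → R) (i j k) :
    f (jetTorsion u P i j k)
      = jetTorsion (fun i α => f (u i α)) (fun i j k => f (P i j k)) i j k := by
  simp only [jetTorsion, map_sub, map_mul, map_sum]

end jets

/-- Leibniz rule for a finite product. -/
theorem derivation_prod {R : Type*} [CommRing R] [Algebra ℝ R] (D : Derivation ℝ R R)
    {ι : Type*} [DecidableEq ι] (s : Finset ι) (f : ι → R) :
    D (∏ i ∈ s, f i) = ∑ i ∈ s, ∏ k ∈ s, Function.update f i (D (f i)) k := by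
  induction s using Finset.induction_on with
  | empty => simp
  | insert a s ha ih =>
    have h1 : ∏ k ∈ s, Function.update f a (D (f a)) k = ∏ k ∈ s, f k :=
      Finset.prod_congr rfl fun k hk => Function.update_of_ne (ne_of_mem_of_not_mem hk ha) _ _
    have h2 : ∑ i ∈ s, ∏ k ∈ insert a s, Function.update f i (D (f i)) k
        = f a * ∑ i ∈ s, ∏ k ∈ s, Function.update f i (D (f i)) k := by
      rw [Finset.mul_sum]
      refine Finset.sum_congr rfl fun i hi => ?_
      rw [Finset.prod_insert ha, Function.update_of_ne (ne_of_mem_of_not_mem hi ha).symm]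
    rw [Finset.prod_insert ha, Derivation.leibniz, Finset.sum_insert ha, Finset.prod_insert ha,
      Function.update_self, h1, h2, ih]
    simp only [smul_eq_mul]; ring

/-- Jacobi's formula. -/
theorem derivation_det {R : Type*} [CommRing R] [Algebra ℝ R] (D : Derivation ℝ R R) {n : ℕ}
    (M : Matrix (Fin n) (Fin n) R) :
    D M.det = ∑ i, ∑ j, M.adjugate i j * D (M j i) := by
  -- By Cramer's rule each inner sum is the determinant with column `i` differentiated, which
  -- reduces the claim to the Leibniz rule in every permutation term.
  have h (i) : ∑ j, M.adjugate i j * D (M j i) = (M.updateCol i fun j => D (M j i)).det := by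
    rw [← Matrix.cramer_apply, Matrix.cramer_eq_adjugate_mulVec]; rfl
  simp only [h, Matrix.det_apply, map_sum]
  rw [Finset.sum_comm]
  refine Finset.sum_congr rfl fun σ _ => ?_
  rw [Units.smul_def, map_zsmul, derivation_prod, Finset.smul_sum]
  refine Finset.sum_congr rfl fun i _ => ?_
  rw [Units.smul_def]
  congr 1
  refine Finset.prod_congr rfl fun k _ => ?_
  by_cases hk : k = i
  · subst hk; simp
  · simp [hk]

namespace DifferentialFrame

variable {R : Type*} [CommRing R] [Algebra ℝ R] {n : ℕ} (A : DifferentialFrame R n)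

/-! ### The Euler–Lagrange expression -/

theorem d_detDown (μ) : A.d μ A.detDown = A.detDown * ∑ α, A.Gam α α μ := by
  have hadj : (Matrix.of A.dn).adjugate = A.detDown • A.matUp := by
    have h1 : Matrix.of A.dn * A.matUp = 1 := A.matDn_mul_matUp
    calc (Matrix.of A.dn).adjugate = (Matrix.of A.dn).adjugate * (Matrix.of A.dn * A.matUp) := by
          rw [h1, mul_one]
      _ = _ := by rw [← mul_assoc, Matrix.adjugate_mul, smul_mul_assoc, one_mul]; rfl
  rw [detDown, derivation_det, hadj, Finset.mul_sum]
  refine Finset.sum_congr rfl fun α _ => ?_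
  simp only [Gam, Finset.mul_sum, Matrix.smul_apply, matUp, Matrix.of_apply, smul_eq_mul, detDown,
    mul_assoc]

theorem frLo_C (b) : ∑ γ, A.up b γ * A.C γ = A.cc b := by
  rw [C_eq_lo]; exact A.frLo_lo A.cc b

/-- The density and the frame field each contribute a trace of `Γ`, over opposite lower indices;
their difference is the trace of the torsion. -/
theorem sum_d_detDown_mul_up (b) :
    ∑ γ, A.d γ (A.detDown * A.up b γ) = -(A.detDown * A.cc b) := by
  have h1 : ∑ γ, A.d γ (A.up b γ) = -∑ ε, A.up b ε * ∑ γ, A.Gam γ ε γ := by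
    simp only [Finset.mul_sum]
    rw [Finset.sum_comm, ← Finset.sum_neg_distrib]
    exact Finset.sum_congr rfl fun γ _ => by rw [sum_up_mul_Gam, neg_neg]
  simp only [Derivation.leibniz, smul_eq_mul, d_detDown, Finset.sum_add_distrib,
    ← Finset.mul_sum, h1, ← frLo_C, C, Tor, Finset.sum_sub_distrib, mul_sub]
  simp only [mul_neg, Finset.mul_sum]
  rw [add_comm, neg_sub, sub_eq_add_neg]
  congr 1
  exact Finset.sum_congr rfl fun _ _ => Finset.sum_congr rfl fun _ _ => by ring

/-- The commutator of two frame fields, in coordinates, is given by the torsion since the frame is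
parallel. -/
theorem e_up_sub (a b β) :
    A.e b (A.up a β) - A.e a (A.up b β) = -A.hi (fun i => A.tt i a b) β := by
  have h (a b) : A.e b (A.up a β) = -∑ ε, ∑ γ, A.up a ε * A.up b γ * A.Gam β ε γ := by
    rw [Finset.sum_comm, ← Finset.sum_neg_distrib]
    refine Finset.sum_congr rfl fun γ _ => ?_
    rw [← neg_eq_iff_eq_neg.mpr (A.sum_up_mul_Gam a β γ), mul_neg, Finset.mul_sum]
    congr 1
    exact Finset.sum_congr rfl fun _ _ => by ring
  have h1 : A.hi (fun i => A.tt i a b) β = ∑ ε, ∑ γ, A.up a ε * A.up b γ * A.Tor β ε γ := by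
    have h2 (ε) : ∑ γ, A.up a ε * A.up b γ * A.Tor β ε γ
        = A.up a ε * A.lo (fun j => A.hi (fun i => A.tt i j b) β) ε := by
      have h3 (γ) : A.Tor β ε γ
          = A.lo (fun k => A.lo (fun j => A.hi (fun i => A.tt i j k) β) ε) γ := by
        simp only [Tor_eq, mix3, lo2, hi_lo_comm]
        exact A.lo_lo_comm _ _ _
      simp only [h3, mul_assoc, ← Finset.mul_sum]
      congr 1
      exact A.frLo_lo (fun k => A.lo (fun j => A.hi (fun i => A.tt i j k) β) ε) b
    simp only [h2]
    exact (A.frLo_lo (fun j => A.hi (fun i => A.tt i j b) β) a).symm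
  rw [h a b, h b a, h1]
  rw [Finset.sum_comm (f := fun ε γ => A.up b ε * A.up a γ * A.Gam β ε γ)]
  simp only [Tor, mul_sub, Finset.sum_sub_distrib]
  simp only [mul_comm (A.up b _)]
  ring

/-- `δ𝓗/δλ_{jβ}`. -/
def euler (j β : Fin n) : R :=
  fieldDeriv A.detDown A.up A.tt j β - ∑ γ, A.d γ (momentum A.detDown A.up A.tt j β γ)

theorem torsionTrace_tt : torsionTrace A.tt = A.cc := funext fun i => A.sum_tt i

theorem torsionQuad_tt : torsionQuad A.tt = ∑ k, A.hF k k := by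
  simp only [torsionQuad, torsionTrace_tt, hF]
  congr 1; funext p
  rw [Finset.sum_comm]

theorem sum_d_momentum (j β) : ∑ γ, A.d γ (momentum A.detDown A.up A.tt j β γ)
    = A.detDown * A.hi (fun a => ∑ b, (A.e b (torsionGrad A.tt j a b)
        - A.e b (torsionGrad A.tt j b a))
      - ∑ b, ∑ c, torsionGrad A.tt j b c * A.tt a b c
      - ∑ b, (torsionGrad A.tt j a b - torsionGrad A.tt j b a) * A.cc b) β := by
  -- Divergence of one bivector term of the momentum. Differentiating the coefficient gives frame
  -- derivatives, the commutator gives torsion, and the density gives the basic vector.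
  have h (s : R) (a b) : ∑ γ, A.d γ (s * (A.detDown * (A.up a β * A.up b γ - A.up a γ * A.up b β)))
      = A.detDown * (A.up a β * A.e b s - A.up b β * A.e a s
        - s * A.hi (fun i => A.tt i a b) β - s * (A.up a β * A.cc b - A.up b β * A.cc a)) := by
    have h1 (a b) : ∑ γ, A.d γ ((s * A.up a β) * (A.detDown * A.up b γ))
        = (s * A.up a β) * -(A.detDown * A.cc b) + A.detDown * A.e b (s * A.up a β) := by
      simp only [Derivation.leibniz _ (s * A.up a β), smul_eq_mul, Finset.sum_add_distrib,
        ← Finset.mul_sum, sum_d_detDown_mul_up]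
      congr 1
      simp only [e, Finset.mul_sum, mul_assoc]
    have h2 (γ) : s * (A.detDown * (A.up a β * A.up b γ - A.up a γ * A.up b β))
        = (s * A.up a β) * (A.detDown * A.up b γ) - (s * A.up b β) * (A.detDown * A.up a γ) := by
      ring
    simp only [h2, map_sub, Finset.sum_sub_distrib, h1, e_mul]
    linear_combination A.detDown * s * A.e_up_sub a b β
  have h3 (γ) : momentum A.detDown A.up A.tt j β γ = ∑ a, ∑ b, torsionGrad A.tt j a b
      * (A.detDown * (A.up a β * A.up b γ - A.up a γ * A.up b β)) := by
    simp only [momentum, Finset.mul_sum]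
    exact Finset.sum_congr rfl fun _ _ => Finset.sum_congr rfl fun _ _ => by ring
  simp only [h3, map_sum]
  rw [Finset.sum_comm]
  have h4 (a) : ∑ γ, ∑ b, A.d γ (torsionGrad A.tt j a b
        * (A.detDown * (A.up a β * A.up b γ - A.up a γ * A.up b β)))
      = ∑ b, A.detDown * (A.up a β * A.e b (torsionGrad A.tt j a b)
        - A.up b β * A.e a (torsionGrad A.tt j a b)
        - torsionGrad A.tt j a b * A.hi (fun i => A.tt i a b) β
        - torsionGrad A.tt j a b * (A.up a β * A.cc b - A.up b β * A.cc a)) := by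
    rw [Finset.sum_comm]; simp only [h]
  simp only [h4, ← Finset.mul_sum]
  congr 1
  have h5 : ∑ a, ∑ b, A.up b β * A.e a (torsionGrad A.tt j a b)
      = ∑ a, ∑ b, A.up a β * A.e b (torsionGrad A.tt j b a) := Finset.sum_comm
  have h6 : ∑ a, ∑ b, torsionGrad A.tt j a b * (A.up b β * A.cc a)
      = ∑ a, ∑ b, A.up a β * (torsionGrad A.tt j b a * A.cc b) := by
    rw [Finset.sum_comm]
    exact Finset.sum_congr rfl fun _ _ => Finset.sum_congr rfl fun _ _ => by ring
  have h7 : ∑ a, ∑ b, torsionGrad A.tt j a b * A.hi (fun i => A.tt i a b) β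
      = A.hi (fun i => ∑ a, ∑ b, torsionGrad A.tt j a b * A.tt i a b) β := by
    simp only [mul_hi, sum_hi]
  have h8 : ∑ a, ∑ b, torsionGrad A.tt j a b * (A.up a β * A.cc b)
      = ∑ a, ∑ b, A.up a β * (torsionGrad A.tt j a b * A.cc b) :=
    Finset.sum_congr rfl fun _ _ => Finset.sum_congr rfl fun _ _ => by ring
  simp only [mul_sub, Finset.sum_sub_distrib, h5, h6, h7, h8]
  simp only [hi, sub_mul, mul_sub, Finset.sum_sub_distrib, Finset.mul_sum]

theorem e_two_mul (i) (f : R) : A.e i (2 * f) = 2 * A.e i f := by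
  rw [two_mul, two_mul, e_add]

theorem e_zero (i) : A.e i 0 = 0 := by simp [e]

theorem eF_eq_torsionGrad (j a) : A.eF a j
    = (if a = j then 1 else 0) * torsionQuad A.tt
      - ∑ i, ∑ b, torsionGrad A.tt i a b * A.tt i j b
      - ∑ i, ∑ b, torsionGrad A.tt i b a * A.tt i b j
      - (∑ b, (A.e b (torsionGrad A.tt j a b) - A.e b (torsionGrad A.tt j b a))
        - ∑ b, ∑ c, torsionGrad A.tt j b c * A.tt a b c
        - ∑ b, (torsionGrad A.tt j a b - torsionGrad A.tt j b a) * A.cc b) := by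
  have k1 : ∑ b, A.e b (torsionGrad A.tt j a b)
      = 2 * ∑ b, A.e b (A.tt a j b) - 2 * A.e j (A.cc a) := by
    simp only [torsionGrad, torsionTrace_tt, e_sub, e_two_mul, apply_ite (A.e _), e_zero,
      Finset.sum_sub_distrib, ← Finset.mul_sum, Finset.sum_ite_eq, Finset.mem_univ, if_true]
  have k2 : ∑ b, A.e b (torsionGrad A.tt j b a)
      = 2 * ∑ b, A.e b (A.tt b j a) - 2 * ((if a = j then 1 else 0) * ∑ b, A.e b (A.cc b)) := by
    simp only [torsionGrad, torsionTrace_tt, e_sub, e_two_mul, apply_ite (A.e _), e_zero,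
      Finset.sum_sub_distrib, ← Finset.mul_sum, ite_mul, one_mul, zero_mul, eq_comm (a := j)]
    split_ifs <;> simp
  have k3 : ∑ i, ∑ b, torsionGrad A.tt i a b * A.tt i j b
      = 2 * ∑ i, ∑ b, A.tt a i b * A.tt i j b - 2 * (A.cc a * A.cc j) := by
    simp only [torsionGrad, torsionTrace_tt, sub_mul, mul_assoc, ite_mul, zero_mul,
      Finset.sum_sub_distrib, ← Finset.mul_sum, Finset.sum_ite_eq, Finset.mem_univ, if_true, sum_tt]
  have k4 : ∑ i, ∑ b, torsionGrad A.tt i b a * A.tt i b j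
      = 2 * ∑ i, ∑ b, A.tt b i a * A.tt i b j - 2 * ∑ b, A.cc b * A.tt a b j := by
    rw [Finset.sum_comm, Finset.sum_comm (f := fun i b => A.tt b i a * A.tt i b j)]
    simp only [torsionGrad, torsionTrace_tt, sub_mul, mul_assoc, ite_mul, zero_mul,
      Finset.sum_sub_distrib, ← Finset.mul_sum, Finset.sum_ite_eq', Finset.mem_univ, if_true]
  have k5 : ∑ b, ∑ c, torsionGrad A.tt j b c * A.tt a b c
      = 2 * ∑ b, ∑ c, A.tt b j c * A.tt a b c - 2 * ∑ b, A.cc b * A.tt a b j := by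
    simp only [torsionGrad, torsionTrace_tt, sub_mul, mul_assoc, ite_mul, zero_mul,
      Finset.sum_sub_distrib, ← Finset.mul_sum, Finset.sum_ite_eq, Finset.mem_univ, if_true]
  have k6 : ∑ b, torsionGrad A.tt j a b * A.cc b
      = 2 * ∑ b, A.cc b * A.tt a j b - 2 * (A.cc a * A.cc j) := by
    simp only [torsionGrad, torsionTrace_tt, sub_mul, mul_assoc, ite_mul, zero_mul,
      Finset.sum_sub_distrib, ← Finset.mul_sum, Finset.sum_ite_eq, Finset.mem_univ, if_true]
    simp only [mul_comm]
  have k7 : ∑ b, torsionGrad A.tt j b a * A.cc b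
      = 2 * ∑ b, A.cc b * A.tt b j a
        - 2 * ((if a = j then 1 else 0) * ∑ b, A.cc b * A.cc b) := by
    simp only [torsionGrad, torsionTrace_tt, sub_mul, mul_assoc, ite_mul, zero_mul,
      Finset.sum_sub_distrib, ← Finset.mul_sum, one_mul, eq_comm (a := j)]
    simp only [mul_comm (A.tt _ _ _)]
    split_ifs <;> simp
  have k8 : ∑ i, ∑ b, A.tt a i b * A.tt i j b = ∑ b, ∑ c, A.tt b j c * A.tt a b c :=
    Finset.sum_congr rfl fun _ _ => Finset.sum_congr rfl fun _ _ => mul_comm _ _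
  have k9 : ∑ i, ∑ b, A.tt b i a * A.tt i b j = A.hF a j + A.cc a * A.cc j := by
    rw [Finset.sum_comm, hF]; ring
  have k10 : ∑ k, A.cc k * A.tt a k j = -∑ k, A.cc k * A.tt a j k := by
    rw [← Finset.sum_neg_distrib]
    exact Finset.sum_congr rfl fun k _ => by rw [A.tt_antisymm a k j]; ring
  -- The variation produces `e_j c_a` and divergences of `t_{bja}`, whereas `E` contains `e_a c_j`;
  -- the contracted first Bianchi identity exchanges them.
  have h := A.e_cc_sub j a
  simp only [sub_mul, Finset.sum_sub_distrib, k1, k2, k3, k4, k5, k6, k7, k8, k9, torsionQuad_tt,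
    eF, k10]
  linear_combination 2 * h

theorem euler_eq (j β) : A.euler j β = A.detDown * A.hi (fun a => A.eF a j) β := by
  have h1 : ∑ i, ∑ a, ∑ b, torsionGrad A.tt i a b * (A.up a β * A.tt i j b)
      = A.hi (fun a => ∑ i, ∑ b, torsionGrad A.tt i a b * A.tt i j b) β := by
    rw [Finset.sum_comm]
    simp only [hi, Finset.mul_sum]
    exact Finset.sum_congr rfl fun _ _ => Finset.sum_congr rfl fun _ _ =>
      Finset.sum_congr rfl fun _ _ => by ring
  have h2 : ∑ i, ∑ a, ∑ b, torsionGrad A.tt i a b * (A.up b β * A.tt i a j)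
      = A.hi (fun a => ∑ i, ∑ b, torsionGrad A.tt i b a * A.tt i b j) β := by
    have h3 (i) : ∑ a, ∑ b, torsionGrad A.tt i a b * (A.up b β * A.tt i a j)
        = ∑ a, A.up a β * ∑ b, torsionGrad A.tt i b a * A.tt i b j := by
      rw [Finset.sum_comm]
      simp only [Finset.mul_sum]
      exact Finset.sum_congr rfl fun _ _ => Finset.sum_congr rfl fun _ _ => by ring
    simp only [h3]
    rw [Finset.sum_comm]
    simp only [hi, Finset.mul_sum]
  have h4 : A.up j β * torsionQuad A.tt
      = A.hi (fun a => (if a = j then 1 else 0) * torsionQuad A.tt) β := by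
    simp [hi]
  rw [euler, sum_d_momentum, fieldDeriv, ← mul_sub]
  simp only [mul_add, Finset.sum_add_distrib, h1, h2]
  rw [h4, hi_add, hi_sub, hi_sub]
  congr 2; funext a
  rw [eF_eq_torsionGrad]; ring

theorem E_eq_euler (μ ν) :
    A.detDown * A.E μ ν = ∑ β, A.g μ β * ∑ j, A.euler j β * A.dn j ν := by
  have h (β) : ∑ j, A.euler j β * A.dn j ν
      = A.detDown * A.hi (fun a => A.lo (fun j => A.eF a j) ν) β := by
    simp only [euler_eq]
    rw [hi_lo_comm, lo, Finset.mul_sum]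
    exact Finset.sum_congr rfl fun _ _ => by ring
  simp only [h, E_eq, lo2, ← A.sum_g_mul_hi, Finset.mul_sum]
  exact Finset.sum_congr rfl fun _ _ => by ring

end DifferentialFrame

/-! ### Smoothness of determinants and inverses -/

theorem contDiff_det (n : ℕ) {m : WithTop ℕ∞} :
    ContDiff ℝ m fun M : Fin n → Fin n → ℝ => (Matrix.of M).det := by
  simp only [Matrix.det_apply]
  refine ContDiff.sum fun σ _ => ?_
  simp only [Units.smul_def, zsmul_eq_mul]
  refine contDiff_const.mul (contDiff_prod fun i _ => ?_)
  exact contDiff_apply_apply ℝ ℝ (σ i) i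

theorem contDiffAt_inv_apply {n : ℕ} {m : WithTop ℕ∞} {M : Fin n → Fin n → ℝ}
    (hM : (Matrix.of M).det ≠ 0) (a b : Fin n) :
    ContDiffAt ℝ m (fun M : Fin n → Fin n → ℝ => (Matrix.of M)⁻¹ a b) M := by
  simp only [Matrix.inv_def, Matrix.smul_apply, smul_eq_mul, Ring.inverse_eq_inv',
    Matrix.adjugate_apply]
  refine ((contDiff_det n).contDiffAt.inv hM).mul ?_
  have h : ContDiff ℝ m fun M : Fin n → Fin n → ℝ =>
      ((fun i j => (Matrix.of M).updateRow b (Pi.single a 1) i j) : Fin n → Fin n → ℝ) := by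
    refine contDiff_pi.mpr fun i => contDiff_pi.mpr fun j => ?_
    by_cases h : i = b
    · subst h; simpa using contDiff_const
    · simpa [h] using contDiff_apply_apply ℝ ℝ i j
  exact ((contDiff_det n).comp h).contDiffAt

/-! ### The algebra of smooth functions on an open set -/

/-- Smooth real functions on `U ⊆ ℝⁿ`. -/
def SmoothAlg {n : ℕ} (U : Set (Coord n)) : Subalgebra ℝ (U → ℝ) where
  carrier := {f | ∃ g : Coord n → ℝ, ContDiffOn ℝ ∞ g U ∧ ∀ x : U, g x = f x}
  mul_mem' := by
    rintro _ _ ⟨g, hg, h⟩ ⟨g', hg', h'⟩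
    exact ⟨_, hg.mul hg', fun x => by simp [h, h']⟩
  add_mem' := by
    rintro _ _ ⟨g, hg, h⟩ ⟨g', hg', h'⟩
    exact ⟨_, hg.add hg', fun x => by simp [h, h']⟩
  algebraMap_mem' r := ⟨fun _ => r, contDiffOn_const, fun _ => rfl⟩

namespace SmoothAlg

variable {n : ℕ} {U : Set (Coord n)}

/-- Evaluation at a point. -/
def eval (x : U) : SmoothAlg U →ₐ[ℝ] ℝ := (Pi.evalAlgHom ℝ (fun _ => ℝ) x).comp (SmoothAlg U).val

/-- The element defined by a function smooth on `U`. -/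
def mk (g : Coord n → ℝ) (hg : ContDiffOn ℝ ∞ g U) : SmoothAlg U :=
  ⟨fun x => g x, g, hg, fun _ => rfl⟩

theorem eval_mk (g : Coord n → ℝ) (hg : ContDiffOn ℝ ∞ g U) (x : U) : eval x (mk g hg) = g x := rfl

theorem ext_eval {f f' : SmoothAlg U} (h : ∀ x, eval x f = eval x f') : f = f' :=
  Subtype.ext (funext h)

/-- A function on `ℝⁿ` restricting to a given element. -/
def extend (f : SmoothAlg U) : Coord n → ℝ := f.2.choose

theorem contDiffOn_extend (f : SmoothAlg U) : ContDiffOn ℝ ∞ (extend f) U :=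
  f.2.choose_spec.1

theorem extend_apply (f : SmoothAlg U) (x : U) : extend f x = eval x f :=
  f.2.choose_spec.2 x

theorem differentiableAt_extend (hU : IsOpen U) (f : SmoothAlg U) (x : U) :
    DifferentiableAt ℝ (SmoothAlg.extend f) x :=
  ((SmoothAlg.contDiffOn_extend f).contDiffAt (hU.mem_nhds x.2)).differentiableAt (by simp)

theorem contDiffOn_pderiv (hU : IsOpen U) {g : Coord n → ℝ} (hg : ContDiffOn ℝ ∞ g U)
    (v : Coord n) : ContDiffOn ℝ ∞ (fun x => fderiv ℝ g x v) U :=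
  (hg.fderiv_of_isOpen hU (by simp)).clm_apply contDiffOn_const

/-- On an open set the derivative ignores values outside, so `pderiv` does not depend on the chosen
extension. -/
theorem fderiv_eq_of_eqOn (hU : IsOpen U) {g g' : Coord n → ℝ} (h : ∀ x : U, g x = g' x) (x : U) :
    fderiv ℝ g x = fderiv ℝ g' x :=
  Filter.EventuallyEq.fderiv_eq <| by
    filter_upwards [hU.mem_nhds x.2] with w hw using h ⟨w, hw⟩

/-- The partial derivative `∂_μ`. -/
def pderiv (hU : IsOpen U) (μ : Fin n) : Derivation ℝ (SmoothAlg U) (SmoothAlg U) :=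
  Derivation.mk'
    { toFun := fun f => mk (fun x => fderiv ℝ (SmoothAlg.extend f) x (Pi.single μ 1))
        (contDiffOn_pderiv hU (SmoothAlg.contDiffOn_extend f) _)
      map_add' := fun f g => ext_eval fun x => by
        rw [map_add, eval_mk, eval_mk, eval_mk, fderiv_eq_of_eqOn hU
          (g' := fun w => extend f w + extend g w) (fun x => by simp [extend_apply]),
          fderiv_fun_add (differentiableAt_extend hU f x) (differentiableAt_extend hU g x)]
        rfl
      map_smul' := fun r f => ext_eval fun x => by
        rw [RingHom.id_apply, map_smul, eval_mk, eval_mk, fderiv_eq_of_eqOn hU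
          (g' := fun w => r • (SmoothAlg.extend f) w) (fun x => by simp [extend_apply]),
          fderiv_fun_const_smul (differentiableAt_extend hU f x)]
        rfl }
    fun f g => ext_eval fun x => by
      have h := fderiv_eq_of_eqOn hU (g := extend (f * g))
        (g' := fun w => extend f w * extend g w) (fun x => by simp [extend_apply]) x
      rw [fderiv_fun_mul (differentiableAt_extend hU f x) (differentiableAt_extend hU g x)] at h
      refine (congrArg (fun F => F (Pi.single μ 1)) h).trans ?_
      simp only [extend_apply, map_add, smul_eq_mul, map_mul]
      rfl

theorem eval_pderiv (hU : IsOpen U) (μ : Fin n) (f : SmoothAlg U) {g : Coord n → ℝ}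
    (hg : ∀ x : U, g x = eval x f) (x : U) :
    eval x (pderiv hU μ f) = fderiv ℝ g x (Pi.single μ 1) := by
  rw [fderiv_eq_of_eqOn hU (g := g) (g' := (SmoothAlg.extend f)) fun x => by rw [hg, extend_apply]]
  rfl

theorem pderiv_comm (hU : IsOpen U) (μ ν : Fin n) (f : SmoothAlg U) :
    pderiv hU μ (pderiv hU ν f) = pderiv hU ν (pderiv hU μ f) := by
  refine ext_eval fun x => ?_
  have hf := (SmoothAlg.contDiffOn_extend f).contDiffAt (hU.mem_nhds x.2)
  have hd : DifferentiableAt ℝ (fderiv ℝ (SmoothAlg.extend f)) x :=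
    (hf.fderiv_right (m := 1) (by norm_cast)).differentiableAt (by simp)
  have key (μ ν : Fin n) : eval x (pderiv hU μ (pderiv hU ν f))
      = fderiv ℝ (fderiv ℝ (SmoothAlg.extend f)) x (Pi.single μ 1) (Pi.single ν 1) := by
    rw [eval_pderiv hU μ _ (g := fun w => fderiv ℝ (extend f) w (Pi.single ν 1)) (fun _ => rfl),
      fderiv_clm_apply hd (differentiableAt_const _)]
    simp
  rw [key, key]
  exact hf.isSymmSndFDerivAt (by simp; norm_cast) _ _

end SmoothAlg

/-! ### Tetrads on the base, and the horizontal calculus over them -/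

section realization

variable {n : ℕ} {U : Set (Coord n)} {ℓ : Coord n → Fin n → Fin n → ℝ}

theorem contDiffOn_tetrad (hℓ : ∀ i α, ContDiffOn ℝ ∞ (fun x => ℓ x i α) U) :
    ContDiffOn ℝ ∞ ℓ U :=
  contDiffOn_pi.mpr fun i => contDiffOn_pi.mpr fun α => hℓ i α

theorem contDiffOn_inv (hℓ : ∀ i α, ContDiffOn ℝ ∞ (fun x => ℓ x i α) U)
    (hdet : ∀ x ∈ U, (Matrix.of (ℓ x)).det ≠ 0) (a b) :
    ContDiffOn ℝ ∞ (fun x => (Matrix.of (ℓ x))⁻¹ a b) U := fun x hx =>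
  (contDiffAt_inv_apply (hdet x hx) a b).comp_contDiffWithinAt x (contDiffOn_tetrad hℓ x hx)

/-- The differential frame of a smooth tetrad. -/
def tetradFrame (hU : IsOpen U) (hℓ : ∀ i α, ContDiffOn ℝ ∞ (fun x => ℓ x i α) U)
    (hdet : ∀ x ∈ U, (Matrix.of (ℓ x)).det ≠ 0) : DifferentialFrame (SmoothAlg U) n where
  up i α := SmoothAlg.mk (fun x => ℓ x i α) (hℓ i α)
  dn i β := SmoothAlg.mk (fun x => (Matrix.of (ℓ x))⁻¹ β i) (contDiffOn_inv hℓ hdet β i)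
  d := SmoothAlg.pderiv hU
  d_comm := SmoothAlg.pderiv_comm hU
  sum_up_dn α β := SmoothAlg.ext_eval fun x => by
    have h := congrArg (fun M => M β α)
      (Matrix.nonsing_inv_mul (Matrix.of (ℓ x)) (isUnit_iff_ne_zero.mpr (hdet x x.2)))
    simp only [Matrix.mul_apply, Matrix.of_apply, Matrix.one_apply] at h
    simp only [map_sum, map_mul, SmoothAlg.eval_mk, apply_ite (SmoothAlg.eval x), map_one, map_zero,
      eq_comm (a := α), ← h]
    exact Finset.sum_congr rfl fun _ _ => mul_comm _ _
  sum_dn_up i j := SmoothAlg.ext_eval fun x => by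
    have h := congrArg (fun M => M j i)
      (Matrix.mul_nonsing_inv (Matrix.of (ℓ x)) (isUnit_iff_ne_zero.mpr (hdet x x.2)))
    simp only [Matrix.mul_apply, Matrix.of_apply, Matrix.one_apply] at h
    simp only [map_sum, map_mul, SmoothAlg.eval_mk, apply_ite (SmoothAlg.eval x), map_one, map_zero,
      eq_comm (a := i), ← h]
    exact Finset.sum_congr rfl fun _ _ => mul_comm _ _

theorem apFrame_realizes (hU : IsOpen U) (hℓ : ∀ i α, ContDiffOn ℝ ∞ (fun x => ℓ x i α) U)
    (hdet : ∀ x ∈ U, (Matrix.of (ℓ x)).det ≠ 0) :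
    (apFrame ℓ).Realizes (tetradFrame hU hℓ hdet) SmoothAlg.eval where
  up _ _ _ := rfl
  D μ _ r h z := (SmoothAlg.eval_pderiv hU μ r h z).symm

variable {V : Set (Coord n)}

/-- Evaluation at the base point of `(x, y)`. -/
def evalBase (z : (U ×ˢ V : Set (TCoord n))) : SmoothAlg U →ₐ[ℝ] ℝ :=
  SmoothAlg.eval ⟨z.1.1, z.2.1⟩

theorem fderiv_of_evalBase (hU : IsOpen U) (hV : IsOpen V) {f : TCoord n → ℝ} {r : SmoothAlg U}
    (h : ∀ w : (U ×ˢ V : Set (TCoord n)), f w = evalBase w r) (z : (U ×ˢ V : Set (TCoord n)))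
    (v : TCoord n) : fderiv ℝ f z v = fderiv ℝ (SmoothAlg.extend r) z.1.1 v.1 := by
  have h1 : f =ᶠ[nhds z.1] fun w => (SmoothAlg.extend r) w.1 := by
    filter_upwards [(hU.prod hV).mem_nhds z.2] with w hw
    rw [h ⟨w, hw⟩]
    exact (SmoothAlg.extend_apply r ⟨w.1, hw.1⟩).symm
  have h2 : HasFDerivAt (fun w : TCoord n => (SmoothAlg.extend r) w.1)
      ((fderiv ℝ (SmoothAlg.extend r) z.1.1).comp (ContinuousLinearMap.fst ℝ _ _)) z.1 :=
    (SmoothAlg.differentiableAt_extend hU r ⟨z.1.1, z.2.1⟩).hasFDerivAt.comp z.1 hasFDerivAt_fst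
  rw [h1.fderiv_eq, h2.fderiv]; rfl

theorem pdx_of_evalBase (hU : IsOpen U) (hV : IsOpen V) {f : TCoord n → ℝ} {r : SmoothAlg U}
    (h : ∀ w : (U ×ˢ V : Set (TCoord n)), f w = evalBase w r) (z : (U ×ˢ V : Set (TCoord n)))
    (μ : Fin n) : pdx μ f z = evalBase z (SmoothAlg.pderiv hU μ r) :=
  fderiv_of_evalBase hU hV h z _

theorem pdy_of_evalBase (hU : IsOpen U) (hV : IsOpen V) {f : TCoord n → ℝ} {r : SmoothAlg U}
    (h : ∀ w : (U ×ˢ V : Set (TCoord n)), f w = evalBase w r) (z : (U ×ˢ V : Set (TCoord n)))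
    (c : Fin n) : pdy c f z = 0 := by
  rw [pdy, fderiv_of_evalBase hU hV h z, map_zero]

/-- Near a point of `U × V` the functions involved are pulled back from the base, so the `N` term of
`δ_μ` is killed and `∂_μ` remains. -/
theorem hor_realizes (hU : IsOpen U) (hV : IsOpen V)
    (hℓ : ∀ i α, ContDiffOn ℝ ∞ (fun x => ℓ x i α) U)
    (hdet : ∀ x ∈ U, (Matrix.of (ℓ x)).det ≠ 0) (L : LocalEAP n)
    (hL : ∀ x ∈ U, ∀ y ∈ V, L.hUp (x, y) = ℓ x) :
    L.hor.Realizes (tetradFrame hU hℓ hdet) (evalBase (V := V)) where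
  up z i α := congrFun (congrFun (hL z.1.1 z.2.1 z.1.2 z.2.2) i) α
  D μ f r h z := by
    change L.delta μ f z = _
    simp only [LocalEAP.delta, pdy_of_evalBase hU hV h z, mul_zero, Finset.sum_const_zero, sub_zero]
    exact pdx_of_evalBase hU hV h z μ

end realization

/-! ### Horizontal fields not depending on the directions -/

theorem isOpen_fibre {n : ℕ} {V : Set (Coord n)} (hV : ∀ y : Coord n, y ≠ 0 → y ∈ V) :
    IsOpen V := by
  by_cases h : (0 : Coord n) ∈ V
  · have : V = Set.univ := Set.eq_univ_of_forall fun y => by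
      by_cases hy : y = 0
      · exact hy ▸ h
      · exact hV y hy
    exact this ▸ isOpen_univ
  · have : V = {0}ᶜ := Set.ext fun y => ⟨fun hy h0 => h (h0 ▸ hy), fun hy => hV y hy⟩
    exact this ▸ isOpen_compl_singleton

/-- Rays replace connectedness of the fibre: `ℝⁿ ∖ {0}` is disconnected for `n = 1`. The frame is
constant on each open ray, and since `λ_i^α` is continuous at `y = 0`, all rays over `x` share the
value there. -/
theorem LocalEAP.hUp_eq_of_CH_eq_zero {n : ℕ} {U V : Set (Coord n)} (hU : IsOpen U)
    (hV : ∀ y : Coord n, y ≠ 0 → y ∈ V) (L : LocalEAP n)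
    (hs : ∀ i α, ContDiffOn ℝ ∞ (fun z => L.hUp z i α) (U ×ˢ Set.univ))
    (hdet : ∀ z ∈ U ×ˢ V, (Matrix.of (L.hUp z)).det ≠ 0)
    (hC : ∀ z ∈ U ×ˢ V, ∀ α μ c, L.CH z α μ c = 0) {x y : Coord n} (hx : x ∈ U) :
    L.hUp (x, y) = L.hUp (x, 0) := by
  by_cases hy0 : y = 0
  · rw [hy0]
  have hopen : IsOpen (U ×ˢ V) := hU.prod (isOpen_fibre hV)
  have hup : ∀ z ∈ U ×ˢ V, ContDiffAt ℝ ∞ L.hUp z := fun z hz =>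
    contDiffAt_pi.mpr fun i => contDiffAt_pi.mpr fun α =>
      (hs i α).contDiffAt ((hU.prod isOpen_univ).mem_nhds ⟨hz.1, trivial⟩)
  have hdown : ∀ z ∈ U ×ˢ V, ∀ i μ, DifferentiableAt ℝ (fun w => L.hor.down w i μ) z :=
    fun z hz i μ => ((contDiffAt_inv_apply (m := ∞) (hdet z hz) μ i).comp z
      (hup z hz)).differentiableAt (by simp)
  have hpdy : ∀ z ∈ U ×ˢ V, ∀ i μ c, pdy c (fun w => L.hor.down w i μ) z = 0 := by
    intro z hz i μ c
    -- `C^α_{μc}` is the vector of vertical derivatives multiplied by the invertible matrix `λ_i^α`.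
    have h1 : Matrix.vecMul (fun i => pdy c (fun w => L.hor.down w i μ) z) (Matrix.of (L.hUp z))
        = 0 := by
      funext α
      have := hC z hz α μ c
      simp only [LocalEAP.CH] at this
      simp only [Matrix.vecMul, dotProduct, Matrix.of_apply, Pi.zero_apply, ← this]
      exact Finset.sum_congr rfl fun _ _ => mul_comm _ _
    exact congrFun (Matrix.eq_zero_of_vecMul_eq_zero (hdet z hz) h1) i
  have hmem : ∀ t ∈ Set.Ioi (0 : ℝ), (x, t • y) ∈ U ×ˢ V := fun t ht =>
    ⟨hx, hV _ (smul_ne_zero (ne_of_gt ht) hy0)⟩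
  have hder : ∀ t ∈ Set.Ioi (0 : ℝ), ∀ i μ,
      HasDerivAt (fun t : ℝ => L.hor.down (x, t • y) i μ) 0 t := by
    intro t ht i μ
    have h1 : HasDerivAt (fun t : ℝ => ((x, t • y) : TCoord n)) (0, y) t := by
      have := (hasDerivAt_id t).smul_const y
      simp only [id, one_smul] at this
      exact (hasDerivAt_const t x).prodMk this
    have h2 := ((hdown _ (hmem t ht) i μ).hasFDerivAt).comp_hasDerivAt t h1
    have h3 : ((0, y) : TCoord n) = ∑ c, y c • ((0, Pi.single c 1) : TCoord n) := by
      ext c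
      · simp [Prod.fst_sum]
      · simp [Prod.snd_sum, Finset.sum_apply, Pi.single_apply]
    have h4 : fderiv ℝ (fun w => L.hor.down w i μ) (x, t • y) (0, y) = 0 := by
      rw [h3, map_sum]
      refine Finset.sum_eq_zero fun c _ => ?_
      rw [map_smul, show fderiv ℝ (fun w => L.hor.down w i μ) (x, t • y) (0, Pi.single c 1) = 0 from
        hpdy _ (hmem t ht) i μ c, smul_zero]
    rw [h4] at h2
    exact h2
  have hconst : ∀ t ∈ Set.Ioi (0 : ℝ), L.hUp (x, t • y) = L.hUp (x, y) := by
    intro t ht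
    have h1 : (Matrix.of (L.hUp (x, t • y)))⁻¹ = (Matrix.of (L.hUp (x, (1 : ℝ) • y)))⁻¹ := by
      ext μ i
      exact isOpen_Ioi.is_const_of_deriv_eq_zero isPreconnected_Ioi
        (f := fun t : ℝ => L.hor.down (x, t • y) i μ)
        (fun t ht => (hder t ht i μ).differentiableAt.differentiableWithinAt)
        (fun t ht => (hder t ht i μ).deriv) ht (by simp)
    have h2 := congrArg (fun M => M⁻¹) h1
    simp only [one_smul] at h2
    rw [Matrix.nonsing_inv_nonsing_inv _ (isUnit_iff_ne_zero.mpr (hdet _ (hmem t ht))),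
      Matrix.nonsing_inv_nonsing_inv _ (isUnit_iff_ne_zero.mpr (hdet _ ⟨hx, hV y hy0⟩))] at h2
    exact h2
  funext i α
  have hc : ContinuousAt (fun t : ℝ => L.hUp (x, t • y) i α) 0 := by
    have h1 : ContinuousAt (fun z => L.hUp z i α) (x, (0 : ℝ) • y) :=
      (hs i α).continuousOn.continuousAt ((hU.prod isOpen_univ).mem_nhds ⟨hx, trivial⟩)
    exact ContinuousAt.comp (f := fun t : ℝ => ((x, t • y) : TCoord n)) h1 (by fun_prop)
  have h1 : Filter.Tendsto (fun t : ℝ => L.hUp (x, t • y) i α) (nhdsWithin 0 (Set.Ioi 0))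
      (nhds (L.hUp (x, 0) i α)) := by
    have := hc.tendsto.mono_left (nhdsWithin_le_nhds (s := Set.Ioi (0 : ℝ)))
    simpa using this
  have h2 : Filter.Tendsto (fun t : ℝ => L.hUp (x, t • y) i α) (nhdsWithin 0 (Set.Ioi 0))
      (nhds (L.hUp (x, y) i α)) := by
    refine tendsto_const_nhds.congr' ?_
    filter_upwards [self_mem_nhdsWithin] with t ht
    rw [hconst t ht]
  exact tendsto_nhds_unique h2 h1

/-! ### Partial derivatives of the Lagrangian on first jets -/

variable {n : ℕ}

/-- `λ_j^α` as a function of `U j β = λ_{jβ}`. -/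
def invTr (U : Fin n → Fin n → ℝ) (j α : Fin n) : ℝ := (Matrix.of U)⁻¹ α j

/-- Every contravariant index comes from a factor `λ_j^α`, so regrouping these factors turns
coordinate contractions into frame contractions. This only rearranges sums, and `U` may be singular.
-/
theorem jetLagrangian_eq (U : Fin n → Fin n → ℝ) (P : Fin n → Fin n → Fin n → ℝ) :
    jetLagrangian U P = (Matrix.of U).det * torsionQuad (jetTorsion (invTr U) P) := by
  have hT (j k p) : jetTorsion (invTr U) P k j p
      = ∑ μ, invTr U p μ * ∑ α, invTr U j α * (P k α μ - P k μ α) := by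
    simp only [jetTorsion, Finset.mul_sum]
    rw [Finset.sum_comm]
    exact Finset.sum_congr rfl fun _ _ => Finset.sum_congr rfl fun _ _ => by ring
  have hC (p) : torsionTrace (jetTorsion (invTr U) P) p
      = ∑ μ, invTr U p μ * ∑ α, ∑ j, invTr U j α * (P j μ α - P j α μ) := by
    simp only [torsionTrace, jetTorsion, Finset.mul_sum]
    rw [Finset.sum_comm]
    refine Finset.sum_congr rfl fun μ _ => ?_
    rw [Finset.sum_comm]
    exact Finset.sum_congr rfl fun _ _ => Finset.sum_congr rfl fun _ _ => by ring
  have hq (x y : Fin n → Fin n → ℝ) :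
      ∑ α, ∑ ε, (∑ j, invTr U j α * x j ε) * (∑ k, invTr U k ε * y k α)
        = ∑ j, ∑ k, (∑ α, invTr U j α * y k α) * (∑ ε, invTr U k ε * x j ε) := by
    simp only [Finset.sum_mul_sum]
    refine (Finset.sum_congr rfl fun α _ => Finset.sum_comm).trans (Finset.sum_comm.trans
      (Finset.sum_congr rfl fun j _ => (Finset.sum_congr rfl fun α _ => Finset.sum_comm).trans
        (Finset.sum_comm.trans (Finset.sum_congr rfl fun k _ => Finset.sum_congr rfl fun α _ =>
          Finset.sum_congr rfl fun ε _ => by ring))))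
  have hg (X : Fin n → Fin n → ℝ) : ∑ μ, ∑ ν, (∑ p, invTr U p μ * invTr U p ν) * X μ ν
      = ∑ p, ∑ μ, ∑ ν, invTr U p μ * invTr U p ν * X μ ν := by
    simp only [Finset.sum_mul]
    exact (Finset.sum_congr rfl fun μ _ => Finset.sum_comm).trans Finset.sum_comm
  have hb (p) (v w : Fin n → ℝ) : ∑ μ, ∑ ν, invTr U p μ * invTr U p ν * (v μ * w ν)
      = (∑ μ, invTr U p μ * v μ) * ∑ ν, invTr U p ν * w ν := by
    rw [Finset.sum_mul_sum]
    exact Finset.sum_congr rfl fun _ _ => Finset.sum_congr rfl fun _ _ => by ring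
  have hs (p) (X : Fin n → Fin n → Fin n → Fin n → ℝ) :
      ∑ μ, ∑ ν, invTr U p μ * invTr U p ν * ∑ j, ∑ k, X j k μ ν
        = ∑ j, ∑ k, ∑ μ, ∑ ν, invTr U p μ * invTr U p ν * X j k μ ν := by
    simp only [Finset.mul_sum]
    exact (Finset.sum_congr rfl fun μ _ => Finset.sum_comm).trans (Finset.sum_comm.trans
      (Finset.sum_congr rfl fun j _ => (Finset.sum_congr rfl fun μ _ => Finset.sum_comm).trans
        Finset.sum_comm))
  change (Matrix.of U).det * ∑ μ, ∑ ν, (∑ p, invTr U p μ * invTr U p ν) *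
    ((∑ α, ∑ ε, (∑ j, invTr U j α * (P j ε μ - P j μ ε)) * (∑ j, invTr U j ε * (P j α ν - P j ν α)))
      - (∑ α, ∑ j, invTr U j α * (P j μ α - P j α μ))
        * (∑ α, ∑ j, invTr U j α * (P j ν α - P j α ν))) = _
  rw [hg]
  simp only [torsionQuad, mul_sub (invTr U _ _ * invTr U _ _), Finset.sum_sub_distrib]
  congr 2
  · refine Finset.sum_congr rfl fun p _ => ?_
    simp only [fun μ ν => hq (fun j ε => P j ε μ - P j μ ε) (fun k α => P k α ν - P k ν α), hs]
    refine Finset.sum_congr rfl fun j _ => Finset.sum_congr rfl fun k _ => ?_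
    rw [hT, hT, ← hb, Finset.sum_comm]
    exact Finset.sum_congr rfl fun _ _ => Finset.sum_congr rfl fun _ _ => by
      rw [mul_comm (invTr U p _) (invTr U p _)]
  · refine Finset.sum_congr rfl fun p _ => ?_
    rw [hC, ← hb]

theorem hasDerivAt_torsionTrace {t : ℝ → Fin n → Fin n → Fin n → ℝ}
    {s : Fin n → Fin n → Fin n → ℝ} {a : ℝ}
    (h : ∀ i j k, HasDerivAt (fun r => t r i j k) (s i j k) a) (j) :
    HasDerivAt (fun r => torsionTrace (t r) j) (torsionTrace s j) a := by
  simp only [torsionTrace]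
  exact HasDerivAt.fun_sum fun i _ => h i j i

theorem hasDerivAt_torsionQuad {t : ℝ → Fin n → Fin n → Fin n → ℝ}
    {s : Fin n → Fin n → Fin n → ℝ} {a : ℝ}
    (h : ∀ i j k, HasDerivAt (fun r => t r i j k) (s i j k) a) :
    HasDerivAt (fun r => torsionQuad (t r))
      (∑ i, ∑ j, ∑ k, torsionGrad (t a) i j k * s i j k) a := by
  have h1 : HasDerivAt (fun r => torsionQuad (t r))
      (∑ p, (∑ j, ∑ k, (s k j p * t a j k p + t a k j p * s j k p)
        - (torsionTrace s p * torsionTrace (t a) p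
          + torsionTrace (t a) p * torsionTrace s p))) a := by
    simp only [torsionQuad]
    exact HasDerivAt.fun_sum fun p _ => (HasDerivAt.fun_sum fun j _ => HasDerivAt.fun_sum fun k _ =>
      (h k j p).mul (h j k p)).sub ((hasDerivAt_torsionTrace h p).mul (hasDerivAt_torsionTrace h p))
  convert h1 using 1
  have h2 : ∑ i, ∑ j, ∑ k, (if i = k then torsionTrace (t a) j else 0) * s i j k
      = ∑ p, torsionTrace (t a) p * torsionTrace s p := by
    rw [Finset.sum_comm]
    simp only [ite_mul, zero_mul, Finset.sum_ite_eq, Finset.mem_univ, if_true, torsionTrace,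
      Finset.mul_sum]
  -- The two terms of the product rule are relabellings of the same sum, hence the factor `2` in
  -- `torsionGrad`.
  have h4 : ∑ i, ∑ j, ∑ k, t a j i k * s i j k = ∑ p, ∑ j, ∑ k, t a k j p * s j k p :=
    (Finset.sum_congr rfl fun i _ => Finset.sum_comm).trans Finset.sum_comm
  have h3 : ∑ i, ∑ j, ∑ k, t a j i k * s i j k = ∑ p, ∑ j, ∑ k, t a j k p * s k j p :=
    h4.trans (Finset.sum_congr rfl fun p _ => Finset.sum_comm)
  simp only [torsionGrad, sub_mul, mul_assoc, Finset.sum_sub_distrib, ← Finset.mul_sum, h2,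
    Finset.sum_add_distrib]
  rw [two_mul]
  nth_rw 1 [h3]
  rw [h4]
  simp only [mul_comm]
  ring

theorem hasDerivAt_add_mul (a b : ℝ) : HasDerivAt (fun r : ℝ => a + r * b) b 0 := by
  simpa using ((hasDerivAt_id (0 : ℝ)).mul_const b).const_add a

theorem jetTorsion_add_smul (u : Fin n → Fin n → ℝ) (P Q : Fin n → Fin n → Fin n → ℝ) (r : ℝ)
    (i j k) : jetTorsion u (P + r • Q) i j k = jetTorsion u P i j k + r * jetTorsion u Q i j k := by
  simp only [jetTorsion, Finset.mul_sum, ← Finset.sum_add_distrib, Pi.add_apply, Pi.smul_apply,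
    smul_eq_mul]
  exact Finset.sum_congr rfl fun _ _ => Finset.sum_congr rfl fun _ _ => by ring

/-- Reduces each partial derivative in jet space to calculus in one real variable, once
differentiability is known. -/
theorem fderiv_eq_of_hasDerivAt_line {E : Type*} [NormedAddCommGroup E] [NormedSpace ℝ E]
    {f : E → ℝ} {x v : E} {d : ℝ} (hf : DifferentiableAt ℝ f x)
    (hd : HasDerivAt (fun r : ℝ => f (x + r • v)) d 0) : fderiv ℝ f x v = d := by
  have h1 : HasDerivAt (fun r : ℝ => x + r • v) v 0 := by
    have := ((hasDerivAt_id (0 : ℝ)).smul_const v).const_add x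
    simpa using this
  have h2 : HasFDerivAt f (fderiv ℝ f x) (x + (0 : ℝ) • v) := by simpa using hf.hasFDerivAt
  exact (h2.comp_hasDerivAt (0 : ℝ) h1).unique hd

theorem jetTorsion_single (u : Fin n → Fin n → ℝ) (j β γ i a b : Fin n) :
    jetTorsion u (Pi.single j (Pi.single β (Pi.single γ 1))) i a b
      = if i = j then u a β * u b γ - u a γ * u b β else 0 := by
  by_cases h : i = j
  · subst h
    simp only [jetTorsion, Pi.single_eq_same, if_true, mul_sub, Finset.sum_sub_distrib]
    have key (β γ μ ν : Fin n) : (Pi.single β (Pi.single γ 1) : Fin n → Fin n → ℝ) μ ν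
        = (if μ = β then 1 else 0) * (if ν = γ then 1 else 0) := by
      by_cases h : μ = β
      · subst h; simp [Pi.single_apply]
      · simp [h]
    simp [key]
  · simp [jetTorsion, h]

theorem fderiv_jetLagrangian_momentum (U : Fin n → Fin n → ℝ) (P : Fin n → Fin n → Fin n → ℝ)
    (j β γ : Fin n) :
    fderiv ℝ (fun P => jetLagrangian U P) P (Pi.single j (Pi.single β (Pi.single γ 1)))
      = momentum (Matrix.of U).det (invTr U) (jetTorsion (invTr U) P) j β γ := by
  refine fderiv_eq_of_hasDerivAt_line ?_ ?_
  · simp only [jetLagrangian_eq, torsionQuad, torsionTrace, jetTorsion]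
    fun_prop
  · simp only [jetLagrangian_eq, momentum]
    refine HasDerivAt.const_mul _ ?_
    have h := hasDerivAt_torsionQuad (a := 0)
      (t := fun r => jetTorsion (invTr U) (P + r • (Pi.single j (Pi.single β (Pi.single γ 1)) :
        Fin n → Fin n → Fin n → ℝ)))
      (s := jetTorsion (invTr U) (Pi.single j (Pi.single β (Pi.single γ 1)))) (fun i a b => by
        simp only [jetTorsion_add_smul]
        exact hasDerivAt_add_mul _ _)
    refine h.congr_deriv ?_
    rw [Finset.sum_eq_single j (fun i _ hi => by simp [jetTorsion_single, hi])
      (by simp)]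
    simp [jetTorsion_single]

theorem hasDerivAt_det_line (U : Fin n → Fin n → ℝ) (hU : (Matrix.of U).det ≠ 0) (j β : Fin n) :
    HasDerivAt (fun r : ℝ =>
        (Matrix.of (U + r • (Pi.single j (Pi.single β 1) : Fin n → Fin n → ℝ))).det)
      ((Matrix.of U).det * invTr U j β) 0 := by
  -- Only row `j` changes, so the determinant is affine in `r`, with slope a cofactor.
  have h (r : ℝ) : (Matrix.of (U + r • (Pi.single j (Pi.single β 1) : Fin n → Fin n → ℝ))).det
      = (Matrix.of U).det + r * (Matrix.of U).adjugate β j := by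
    have h1 : Matrix.of (U + r • (Pi.single j (Pi.single β 1) : Fin n → Fin n → ℝ))
        = (Matrix.of U).updateRow j (U j + r • Pi.single β 1) := by
      ext a b
      by_cases h : a = j
      · subst h; simp
      · simp [h]
    rw [h1, Matrix.det_updateRow_add, Matrix.det_updateRow_smul, Matrix.adjugate_apply,
      show U j = (Matrix.of U) j from rfl, Matrix.updateRow_eq_self]
  have h2 : (Matrix.of U).det * invTr U j β = (Matrix.of U).adjugate β j := by
    rw [invTr, Matrix.inv_def, Matrix.smul_apply, smul_eq_mul, Ring.inverse_eq_inv',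
      mul_inv_cancel_left₀ hU]
  simp only [h, h2]
  exact hasDerivAt_add_mul _ _

theorem differentiableAt_invTr {U : Fin n → Fin n → ℝ} (hU : (Matrix.of U).det ≠ 0) (i α) :
    DifferentiableAt ℝ (fun U => invTr U i α) U :=
  (contDiffAt_inv_apply (m := 1) hU α i).differentiableAt (by simp)

/-- The derivative of the inverse is `-U⁻¹ V U⁻¹`: it exists by smoothness, and its value follows
from differentiating `U⁻¹ U = 1`, valid for small `r`. -/
theorem hasDerivAt_invTr_line (U : Fin n → Fin n → ℝ) (hU : (Matrix.of U).det ≠ 0)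
    (j β i α : Fin n) :
    HasDerivAt (fun r : ℝ => invTr (U + r • (Pi.single j (Pi.single β 1) : Fin n → Fin n → ℝ)) i α)
      (-(invTr U j α * invTr U i β)) 0 := by
  set V : Fin n → Fin n → ℝ := Pi.single j (Pi.single β 1) with hV
  have hl : HasDerivAt (fun r : ℝ => U + r • V) V 0 := by
    have := ((hasDerivAt_id (0 : ℝ)).smul_const V).const_add U
    simpa using this
  have h0 : U + (0 : ℝ) • V = U := by simp
  have hd (i α) : ∃ d, HasDerivAt (fun r : ℝ => invTr (U + r • V) i α) d 0 := by
    have h1 : HasFDerivAt (fun U => invTr U i α) (fderiv ℝ (fun U => invTr U i α) U)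
        (U + (0 : ℝ) • V) := by rw [h0]; exact (differentiableAt_invTr hU i α).hasFDerivAt
    refine ⟨fderiv ℝ (fun U => invTr U i α) U V, ?_⟩
    exact h1.comp_hasDerivAt (0 : ℝ) hl
  choose D hD using hd
  have hev : ∀ᶠ r : ℝ in nhds 0, (Matrix.of (U + r • V)).det ≠ 0 := by
    have := (hasDerivAt_det_line U hU j β).continuousAt
    refine this.eventually_ne ?_
    rw [← hV, h0]; exact hU
  have hW (a b) : ∑ k, (D k a * U k b + invTr U k a * V k b) = 0 := by
    have h1 : HasDerivAt (fun r : ℝ => ∑ k, invTr (U + r • V) k a * (U + r • V) k b)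
        (∑ k, (D k a * U k b + invTr U k a * V k b)) 0 := by
      refine HasDerivAt.fun_sum fun k _ => ?_
      have h2 : HasDerivAt (fun r : ℝ => (U + r • V) k b) (V k b) 0 :=
        (hasDerivAt_pi.mp ((hasDerivAt_pi.mp hl) k)) b
      have := (hD k a).fun_mul h2
      rwa [h0] at this
    have h2 : (fun r : ℝ => ∑ k, invTr (U + r • V) k a * (U + r • V) k b)
        =ᶠ[nhds 0] fun _ => (1 : Matrix (Fin n) (Fin n) ℝ) a b := by
      filter_upwards [hev] with r hr
      rw [← Matrix.nonsing_inv_mul _ (isUnit_iff_ne_zero.mpr hr)]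
      rfl
    exact (h1.congr_of_eventuallyEq h2.symm).unique (hasDerivAt_const _ _)
  have hM : (Matrix.of fun a k => D k a) * Matrix.of U
      = -((Matrix.of U)⁻¹ * Matrix.of V) := by
    ext a b
    have := hW a b
    rw [Finset.sum_add_distrib] at this
    simp only [Matrix.mul_apply, Matrix.of_apply, Matrix.neg_apply]
    exact eq_neg_of_add_eq_zero_left this
  have hM2 : (Matrix.of fun a k => D k a) = -((Matrix.of U)⁻¹ * Matrix.of V * (Matrix.of U)⁻¹) := by
    rw [← neg_mul, ← hM, mul_assoc, Matrix.mul_nonsing_inv _ (isUnit_iff_ne_zero.mpr hU), mul_one]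
  have hres : D i α = -(invTr U j α * invTr U i β) := by
    have h1 := congrArg (fun M => M α i) hM2
    simp only [Matrix.of_apply, Matrix.neg_apply] at h1
    rw [h1]
    have key (μ ν : Fin n) : V μ ν = (if μ = j then 1 else 0) * (if ν = β then 1 else 0) := by
      by_cases h : μ = j
      · subst h; simp [hV, Pi.single_apply]
      · simp [hV, h]
    simp [Matrix.mul_apply, key, invTr]
  rw [← hres]
  exact hD i α

theorem fderiv_jetLagrangian_field (U : Fin n → Fin n → ℝ) (hU : (Matrix.of U).det ≠ 0)
    (P : Fin n → Fin n → Fin n → ℝ) (j β : Fin n) :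
    fderiv ℝ (fun U => jetLagrangian U P) U (Pi.single j (Pi.single β 1))
      = fieldDeriv (Matrix.of U).det (invTr U) (jetTorsion (invTr U) P) j β := by
  refine fderiv_eq_of_hasDerivAt_line ?_ ?_
  · have h1 := differentiableAt_invTr hU
    have h2 : DifferentiableAt ℝ (fun U : Fin n → Fin n → ℝ => (Matrix.of U).det) U :=
      (contDiff_det n (m := 1)).differentiable (by simp) U
    simp only [jetLagrangian_eq, torsionQuad, torsionTrace, jetTorsion]
    fun_prop
  · simp only [jetLagrangian_eq]
    set V : Fin n → Fin n → ℝ := Pi.single j (Pi.single β 1) with hV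
    have h0 : U + (0 : ℝ) • V = U := by simp
    have ht (i a b) : HasDerivAt (fun r : ℝ => jetTorsion (invTr (U + r • V)) P i a b)
        (-(invTr U a β * jetTorsion (invTr U) P i j b + invTr U b β * jetTorsion (invTr U) P i a j))
        0 := by
      have h1 : HasDerivAt (fun r : ℝ => jetTorsion (invTr (U + r • V)) P i a b)
          (∑ μ, ∑ ν, (-(invTr U j μ * invTr U a β) * invTr U b ν
            + invTr U a μ * -(invTr U j ν * invTr U b β)) * (P i μ ν - P i ν μ)) 0 := by
        simp only [jetTorsion]
        refine HasDerivAt.fun_sum fun μ _ => HasDerivAt.fun_sum fun ν _ => HasDerivAt.mul_const ?_ _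
        have := (hasDerivAt_invTr_line U hU j β a μ).fun_mul (hasDerivAt_invTr_line U hU j β b ν)
        rwa [← hV, h0] at this
      convert h1 using 1
      simp only [jetTorsion, Finset.mul_sum, ← Finset.sum_add_distrib, ← Finset.sum_neg_distrib]
      exact Finset.sum_congr rfl fun _ _ => Finset.sum_congr rfl fun _ _ => by ring
    have h1 := (hasDerivAt_det_line U hU j β).fun_mul (hasDerivAt_torsionQuad ht)
    rw [← hV, h0] at h1
    refine h1.congr_deriv ?_
    simp only [fieldDeriv, mul_neg, Finset.sum_neg_distrib]
    ring

/-! ### Comparison of the Euler–Lagrange expression with `E` -/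

namespace DifferentialFrame

variable {R : Type*} [CommRing R] [Algebra ℝ R] {n : ℕ} (A : DifferentialFrame R n)

/-- The structure equation `d_dn_sub` read in frame components: the torsion depends only on the
first jet of the coframe. -/
theorem tt_eq_jetTorsion (i j k) :
    A.tt i j k = jetTorsion A.up (fun i μ ν => A.d ν (A.dn i μ)) i j k := by
  have h : A.fr2 (A.lo2 (A.tt i)) j k = A.tt i j k :=
    A.lo2_inj (A.lo2_fr2 (A.lo2 (A.tt i))) j k
  rw [← h]
  simp only [fr2, frLo, jetTorsion, ← d_dn_sub, Finset.mul_sum, mul_assoc]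

/-- The relation `E_eq_euler` solved for the variational derivative; it supplies the converse
direction of the equivalence of the two equations. -/
theorem euler_eq_E (j β) :
    A.euler j β = A.detDown * ∑ μ, A.gInv β μ * ∑ ν, A.up j ν * A.E μ ν := by
  have h (μ) : ∑ ν, A.up j ν * A.E μ ν = A.lo (fun i => A.eF i j) μ := by
    simp only [E_eq, lo2, A.lo_lo_comm _ μ]
    exact A.frLo_lo _ j
  simp only [euler_eq, h, sum_gInv_mul_lo]

/-- At a point, `E_{μν} = 0` splits into its symmetric and antisymmetric parts. -/
theorem map_E_eq_zero_iff (φ : R →ₐ[ℝ] ℝ) : (∀ μ ν, φ (A.E μ ν) = 0) ↔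
    (∀ μ ν, φ (A.einstein A.curv0 μ ν) = φ (A.T μ ν)) ∧
      ∀ μ ν, φ (A.F μ ν) = φ (A.d ν (A.C μ)) - φ (A.d μ (A.C ν)) := by
  have h (μ ν) : φ (A.E μ ν) = -2 * (φ (A.einstein A.curv0 μ ν) - φ (A.T μ ν))
      + 2 * (φ (A.F μ ν) - (φ (A.d ν (A.C μ)) - φ (A.d μ (A.C ν)))) := by
    simp only [E_split, map_add, map_sub, map_mul, map_neg, map_ofNat]
  refine ⟨fun h0 => ?_, fun ⟨h1, h2⟩ μ ν => by rw [h, h1, h2]; ring⟩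
  have hs (μ ν) : φ (A.einstein A.curv0 μ ν) - φ (A.T μ ν) = 0 ∧
      φ (A.F μ ν) - (φ (A.d ν (A.C μ)) - φ (A.d μ (A.C ν))) = 0 := by
    have h1 := (h μ ν).symm.trans (h0 μ ν)
    have h2 := (h ν μ).symm.trans (h0 ν μ)
    rw [A.einstein_curv0_symm ν, A.T_symm ν, A.F_antisymm ν, map_neg] at h2
    constructor <;> linarith
  exact ⟨fun μ ν => sub_eq_zero.mp (hs μ ν).1, fun μ ν => sub_eq_zero.mp (hs μ ν).2⟩

end DifferentialFrame

section EulerLagrange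

variable {n : ℕ} {U : Set (Coord n)} {ℓ : Coord n → Fin n → Fin n → ℝ}

theorem of_apFrame_down (x : Coord n) :
    Matrix.of ((apFrame ℓ).down x) = (Matrix.of (ℓ x))⁻¹.transpose := rfl

theorem det_apFrame_down_ne_zero {x : Coord n} (h : (Matrix.of (ℓ x)).det ≠ 0) :
    (Matrix.of ((apFrame ℓ).down x)).det ≠ 0 := by
  rw [of_apFrame_down, Matrix.det_transpose, Matrix.det_nonsing_inv, Ring.inverse_eq_inv']
  exact inv_ne_zero h

theorem invTr_apFrame_down {x : Coord n} (h : (Matrix.of (ℓ x)).det ≠ 0) :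
    invTr ((apFrame ℓ).down x) = ℓ x := by
  funext j α
  rw [invTr, of_apFrame_down, ← Matrix.transpose_nonsing_inv,
    Matrix.nonsing_inv_nonsing_inv _ (isUnit_iff_ne_zero.mpr h)]
  rfl

theorem apFrame_Lag_eq {x : Coord n} (h : (Matrix.of (ℓ x)).det ≠ 0) :
    (apFrame ℓ).Lag x = jetLagrangian ((apFrame ℓ).down x) (jet (apFrame ℓ).down x) := by
  have hi (j α) : (Matrix.of ((apFrame ℓ).down x))⁻¹ α j = ℓ x j α :=
    congrFun (congrFun (invTr_apFrame_down h) j) α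
  have hT (α μ ν) : (apFrame ℓ).Tor x α μ ν
      = ∑ j, ℓ x j α * (jet (apFrame ℓ).down x j μ ν - jet (apFrame ℓ).down x j ν μ) := by
    simp only [HFrame.Tor, HFrame.Gam, ← Finset.sum_sub_distrib, ← mul_sub]
    rfl
  simp only [jetLagrangian, hi, HFrame.Lag, HFrame.tr, HFrame.H, HFrame.C, hT]
  rfl

theorem eulerLagrange_apFrame (hU : IsOpen U) (hℓ : ∀ i α, ContDiffOn ℝ ∞ (fun x => ℓ x i α) U)
    (hdet : ∀ x ∈ U, (Matrix.of (ℓ x)).det ≠ 0) (x : U) (j β : Fin n) :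
    eulerLagrange (apFrame ℓ).down x j β
      = SmoothAlg.eval x ((tetradFrame hU hℓ hdet).euler j β) := by
  set A := tetradFrame hU hℓ hdet with hA
  have h := apFrame_realizes hU hℓ hdet
  have hu (w : U) : invTr ((apFrame ℓ).down w) = fun i α => SmoothAlg.eval w (A.up i α) :=
    invTr_apFrame_down (hdet w w.2)
  have hd (w : U) : (Matrix.of ((apFrame ℓ).down w)).det = SmoothAlg.eval w A.detDown :=
    h.detDown w
  have hj (w : U) : jet (apFrame ℓ).down w
      = fun i μ ν => SmoothAlg.eval w (A.d ν (A.dn i μ)) := by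
    funext i μ ν
    exact h.D_down w ν i μ
  have ht (w : U) : jetTorsion (invTr ((apFrame ℓ).down w)) (jet (apFrame ℓ).down w)
      = fun i j k => SmoothAlg.eval w (A.tt i j k) := by
    funext i j k
    rw [hu, hj, A.tt_eq_jetTorsion]
    exact (map_jetTorsion (SmoothAlg.eval w).toRingHom _ _ _ _ _).symm
  -- The momentum along the field is identified at every point of `U`, not just at `x`, because it
  -- is differentiated once more below.
  have hm (w : U) (γ : Fin n) :
      fderiv ℝ (fun P : Fin n → Fin n → Fin n → ℝ => jetLagrangian ((apFrame ℓ).down w) P)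
          (jet (apFrame ℓ).down w) (Pi.single j (Pi.single β (Pi.single γ 1)))
        = SmoothAlg.eval w (momentum A.detDown A.up A.tt j β γ) := by
    rw [fderiv_jetLagrangian_momentum, ht, hd, hu]
    exact (map_momentum (SmoothAlg.eval w).toRingHom _ _ _ _ _ _).symm
  rw [DifferentialFrame.euler, map_sub, map_sum, eulerLagrange]
  congr 1
  · rw [fderiv_jetLagrangian_field _ (det_apFrame_down_ne_zero (hdet x x.2)), ht, hd, hu]
    exact (map_fieldDeriv (SmoothAlg.eval x).toRingHom _ _ _ _ _).symm
  · refine Finset.sum_congr rfl fun γ _ => ?_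
    exact (SmoothAlg.eval_pderiv hU γ _ (fun w => hm w γ) x).symm

end EulerLagrange

/-! ### Vanishing of the vertical and mixed natural objects -/

namespace LocalEAP

variable {n : ℕ} {U V : Set (Coord n)} {ℓ : Coord n → Fin n → Fin n → ℝ}

theorem CH0_eq_zero (hU : IsOpen U) (hV : IsOpen V)
    (hℓ : ∀ i α, ContDiffOn ℝ ∞ (fun x => ℓ x i α) U)
    (hdet : ∀ x ∈ U, (Matrix.of (ℓ x)).det ≠ 0) (L : LocalEAP n)
    (hL : ∀ x ∈ U, ∀ y ∈ V, L.hUp (x, y) = ℓ x) (z : (U ×ˢ V : Set (TCoord n))) (α μ c : Fin n) :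
    L.CH0 z α μ c = 0 := by
  have h := hor_realizes hU hV hℓ hdet L hL
  simp only [CH0, fun μ ε => pdy_of_evalBase hU hV (f := fun w => L.hor.g w μ ε)
    (fun w => h.g w μ ε) z c, mul_zero, Finset.sum_const_zero]

theorem curvH_eq (hU : IsOpen U) (hV : IsOpen V)
    (hℓ : ∀ i α, ContDiffOn ℝ ∞ (fun x => ℓ x i α) U)
    (hdet : ∀ x ∈ U, (Matrix.of (ℓ x)).det ≠ 0) (L : LocalEAP n)
    (hL : ∀ x ∈ U, ∀ y ∈ V, L.hUp (x, y) = ℓ x) (z : (U ×ˢ V : Set (TCoord n)))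
    (α β μ ν : Fin n) :
    L.curvH z α β μ ν = evalBase z ((tetradFrame hU hℓ hdet).curv0 α β μ ν) := by
  simp only [curvH, CH0_eq_zero hU hV hℓ hdet L hL, mul_zero, Finset.sum_const_zero, sub_zero]
  exact (hor_realizes hU hV hℓ hdet L hL).curv0 z α β μ ν

theorem curvP_eq_zero (hU : IsOpen U) (hV : IsOpen V)
    (hℓ : ∀ i α, ContDiffOn ℝ ∞ (fun x => ℓ x i α) U)
    (hdet : ∀ x ∈ U, (Matrix.of (ℓ x)).det ≠ 0) (L : LocalEAP n)
    (hL : ∀ x ∈ U, ∀ y ∈ V, L.hUp (x, y) = ℓ x) (z : (U ×ˢ V : Set (TCoord n)))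
    (α β ν c : Fin n) : L.curvP z α β ν c = 0 := by
  have h := hor_realizes hU hV hℓ hdet L hL
  have h0 := CH0_eq_zero hU hV hℓ hdet L hL
  have h1 : L.delta ν (fun w => L.CH0 w α β c) z = 0 :=
    (h.D ν (fun w => L.CH0 w α β c) 0 (fun w => by rw [h0, map_zero]) z).trans (by simp)
  simp only [curvP, pdy_of_evalBase hU hV (f := fun w => L.hor.Gam0 w α β ν)
    (fun w => h.Gam0 w α β ν) z c, h1, h0]
  simp

end LocalEAP

/-- In the Berwald case the horizontal fields come from a tetrad on the base. -/
theorem EAPSpace.exists_tetrad {n : ℕ} {M : Type*} [TopologicalSpace M]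
    [ChartedSpace (Coord n) M] (S : EAPSpace n M) (hS : S.IsBerwald)
    {e : OpenPartialHomeomorph M (Coord n)}
    (he : e ∈ IsManifold.maximalAtlas 𝓘(ℝ, Coord n) ∞ M) :
    ∃ ℓ : Coord n → Fin n → Fin n → ℝ,
      (∀ i α, ContDiffOn ℝ ∞ (fun x => ℓ x i α) e.target) ∧
      (∀ x ∈ e.target, (Matrix.of (ℓ x)).det ≠ 0) ∧
      ∀ x ∈ e.target, ∀ y ∈ S.fibre, (S.loc e).hUp (x, y) = ℓ x := by
  have hb {x y : Coord n} (hx : x ∈ e.target) : (S.loc e).hUp (x, y) = (S.loc e).hUp (x, 0) :=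
    LocalEAP.hUp_eq_of_CH_eq_zero e.open_target S.mem_fibre_of_ne_zero (S.loc e)
      (S.smooth_hUp e he) (S.indep_h e he) (fun z hz => (hS e he z hz).2) hx
  refine ⟨fun x => (S.loc e).hUp (x, 0), fun i α => ?_, fun x hx => ?_, fun x hx y _ => hb hx⟩
  · exact (S.smooth_hUp e he i α).comp (f := fun x : Coord n => ((x, 0) : TCoord n))
      (contDiff_id.prodMk contDiff_const).contDiffOn fun x hx => ⟨hx, trivial⟩
  -- Independence is assumed only over the fibre, which may omit `0`, so the determinant is taken at
  -- a nonzero direction. For `n = 0` there is none, but the empty determinant is `1`.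
  · rcases Nat.eq_zero_or_pos n with rfl | hn
    · simp
    · have hy : (fun _ => 1 : Coord n) ≠ 0 := fun h => one_ne_zero (congrFun h ⟨0, hn⟩)
      have := S.indep_h e he (x, fun _ => 1) ⟨hx, S.mem_fibre_of_ne_zero _ hy⟩
      rwa [hb hx] at this

end EAP

end

/-! ### The main theorem: evaluation of the algebraic identities -/

open EAP in
theorem mainTheorem7 {n : ℕ} {M : Type*} [TopologicalSpace M] [ChartedSpace (EAP.Coord n) M]
    [IsManifold 𝓘(ℝ, EAP.Coord n) ∞ M] [T2Space M] [ParacompactSpace M]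
    (S : EAP.EAPSpace n M) (hS : S.IsBerwald)
    (e : OpenPartialHomeomorph M (EAP.Coord n))
    (he : e ∈ IsManifold.maximalAtlas 𝓘(ℝ, EAP.Coord n) ∞ M) :
    -- an AP-structure (tetrad) `ℓ` on the base, depending on `x` only
    ∃ ℓ : EAP.Coord n → Fin n → Fin n → ℝ,
      (∀ i α, ContDiffOn ℝ ∞ (fun x => ℓ x i α) e.target) ∧
      (∀ x ∈ e.target, (Matrix.of (ℓ x)).det ≠ 0) ∧
      (∀ x ∈ e.target, ∀ y ∈ S.fibre,
        let L := S.loc e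
        let H := L.hor
        let A := EAP.apFrame ℓ
        let z : EAP.TCoord n := (x, y)
        -- all horizontal objects depend on `x` only, and are those of the AP-space of `ℓ`
        (H.up z = A.up x ∧ H.down z = A.down x ∧ H.detDown z = A.detDown x ∧
          H.g z = A.g x ∧ H.gInv z = A.gInv x ∧
          H.Gam z = A.Gam x ∧ H.Gam0 z = A.Gam0 x ∧ H.Tor z = A.Tor x ∧
          H.gam z = A.gam x ∧ H.Om z = A.Om x ∧ H.C z = A.C x ∧
          H.xi z = A.xi x ∧ H.gam2 z = A.gam2 x ∧ H.eta z = A.eta x ∧ H.phi z = A.phi x ∧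
          H.chi z = A.chi x ∧ H.psi z = A.psi x ∧ H.eps z = A.eps x ∧
          H.theta z = A.theta x ∧ H.kappa z = A.kappa x ∧ H.varpi z = A.varpi x ∧
          H.sigma z = A.sigma x ∧ H.omega z = A.omega x ∧ H.alpha z = A.alpha x ∧
          L.curvH z = A.curv0 x ∧ H.H z = A.H x ∧ H.Lag z = A.Lag x ∧ H.E z = A.E x ∧
          H.T z = A.T x ∧ H.F z = A.F x ∧ H.J z = A.J x) ∧
        -- the mixed objects vanish
        (∀ α μ c, L.CH0 z α μ c = 0 ∧ L.CH z α μ c - L.CH0 z α μ c = 0) ∧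
        (∀ α β ν c, L.curvP z α β ν c = 0) ∧
        -- Ricci tensor, and the identity satisfied by the horizontal Einstein tensor
        (∀ β μ, EAP.HFrame.ricci L.curvH z β μ = EAP.HFrame.ricci L.curvH z μ β ∧
          EAP.HFrame.ricci L.curvH z β μ
            = - (1 / 2) * (H.theta z β μ - H.psi z β μ + H.phi z β μ) + H.omega z β μ) ∧
        (∀ σ, H.div0 (H.einstein L.curvH) z σ = 0) ∧
        -- the horizontal Euler–Lagrange equations are `E_{μν} = 0`
        H.Lag z = EAP.jetLagrangian (A.down x) (EAP.jet A.down x) ∧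
        (∀ μ ν, H.E z μ ν = ∑ β, H.g z μ β *
          ((1 / H.detDown z) * ∑ j, EAP.eulerLagrange A.down x j β * H.down z j ν)) ∧
        ((∀ j β, EAP.eulerLagrange A.down x j β = 0) ↔ ∀ μ ν, H.E z μ ν = 0) ∧
        -- these split into the Einstein equations and `F` = curl of `C`
        ((∀ μ ν, H.E z μ ν = 0) ↔
          (∀ μ ν, H.einstein L.curvH z μ ν = H.T z μ ν) ∧
          (∀ μ ν, H.F z μ ν
            = EAP.pdx ν (fun w => H.C w μ) z - EAP.pdx μ (fun w => H.C w ν) z)) ∧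
        -- conservation of the current
        H.divJ z = 0) ∧
      -- consequences of the field equations on the whole chart
      ((∀ x ∈ e.target, ∀ y ∈ S.fibre, ∀ μ ν, (S.loc e).hor.E (x, y) μ ν = 0) →
        ∀ x ∈ e.target, ∀ y ∈ S.fibre,
          let L := S.loc e
          let H := L.hor
          let z : EAP.TCoord n := (x, y)
          -- conservation law of the energy-momentum tensor
          (∀ ν, H.div0 H.T z ν = 0) ∧
          -- the cyclic identity of the electromagnetic field
          (∀ μ ν σ,
            H.cycF z μ ν σ
              = - ((∑ a, L.RN z a μ ν * EAP.pdy a (fun w => H.C w σ) z)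
                  + (∑ a, L.RN z a ν σ * EAP.pdy a (fun w => H.C w μ) z)
                  + (∑ a, L.RN z a σ μ * EAP.pdy a (fun w => H.C w ν) z)) ∧
            H.cycF z μ ν σ = 0)) := by
  have hU : IsOpen e.target := e.open_target
  have hV : IsOpen S.fibre := isOpen_fibre S.mem_fibre_of_ne_zero
  obtain ⟨ℓ, hℓ, hdet, hL⟩ := S.exists_tetrad hS he
  refine ⟨ℓ, hℓ, hdet, fun x hx y hy => ?_, fun hE x hx y hy => ?_⟩
  · have hA := apFrame_realizes hU hℓ hdet
    have hH := hor_realizes hU hV hℓ hdet (S.loc e) hL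
    have hK := LocalEAP.curvH_eq hU hV hℓ hdet (S.loc e) hL
    have hEL := eulerLagrange_apFrame hU hℓ hdet ⟨x, hx⟩
    have hCH := (hS e he (x, y) ⟨hx, hy⟩).2
    have hCH0 := LocalEAP.CH0_eq_zero hU hV hℓ hdet (S.loc e) hL ⟨(x, y), hx, hy⟩
    have hP := LocalEAP.curvP_eq_zero hU hV hℓ hdet (S.loc e) hL ⟨(x, y), hx, hy⟩
    have hLag : (S.loc e).hor.Lag (x, y) = (apFrame ℓ).Lag x :=
      (hH.Lag ⟨(x, y), hx, hy⟩).trans (hA.Lag ⟨x, hx⟩).symm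
    set A := tetradFrame hU hℓ hdet with hAdef
    have hcurl (μ ν) := pdx_of_evalBase hU hV (f := fun w => (S.loc e).hor.C w μ)
      (fun w => hH.C w μ) ⟨(x, y), hx, hy⟩ ν
    set φ := evalBase (U := e.target) (V := S.fibre) ⟨(x, y), hx, hy⟩ with hφ
    have hEz (μ ν) : (S.loc e).hor.E (x, y) μ ν = φ (A.E μ ν) := hH.E ⟨(x, y), hx, hy⟩ μ ν
    have hδ : φ A.detDown ≠ 0 := by
      rw [← show (apFrame ℓ).detDown x = φ A.detDown from hA.detDown ⟨x, hx⟩]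
      exact det_apFrame_down_ne_zero (hdet x hx)
    refine ⟨⟨?_, ?_, ?_, ?_, ?_, ?_, ?_, ?_, ?_, ?_, ?_, ?_, ?_, ?_, ?_, ?_, ?_, ?_, ?_, ?_, ?_,
      ?_, ?_, ?_, ?_, ?_, ?_, ?_, ?_, ?_, ?_⟩, fun α μ c => ⟨hCH0 α μ c, ?_⟩, hP, fun β μ => ?_,
      fun σ => ?_, ?_, fun μ ν => ?_, ?_, ?_, ?_⟩
    · exact hL x hx y hy
    · funext i β; exact (hH.down ⟨(x, y), hx, hy⟩ i β).trans (hA.down ⟨x, hx⟩ i β).symm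
    · exact (hH.detDown ⟨(x, y), hx, hy⟩).trans (hA.detDown ⟨x, hx⟩).symm
    · funext μ ν; exact (hH.g ⟨(x, y), hx, hy⟩ μ ν).trans (hA.g ⟨x, hx⟩ μ ν).symm
    · funext μ ν; exact (hH.gInv ⟨(x, y), hx, hy⟩ μ ν).trans (hA.gInv ⟨x, hx⟩ μ ν).symm
    · funext α μ ν; exact (hH.Gam ⟨(x, y), hx, hy⟩ α μ ν).trans (hA.Gam ⟨x, hx⟩ α μ ν).symm
    · funext α μ ν; exact (hH.Gam0 ⟨(x, y), hx, hy⟩ α μ ν).trans (hA.Gam0 ⟨x, hx⟩ α μ ν).symm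
    · funext α μ ν; exact (hH.Tor ⟨(x, y), hx, hy⟩ α μ ν).trans (hA.Tor ⟨x, hx⟩ α μ ν).symm
    · funext α μ ν; exact (hH.gam ⟨(x, y), hx, hy⟩ α μ ν).trans (hA.gam ⟨x, hx⟩ α μ ν).symm
    · funext α μ ν; exact (hH.Om ⟨(x, y), hx, hy⟩ α μ ν).trans (hA.Om ⟨x, hx⟩ α μ ν).symm
    · funext μ; exact (hH.C ⟨(x, y), hx, hy⟩ μ).trans (hA.C ⟨x, hx⟩ μ).symm
    · funext μ ν; exact (hH.xi ⟨(x, y), hx, hy⟩ μ ν).trans (hA.xi ⟨x, hx⟩ μ ν).symm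
    · funext μ ν; exact (hH.gam2 ⟨(x, y), hx, hy⟩ μ ν).trans (hA.gam2 ⟨x, hx⟩ μ ν).symm
    · funext μ ν; exact (hH.eta ⟨(x, y), hx, hy⟩ μ ν).trans (hA.eta ⟨x, hx⟩ μ ν).symm
    · funext μ ν; exact (hH.phi ⟨(x, y), hx, hy⟩ μ ν).trans (hA.phi ⟨x, hx⟩ μ ν).symm
    · funext μ ν; exact (hH.chi ⟨(x, y), hx, hy⟩ μ ν).trans (hA.chi ⟨x, hx⟩ μ ν).symm
    · funext μ ν; exact (hH.psi ⟨(x, y), hx, hy⟩ μ ν).trans (hA.psi ⟨x, hx⟩ μ ν).symm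
    · funext μ ν; exact (hH.eps ⟨(x, y), hx, hy⟩ μ ν).trans (hA.eps ⟨x, hx⟩ μ ν).symm
    · funext μ ν; exact (hH.theta ⟨(x, y), hx, hy⟩ μ ν).trans (hA.theta ⟨x, hx⟩ μ ν).symm
    · funext μ ν; exact (hH.kappa ⟨(x, y), hx, hy⟩ μ ν).trans (hA.kappa ⟨x, hx⟩ μ ν).symm
    · funext μ ν; exact (hH.varpi ⟨(x, y), hx, hy⟩ μ ν).trans (hA.varpi ⟨x, hx⟩ μ ν).symm
    · funext μ ν; exact (hH.sigma ⟨(x, y), hx, hy⟩ μ ν).trans (hA.sigma ⟨x, hx⟩ μ ν).symm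
    · funext μ ν; exact (hH.omega ⟨(x, y), hx, hy⟩ μ ν).trans (hA.omega ⟨x, hx⟩ μ ν).symm
    · funext μ ν; exact (hH.alpha ⟨(x, y), hx, hy⟩ μ ν).trans (hA.alpha ⟨x, hx⟩ μ ν).symm
    · funext α β μ ν
      exact (hK ⟨(x, y), hx, hy⟩ α β μ ν).trans (hA.curv0 ⟨x, hx⟩ α β μ ν).symm
    · funext μ ν; exact (hH.H ⟨(x, y), hx, hy⟩ μ ν).trans (hA.H ⟨x, hx⟩ μ ν).symm
    · exact hLag
    · funext μ ν; exact (hH.E ⟨(x, y), hx, hy⟩ μ ν).trans (hA.E ⟨x, hx⟩ μ ν).symm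
    · funext μ ν; exact (hH.T ⟨(x, y), hx, hy⟩ μ ν).trans (hA.T ⟨x, hx⟩ μ ν).symm
    · funext μ ν; exact (hH.F ⟨(x, y), hx, hy⟩ μ ν).trans (hA.F ⟨x, hx⟩ μ ν).symm
    · funext μ; exact (hH.J ⟨(x, y), hx, hy⟩ μ).trans (hA.J ⟨x, hx⟩ μ).symm
    · rw [hCH, hCH0 α μ c, sub_zero]
    · have hR (β μ) : HFrame.ricci (S.loc e).curvH (x, y) β μ
          = φ (DifferentialFrame.ricci A.curv0 β μ) :=
        HFrame.Realizes.ricci hK ⟨(x, y), hx, hy⟩ β μ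
      refine ⟨by rw [hR, hR, A.ricci_curv0_symm], ?_⟩
      rw [hR, A.ricci_curv0_formula, hH.theta ⟨(x, y), hx, hy⟩, hH.psi ⟨(x, y), hx, hy⟩,
        hH.phi ⟨(x, y), hx, hy⟩, hH.omega ⟨(x, y), hx, hy⟩]
      simp only [map_add, map_sub, map_mul, map_neg, hφ, HFrame.Realizes.half_eq]
    · exact (hH.div0 (hH.einstein hK) ⟨(x, y), hx, hy⟩ σ).trans (by rw [A.div0_einstein, map_zero])
    · exact hLag.trans (apFrame_Lag_eq (hdet x hx))
    · have h1 := congrArg φ (A.E_eq_euler μ ν)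
      simp only [map_mul, map_sum] at h1
      rw [hEz, show (S.loc e).hor.detDown (x, y) = φ A.detDown from hH.detDown ⟨(x, y), hx, hy⟩,
        eq_comm]
      refine (mul_left_cancel₀ hδ ?_).symm
      rw [h1, Finset.mul_sum]
      refine Finset.sum_congr rfl fun β _ => ?_
      have h2 : ∑ j, eulerLagrange (apFrame ℓ).down x j β * (S.loc e).hor.down (x, y) j ν
          = ∑ j, φ (A.euler j β) * φ (A.dn j ν) :=
        Finset.sum_congr rfl fun j _ =>
          congrArg₂ _ (hEL j β) (hH.down ⟨(x, y), hx, hy⟩ j ν)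
      rw [h2, show (S.loc e).hor.g (x, y) μ β = φ (A.g μ β) from hH.g ⟨(x, y), hx, hy⟩ μ β]
      field_simp
    · have hEL' (j β) : eulerLagrange (apFrame ℓ).down x j β = φ (A.euler j β) := hEL j β
      simp only [hEz, hEL']
      refine ⟨fun h μ ν => ?_, fun h j β => ?_⟩
      · have h1 := congrArg φ (A.E_eq_euler μ ν)
        simp only [map_mul, map_sum, h, zero_mul, Finset.sum_const_zero, mul_zero] at h1
        exact (mul_eq_zero.mp h1).resolve_left hδ
      · simp only [A.euler_eq_E, map_mul, map_sum, h, mul_zero, Finset.sum_const_zero]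
    · simp only [hEz, A.map_E_eq_zero_iff φ]
      refine and_congr (forall₂_congr fun μ ν => ?_) (forall₂_congr fun μ ν => ?_)
      · rw [hH.einstein hK ⟨(x, y), hx, hy⟩, hH.T ⟨(x, y), hx, hy⟩]
      · rw [hH.F ⟨(x, y), hx, hy⟩, hcurl, hcurl]; rfl
    · exact (hH.divJ ⟨(x, y), hx, hy⟩).trans (by rw [A.divJ_eq_zero, map_zero])
  · have hH := hor_realizes hU hV hℓ hdet (S.loc e) hL
    set A := tetradFrame hU hℓ hdet with hAdef
    -- With `y` fixed, the field equations over all base points become equalities in the function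
    -- algebra, which may then be differentiated.
    have hsplit (w : e.target) :=
      (A.map_E_eq_zero_iff (SmoothAlg.eval w)).mp fun μ ν =>
        (hH.E ⟨(w.1, y), w.2, hy⟩ μ ν).symm.trans (hE w w.2 y hy μ ν)
    have hT : A.einstein A.curv0 = A.T := by
      funext μ ν; exact SmoothAlg.ext_eval fun w => (hsplit w).1 μ ν
    have hF (μ ν) : A.F μ ν = A.d ν (A.C μ) - A.d μ (A.C ν) :=
      SmoothAlg.ext_eval fun w => ((hsplit w).2 μ ν).trans (map_sub _ _ _).symm
    have hcyc (μ ν σ) : (S.loc e).hor.cycF (x, y) μ ν σ = 0 :=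
      (hH.cycF ⟨(x, y), hx, hy⟩ μ ν σ).trans (by rw [A.cycF_eq_zero hF, map_zero])
    have hC (μ a) := pdy_of_evalBase hU hV (f := fun w => (S.loc e).hor.C w μ)
      (fun w => hH.C w μ) ⟨(x, y), hx, hy⟩ a
    refine ⟨fun ν => ?_, fun μ ν σ => ⟨?_, hcyc μ ν σ⟩⟩
    · refine (hH.div0 hH.T ⟨(x, y), hx, hy⟩ ν).trans ?_
      rw [← hT, A.div0_einstein, map_zero]
    -- Both sides vanish separately: `C_σ` does not depend on `y`, so each term with `R^a_{μν}` is
    -- zero.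
    · rw [hcyc]
      simp only [hC, mul_zero, Finset.sum_const_zero, add_zero, neg_zero]
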